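/- \textbf{Setting.} A \emph{polygonal set} is a nonempty connected subset of $\mathbb{R}^2$ which is the interior of a finite union of closed nondegenerate triangles. Let $\Omega\subset\mathbb{R}^2$ be a polygonal set whose closure $\overline\Omega$ is contractible. Let $\mathcal{M}_h=\mathcal{T}_h\cup\mathcal{E}_h\cup\mathcal{V}_h$ be a finite polygonal mesh of $\Omega$: the elements $T\in\mathcal{T}_h$ are pairwise disjoint polygonal sets with $\overline\Omega=\bigcup_T\overline T$; the edges $E\in\mathcal{E}_h$ are open nondegenerate segments whose endpoints are the vertices $\nu\in\mathcal{V}_h$ (with coordinates $x_\nu$), every vertex being an endpoint of some edge; the edges are pairwise disjoint and contain no vertex; $\bigcup_T\partial T=\bigcup_E\overline E$; and each edge is contained either in $\partial T_1\cap\partial T_2$ for two distinct elements $T_1,T_2$, or in $\partial T\cap\partial\Omega$ for some element $T$. Assume that every element $T$ is contractible, and fix a point $x_T\in T$. Let $\mathcal{E}_T$ be the set of edges contained in $\partial T$. Each edge $E$ is oriented by a unit tangent $t_E$; $n_E$ is the unit normal such that $(t_E,n_E)$ is right-handed, and, for $E\in\mathcal{E}_T$, $\omega_{TE}\in\{-1,1\}$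 is such that $\omega_{TE}n_E$ points out of $T$. For $Y\in\mathcal{T}_h\cup\mathcal{E}_h$, $\mathcal{P}^m(Y)$ is the space of restrictions to $Y$ of polynomials in two variables of total degree $\le m$ ($\{0\}$ if $m=-1$). With $\mathbf{rot}\,q=(\partial_2q,-\partial_1q)$, put $\mathcal{R}^m(T)=\mathbf{rot}\,\mathcal{P}^{m+1}(T)$ and $\mathcal{R}^{c,m}(T)=(x-x_T)\mathcal{P}^{m-1}(T)$. The letter $\pi$ denotes $L^2$-orthogonal projectors. For an integer $k\ge0$ let \[ \begin{aligned} V_h&=\prod_T\mathcal{P}^{k-1}(T)\times\prod_E\mathcal{P}^{k-1}(E)\times\prod_\nu\mathbb{R},\qquad W_h=\prod_T\mathcal{P}^{k}(T)\times\prod_E\mathcal{P}^{k-1}(E)\times\prod_\nu\mathbb{R},\\ \Sigma_h&=\prod_T\big(\mathcal{R}^{k-1}(T)\times\mathcal{R}^{c,k}(T)\big)\times\prod_E\big(\mathcal{P}^k(E)\times\mathcal{P}^{k-1}(E)\big)\times\prod_\nu\mathbb{R}, \end{aligned} \] with elements written $q=((q_T)_T,(q_E)_E,(q_\nu)_\nu)$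 in $V_h$ (and similarly in $W_h$), and $v=((v_{\mathcal R,T},v^c_{\mathcal R,T})_T,(v_E,C_{v,E})_E,(C_{v,\nu})_\nu)$ in $\Sigma_h$. \textbf{Maps.} For $c\in\mathbb{R}$, $I_{V,h}c=\big((\pi^{k-1}_Tc)_T,(\pi^{k-1}_Ec)_E,(c)_\nu\big)$. For $q\in V_h$, $P_E q\in\mathcal{P}^{k+1}(E)$ is the unique polynomial with $P_Eq(x_\nu)=q_\nu$ at both endpoints of $E$ and $\pi^{k-1}_EP_Eq=q_E$; $G_E^kq=(P_Eq)'$ is its derivative along $t_E$; and $G_T^kq\in\mathcal{P}^k(T)^2$ is defined by \[\int_TG_T^kq\cdot w=-\int_Tq_T\,\mathrm{div}\,w+\sum_{E\in\mathcal{E}_T}\omega_{TE}\int_EP_Eq\,(w\cdot n_E)\qquad\forall w\in\mathcal{P}^k(T)^2 .\] For $v\in\Sigma_h$, $R_T^kv\in\mathcal{P}^k(T)$ is defined by \[\int_TR_T^kv\;r=\int_Tv_{\mathcal R,T}\cdot\mathbf{rot}\,r-\sum_{E\in\mathcal{E}_T}\omega_{TE}\int_Ev_E\,r\qquad\forall r\in\mathcal{P}^k(T).\]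 Finally, \[G_h^kq=\big((\pi_{\mathcal R^{k-1}(T)}G_T^kq,\ \pi_{\mathcal R^{c,k}(T)}G_T^kq)_T,(G_E^kq,0)_E,(0)_\nu\big),\qquad R_h^kv=\big((R_T^kv)_T,(C_{v,E})_E,(C_{v,\nu})_\nu\big).\] \textbf{Theorem (Exactness).} For every $k\ge0$ the sequence of linear maps \[\mathbb{R}\xrightarrow{\ I_{V,h}\ }V_h\xrightarrow{\ G_h^k\ }\Sigma_h\xrightarrow{\ R_h^k\ }W_h\xrightarrow{\ 0\ }0\] is an exact complex: $\ker G_h^k=I_{V,h}(\mathbb{R})$, $\ker R_h^k=\operatorname{im}G_h^k$, and $R_h^k$ is surjective. -/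

import Mathlib

open MeasureTheory Set Topology

noncomputable section

namespace RotRot

/-! ## Polygonal sets and polygonal meshes -/

/-- The Euclidean plane; the coordinates `x₁, x₂` are `x 0, x 1`. -/
abbrev Plane := EuclideanSpace ℝ (Fin 2)

/-- A polygonal set: a nonempty connected set which is the interior of a finite union of closed
nondegenerate triangles. Such a set is open and bounded. -/
def IsPolygonalSet (S : Set Plane) : Prop :=
  IsConnected S ∧ ∃ t : Finset (Fin 3 → Plane),
    (∀ p ∈ t, AffineIndependent ℝ p) ∧ S = interior (⋃ p ∈ t, convexHull ℝ (range p))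

/-- A polygonal mesh of `Ω` with elements, edges and vertices indexed by `ιT`, `ιE`, `ιV`.
Elements are disjoint open polygonal sets covering `Ω` up to their boundaries; edges are open
segments with end points in the set of vertices; edges and vertices are pairwise disjoint and
partition the mesh skeleton. Each edge is either an interface between two distinct elements or a
boundary edge. The order `src`, `tgt` of the end points of an edge fixes its orientation.
Hanging nodes are allowed: several collinear edges may lie on one geometric side of an element. -/
structure PolygonalMesh (Ω : Set Plane) (ιT ιE ιV : Type*) where
  /-- the (open) mesh elements -/
  elem : ιT → Set Plane
  /-- the mesh vertices -/
  vtx : ιV → Plane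
  /-- the starting vertex of an oriented edge -/
  src : ιE → ιV
  /-- the final vertex of an oriented edge -/
  tgt : ιE → ιV
  /-- the point `x_T` inside `T` -/
  center : ιT → Plane
  elem_polygonal : ∀ T, IsPolygonalSet (elem T)
  elem_disjoint : Pairwise fun T T' => Disjoint (elem T) (elem T')
  elem_cover : closure Ω = ⋃ T, closure (elem T)
  vtx_injective : Function.Injective vtx
  src_ne_tgt : ∀ E, src E ≠ tgt E
  edge_disjoint : Pairwise fun E E' =>
    Disjoint (openSegment ℝ (vtx (src E)) (vtx (tgt E)))
      (openSegment ℝ (vtx (src E')) (vtx (tgt E')))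
  vtx_notMem_edge : ∀ v E, vtx v ∉ openSegment ℝ (vtx (src E)) (vtx (tgt E))
  vtx_endpoint : ∀ v, ∃ E, v = src E ∨ v = tgt E
  skeleton : ⋃ T, frontier (elem T) = ⋃ E, segment ℝ (vtx (src E)) (vtx (tgt E))
  edge_interface_or_boundary : ∀ E,
    (∃ T T', T ≠ T' ∧ openSegment ℝ (vtx (src E)) (vtx (tgt E)) ⊆
      frontier (elem T) ∩ frontier (elem T')) ∨
    (∃ T, openSegment ℝ (vtx (src E)) (vtx (tgt E)) ⊆ frontier (elem T) ∩ frontier Ω)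
  center_mem : ∀ T, center T ∈ elem T

/-! ## Polynomials and first-order operators

Polynomial functions on an element (a nonempty open set) are identified with polynomials in two
variables, and polynomial functions on an edge with polynomials in the arc length. -/

/-- Polynomials in the two coordinates. -/
abbrev Poly2 := MvPolynomial (Fin 2) ℝ

/-- Vector-valued polynomials. -/
abbrev VPoly2 := Fin 2 → Poly2

/-- Polynomials in two variables of total degree at most `m` (only `0` if `m < 0`). -/
def polyT (m : ℤ) : Submodule ℝ Poly2 :=
  MvPolynomial.restrictSupport ℝ {d | (d.degree : ℤ) ≤ m}

/-- Polynomials in the arc length of degree at most `m` (only `0` if `m < 0`). -/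
def polyE (m : ℤ) : Submodule ℝ (Polynomial ℝ) :=
  Polynomial.degreeLT ℝ (m + 1).toNat

/-- Vector-valued polynomials with components of total degree at most `m`. -/
def vPolyT (m : ℤ) : Submodule ℝ VPoly2 :=
  Submodule.pi univ fun _ => polyT m

/-- The vector rotor `rot q = (∂₂ q, -∂₁ q)`. -/
def vrot : Poly2 →ₗ[ℝ] VPoly2 where
  toFun q := ![MvPolynomial.pderiv 1 q, -MvPolynomial.pderiv 0 q]
  map_add' p q := by
    funext i; fin_cases i
    · simp
    · simp [add_comm]
  map_smul' c p := by
    funext i; fin_cases i <;> simp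

/-- The divergence `div v = ∂₁ v₁ + ∂₂ v₂`. -/
def pdiv : VPoly2 →ₗ[ℝ] Poly2 where
  toFun v := MvPolynomial.pderiv 0 (v 0) + MvPolynomial.pderiv 1 (v 1)
  map_add' p q := by simp; ring
  map_smul' c p := by simp

/-- Multiplication by `x - c`. -/
def koszul (c : Plane) : Poly2 →ₗ[ℝ] VPoly2 where
  toFun p := fun i => (MvPolynomial.X i - MvPolynomial.C (c i)) * p
  map_add' p q := by funext i; simp [mul_add]
  map_smul' a p := by funext i; simp

/-- The space `R^m = rot P^{m+1}`. -/
def roly (m : ℤ) : Submodule ℝ VPoly2 := (polyT (m + 1)).map vrot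

/-- The Koszul complement `R^{c,m} = (x - c) P^{m-1}`. -/
def croly (c : Plane) (m : ℤ) : Submodule ℝ VPoly2 := (polyT (m - 1)).map (koszul c)

instance polyT_finite (m : ℤ) : FiniteDimensional ℝ (polyT m) := by
  have h : polyT m ≤ MvPolynomial.restrictTotalDegree (Fin 2) ℝ m.toNat := by
    apply MvPolynomial.restrictSupport_mono
    intro d hd
    have hd' : (d.degree : ℤ) ≤ m := hd
    have : d.degree ≤ m.toNat := by omega
    simpa [Finsupp.degree_eq_sum, Finsupp.sum_fintype] using this
  exact Submodule.finiteDimensional_of_le h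

instance polyE_finite (m : ℤ) : FiniteDimensional ℝ (polyE m) :=
  (Polynomial.degreeLTEquiv ℝ (m + 1).toNat).symm.finiteDimensional

instance vPolyT_finite (m : ℤ) : FiniteDimensional ℝ (vPolyT m) := by
  let f : vPolyT m →ₗ[ℝ] (Fin 2 → polyT m) :=
    { toFun := fun v i => ⟨v.1 i, v.2 i (mem_univ i)⟩
      map_add' := fun _ _ => rfl
      map_smul' := fun _ _ => rfl }
  refine FiniteDimensional.of_injective f ?_
  intro v w h
  ext1
  funext i
  exact congrArg Subtype.val (congrFun h i)

instance roly_finite (m : ℤ) : FiniteDimensional ℝ (roly m) := by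
  unfold roly; infer_instance

instance croly_finite (c : Plane) (m : ℤ) : FiniteDimensional ℝ (croly c m) := by
  unfold croly; infer_instance

/-- For a definite bilinear form `B` on `V` and a finite-dimensional subspace `X`, the map that
sends a linear form `l` on `X` to the unique `x ∈ X` with `B x y = l y` for all `y ∈ X`. -/
def rieszRep {V : Type*} [AddCommGroup V] [Module ℝ V] (B : LinearMap.BilinForm ℝ V)
    (hB : ∀ x, B x x = 0 → x = 0) (X : Submodule ℝ V) [FiniteDimensional ℝ X] :
    Module.Dual ℝ X ≃ₗ[ℝ] X :=
  ((B.restrict X).toDual (by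
    have h1 : (B.restrict X).SeparatingLeft := by
      intro x hx
      exact Subtype.ext (hB x (hx x))
    have h2 : (B.restrict X).SeparatingRight := by
      intro x hx
      exact Subtype.ext (hB x (hx x))
    exact ⟨h1, h2⟩)).symm

theorem rieszRep_spec {V : Type*} [AddCommGroup V] [Module ℝ V] (B : LinearMap.BilinForm ℝ V)
    (hB : ∀ x, B x x = 0 → x = 0) (X : Submodule ℝ V) [FiniteDimensional ℝ X]
    (l : Module.Dual ℝ X) (y : X) : B (rieszRep B hB X l) y = l y :=
  LinearMap.BilinForm.apply_toDual_symm_apply (B := B.restrict X) l y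

namespace PolygonalMesh

variable {Ω : Set Plane} {ιT ιE ιV : Type*} (M : PolygonalMesh Ω ιT ιE ιV)

/-! ## Edges: length, tangent, normal, relative orientation -/

/-- The (open) edge `E`. -/
def edge (E : ιE) : Set Plane := openSegment ℝ (M.vtx (M.src E)) (M.vtx (M.tgt E))

/-- The length of `E`. -/
def len (E : ιE) : ℝ := ‖M.vtx (M.tgt E) - M.vtx (M.src E)‖

/-- The unit tangent vector `t_E`. -/
def tangent (E : ιE) : Plane := (M.len E)⁻¹ • (M.vtx (M.tgt E) - M.vtx (M.src E))

/-- The unit normal `n_E`, such that `(t_E, n_E)` is right-handed. -/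
def normal (E : ιE) : Plane := !₂[-(M.tangent E 1), M.tangent E 0]

open Classical in
/-- The edges of the element `T`. -/
def edgesOf [Fintype ιE] (T : ιT) : Finset ιE :=
  Finset.univ.filter fun E => M.edge E ⊆ frontier (M.elem T)

open Classical in
/-- The orientation `ω_{TE}` of `E ⊆ ∂T` relative to `T`: it is `1` if `n_E` points out of `T` and
`-1` otherwise, so that `ω_{TE} n_E` points out of `T`. -/
def omega (T : ιT) (E : ιE) : ℝ :=
  if ∀ x ∈ M.edge E, ∀ᶠ s in 𝓝[>] (0 : ℝ), x + s • M.normal E ∉ M.elem T then 1 else -1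

theorem len_pos (E : ιE) : 0 < M.len E := by
  unfold len
  rw [norm_pos_iff, sub_ne_zero]
  exact fun h => M.src_ne_tgt E (M.vtx_injective h).symm

/-! ## Integrals of polynomials -/

theorem isOpen_elem (T : ιT) : IsOpen (M.elem T) := by
  obtain ⟨-, t, -, h⟩ := M.elem_polygonal T
  rw [h]; exact isOpen_interior

theorem isBounded_elem (T : ιT) : Bornology.IsBounded (M.elem T) := by
  obtain ⟨-, t, -, h⟩ := M.elem_polygonal T
  rw [h]
  refine Bornology.IsBounded.subset ?_ interior_subset
  rw [Bornology.isBounded_biUnion_finset]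
  intro p _
  rw [isBounded_convexHull]
  exact (finite_range p).isBounded

theorem integrableOn_elem (T : ιT) {f : Plane → ℝ} (hf : Continuous f) :
    IntegrableOn f (M.elem T) :=
  (hf.continuousOn.integrableOn_compact (M.isBounded_elem T).isCompact_closure).mono_set
    subset_closure

theorem continuous_eval (p : Poly2) :
    Continuous fun x : Plane => MvPolynomial.eval (fun i => x i) p :=
  (MvPolynomial.continuous_eval p).comp (by fun_prop)

/-- The integral over the element `T` of the product of a continuous function and a polynomial. -/
def intMul (T : ιT) : C(Plane, ℝ) →ₗ[ℝ] Poly2 →ₗ[ℝ] ℝ :=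
  LinearMap.mk₂ ℝ (fun f p => ∫ x in M.elem T, f x * MvPolynomial.eval (fun i => x i) p)
    (by
      intro f g p
      simp only [ContinuousMap.add_apply, add_mul]
      exact integral_add (M.integrableOn_elem T (f.continuous.mul (continuous_eval p)))
        (M.integrableOn_elem T (g.continuous.mul (continuous_eval p))))
    (by
      intro c f p
      simp only [ContinuousMap.smul_apply, smul_eq_mul, mul_assoc]
      exact integral_const_mul _ _)
    (by
      intro f p q
      simp only [map_add, mul_add]
      exact integral_add (M.integrableOn_elem T (f.continuous.mul (continuous_eval p)))
        (M.integrableOn_elem T (f.continuous.mul (continuous_eval q))))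
    (by
      intro c f p
      simp only [MvPolynomial.smul_eval, smul_eq_mul, mul_left_comm _ c]
      exact integral_const_mul _ _)

/-- The integral over `T` of a polynomial. -/
def intT (T : ιT) : Poly2 →ₗ[ℝ] ℝ := M.intMul T 1

theorem intT_apply (T : ιT) (p : Poly2) :
    M.intT T p = ∫ x in M.elem T, MvPolynomial.eval (fun i => x i) p := by
  simp [intT, intMul]

/-- The integral over the edge `E` of a polynomial in the arc length. -/
def intE (E : ιE) : Polynomial ℝ →ₗ[ℝ] ℝ where
  toFun p := ∫ s in (0 : ℝ)..M.len E, p.eval s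
  map_add' p q := by
    simp only [Polynomial.eval_add]
    exact intervalIntegral.integral_add (p.continuous.intervalIntegrable _ _)
      (q.continuous.intervalIntegrable _ _)
  map_smul' c p := by
    simp only [Polynomial.eval_smul, smul_eq_mul, RingHom.id_apply]
    exact intervalIntegral.integral_const_mul _ _

/-- The restriction to `E` of a polynomial in two variables, as a polynomial in the arc length
measured from the starting vertex. -/
def restrE (E : ιE) : Poly2 →ₐ[ℝ] Polynomial ℝ :=
  MvPolynomial.aeval fun i =>
    Polynomial.C (M.vtx (M.src E) i) + Polynomial.C (M.tangent E i) * Polynomial.X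

/-- The normal trace `v · n_E` on `E` of a vector-valued polynomial. -/
def normalTrace (E : ιE) : VPoly2 →ₗ[ℝ] Polynomial ℝ where
  toFun v := M.normal E 0 • M.restrE E (v 0) + M.normal E 1 • M.restrE E (v 1)
  map_add' v w := by simp only [Pi.add_apply, map_add, smul_add]; abel
  map_smul' c v := by
    simp only [Pi.smul_apply, map_smul, smul_add, smul_comm c, RingHom.id_apply]

/-- The `L²(T)` inner product of polynomials. -/
def l2T (T : ιT) : LinearMap.BilinForm ℝ Poly2 :=
  (LinearMap.mul ℝ Poly2).compr₂ (M.intT T)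

/-- The `L²(T; ℝ²)` inner product of vector-valued polynomials. -/
def l2V (T : ιT) : LinearMap.BilinForm ℝ VPoly2 :=
  ∑ i, (M.l2T T).compl₁₂ (LinearMap.proj i) (LinearMap.proj i)

/-- The `L²(E)` inner product of polynomials in the arc length. -/
def l2E (E : ιE) : LinearMap.BilinForm ℝ (Polynomial ℝ) :=
  (LinearMap.mul ℝ (Polynomial ℝ)).compr₂ (M.intE E)

theorem l2T_apply (T : ιT) (p q : Poly2) : M.l2T T p q = M.intT T (p * q) := rfl

theorem l2V_apply (T : ιT) (v w : VPoly2) :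
    M.l2V T v w = M.intT T (v 0 * w 0) + M.intT T (v 1 * w 1) := by
  simp [l2V, l2T_apply]

theorem l2E_apply (E : ιE) (p q : Polynomial ℝ) : M.l2E E p q = M.intE E (p * q) := rfl

theorem intT_mul_self_nonneg (T : ιT) (p : Poly2) : 0 ≤ M.intT T (p * p) := by
  rw [intT_apply]
  exact integral_nonneg fun x => by simpa using mul_self_nonneg _

theorem l2T_definite (T : ιT) (p : Poly2) (h : M.l2T T p p = 0) : p = 0 := by
  rw [l2T_apply, intT_apply] at h
  have hc := continuous_eval (p * p)
  have ho := M.isOpen_elem T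
  rw [setIntegral_eq_zero_iff_of_nonneg_ae
    (Filter.Eventually.of_forall fun x => by simpa using mul_self_nonneg _)
    (M.integrableOn_elem T hc)] at h
  have h0 : EqOn (fun x : Plane => MvPolynomial.eval (fun i => x i) (p * p)) 0 (M.elem T) :=
    Measure.eqOn_open_of_ae_eq h ho hc.continuousOn continuousOn_const
  obtain ⟨c, hc'⟩ := (M.elem_polygonal T).1.nonempty
  have ho' : IsOpen ((WithLp.toLp 2 : (Fin 2 → ℝ) → Plane) ⁻¹' M.elem T) :=
    ho.preimage (PiLp.continuous_toLp 2 _)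
  obtain ⟨r, hr, hb⟩ := Metric.isOpen_iff.1 ho' (fun i => c i) (by simpa using hc')
  rw [ball_pi _ hr] at hb
  refine MvPolynomial.funext_set (fun i => Metric.ball (c i) r) (fun i => ?_) (fun x hx => ?_)
  · rw [Real.ball_eq_Ioo]
    exact Ioo_infinite (by linarith)
  · have := h0 (hb hx)
    simpa using this

theorem l2V_definite (T : ιT) (v : VPoly2) (h : M.l2V T v v = 0) : v = 0 := by
  rw [l2V_apply] at h
  have h0 := M.intT_mul_self_nonneg T (v 0)
  have h1 := M.intT_mul_self_nonneg T (v 1)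
  funext i
  fin_cases i
  · exact M.l2T_definite T _ (by rw [l2T_apply]; simp only [Fin.zero_eta]; linarith)
  · exact M.l2T_definite T _ (by rw [l2T_apply]; simp only [Fin.mk_one]; linarith)

theorem eq_zero_of_intE_eq_zero (E : ιE) (p : Polynomial ℝ)
    (hp : ∀ s ∈ Ioo 0 (M.len E), 0 ≤ p.eval s) (h : M.intE E p = 0) : p = 0 := by
  have hl := M.len_pos E
  have hp' : ∀ s ∈ Icc 0 (M.len E), 0 ≤ p.eval s := by
    have : closure (Ioo 0 (M.len E)) ⊆ {s | 0 ≤ p.eval s} :=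
      closure_minimal hp (isClosed_le continuous_const p.continuous)
    rwa [closure_Ioo hl.ne] at this
  by_contra hne
  have hz : ∀ s ∈ Ioo 0 (M.len E), p.eval s = 0 := by
    intro s hs
    by_contra hs0
    have : 0 < ∫ s in (0 : ℝ)..M.len E, p.eval s :=
      intervalIntegral.integral_pos hl p.continuous.continuousOn
        (fun x hx => hp' x (Ioc_subset_Icc_self hx))
        ⟨s, Ioo_subset_Icc_self hs, lt_of_le_of_ne (hp s hs) (Ne.symm hs0)⟩
    exact this.ne' h
  exact hne (Polynomial.eq_zero_of_infinite_isRoot p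
    ((Ioo_infinite hl).mono fun s hs => hz s hs))

theorem l2E_definite (E : ιE) (p : Polynomial ℝ) (h : M.l2E E p p = 0) : p = 0 := by
  refine mul_self_eq_zero.1 (M.eq_zero_of_intE_eq_zero E (p * p) (fun s _ => ?_) h)
  simpa using mul_self_nonneg _

/-! ## `L²`-orthogonal projectors -/

/-- The `L²`-orthogonal projector of vector-valued polynomials on a polynomial subspace `X`. -/
def projV (T : ιT) (X : Submodule ℝ VPoly2) [FiniteDimensional ℝ X] : VPoly2 →ₗ[ℝ] X :=
  (rieszRep (M.l2V T) (M.l2V_definite T) X).toLinearMap ∘ₗ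
    X.subtype.dualMap ∘ₗ M.l2V T

/-- The `L²(E)`-orthogonal projector on polynomials of degree at most `m`, for polynomials. -/
def projE (E : ιE) (m : ℤ) : Polynomial ℝ →ₗ[ℝ] polyE m :=
  (rieszRep (M.l2E E) (M.l2E_definite E) (polyE m)).toLinearMap ∘ₗ
    (polyE m).subtype.dualMap ∘ₗ M.l2E E

/-- The `L²(T)`-orthogonal projector on `polyT m`, for continuous functions. -/
def projTCont (T : ιT) (m : ℤ) : C(Plane, ℝ) →ₗ[ℝ] polyT m :=
  (rieszRep (M.l2T T) (M.l2T_definite T) (polyT m)).toLinearMap ∘ₗ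
    (polyT m).subtype.dualMap ∘ₗ M.intMul T

/-- The linear form `r ↦ ∫_E f r` for a continuous function `f`. -/
def intEMul (E : ιE) : C(Plane, ℝ) →ₗ[ℝ] Polynomial ℝ →ₗ[ℝ] ℝ :=
  LinearMap.mk₂ ℝ (fun f p => ∫ s in (0 : ℝ)..M.len E,
      f (M.vtx (M.src E) + s • M.tangent E) * p.eval s)
    (by
      intro f g p
      simp only [ContinuousMap.add_apply, add_mul]
      exact intervalIntegral.integral_add
        (Continuous.intervalIntegrable (by fun_prop) _ _)
        (Continuous.intervalIntegrable (by fun_prop) _ _))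
    (by
      intro c f p
      simp only [ContinuousMap.smul_apply, smul_eq_mul, mul_assoc]
      exact intervalIntegral.integral_const_mul _ _)
    (by
      intro f p q
      simp only [Polynomial.eval_add, mul_add]
      exact intervalIntegral.integral_add
        (Continuous.intervalIntegrable (by fun_prop) _ _)
        (Continuous.intervalIntegrable (by fun_prop) _ _))
    (by
      intro c f p
      simp only [Polynomial.eval_smul, smul_eq_mul, mul_left_comm _ c]
      exact intervalIntegral.integral_const_mul _ _)

/-- The `L²(E)`-orthogonal projector on `polyE m`, for continuous functions. -/
def projECont (E : ιE) (m : ℤ) : C(Plane, ℝ) →ₗ[ℝ] polyE m :=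
  (rieszRep (M.l2E E) (M.l2E_definite E) (polyE m)).toLinearMap ∘ₗ
    (polyE m).subtype.dualMap ∘ₗ M.intEMul E

theorem projV_spec (T : ιT) (X : Submodule ℝ VPoly2) [FiniteDimensional ℝ X] (v : VPoly2) (w : X) :
    M.l2V T (M.projV T X v) w = M.l2V T v w :=
  rieszRep_spec (M.l2V T) (M.l2V_definite T) X (X.subtype.dualMap (M.l2V T v)) w

theorem projE_spec (E : ιE) (m : ℤ) (p : Polynomial ℝ) (q : polyE m) :
    M.intE E (M.projE E m p * q) = M.intE E (p * q) :=
  rieszRep_spec (M.l2E E) (M.l2E_definite E) (polyE m)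
    ((polyE m).subtype.dualMap (M.l2E E p)) q

theorem projTCont_spec (T : ιT) (m : ℤ) (f : C(Plane, ℝ)) (p : polyT m) :
    M.intT T (M.projTCont T m f * p) =
      ∫ x in M.elem T, f x * MvPolynomial.eval (fun i => x i) (p : Poly2) := by
  rw [← l2T_apply]
  exact rieszRep_spec (M.l2T T) (M.l2T_definite T) (polyT m)
    ((polyT m).subtype.dualMap (M.intMul T f)) p

theorem projECont_spec (E : ιE) (m : ℤ) (f : C(Plane, ℝ)) (p : polyE m) :
    M.intE E (M.projECont E m f * p) =
      ∫ s in (0 : ℝ)..M.len E,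
        f (M.vtx (M.src E) + s • M.tangent E) * (p : Polynomial ℝ).eval s := by
  rw [← l2E_apply]
  exact rieszRep_spec (M.l2E E) (M.l2E_definite E) (polyE m)
    ((polyE m).subtype.dualMap (M.intEMul E f)) p

/-! ## Discrete spaces -/

/-- The space `X^{m,k}` of vectors `((q_T)_T, (q_E)_E, (q_ν)_ν)` with `q_T ∈ P^m(T)`,
`q_E ∈ P^{k-1}(E)` and `q_ν ∈ ℝ`. -/
abbrev XGrad (_M : PolygonalMesh Ω ιT ιE ιV) (m k : ℤ) : Type _ :=
  (ιT → polyT m) × (ιE → polyE (k - 1)) × (ιV → ℝ)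

/-- The space `V_h = X^{k-1,k}`. -/
abbrev SpaceV (k : ℕ) : Type _ := M.XGrad ((k : ℤ) - 1) k

/-- The space `W_h = X^{k,k}`. -/
abbrev SpaceW (k : ℕ) : Type _ := M.XGrad (k : ℤ) k

/-- The space `Σ_h` of vectors `((v_{R,T}, v^c_{R,T})_T, (v_E, C_{v,E})_E, (C_{v,ν})_ν)` with
`v_{R,T} ∈ R^{k-1}(T)`, `v^c_{R,T} ∈ R^{c,k}(T)`, `v_E ∈ P^k(E)`, `C_{v,E} ∈ P^{k-1}(E)`,
`C_{v,ν} ∈ ℝ`. -/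
abbrev SpaceSigma (k : ℕ) : Type _ :=
  ((T : ιT) → roly ((k : ℤ) - 1) × croly (M.center T) k) ×
    (ιE → polyE (k : ℤ) × polyE ((k : ℤ) - 1)) × (ιV → ℝ)

/-! ## Interpolator -/

/-- The interpolator on `V_h`. -/
def interpV (k : ℕ) : C(Plane, ℝ) →ₗ[ℝ] M.SpaceV k where
  toFun f := (fun T => M.projTCont T _ f, fun E => M.projECont E _ f, fun ν => f (M.vtx ν))
  map_add' f g := by
    simp only [map_add]; rfl
  map_smul' c f := by
    simp only [map_smul]; rfl

/-- The interpolator restricted to constant functions, a map `ℝ → V_h`. -/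
def interpConst (k : ℕ) : ℝ →ₗ[ℝ] M.SpaceV k :=
  M.interpV k ∘ₗ Algebra.linearMap ℝ C(Plane, ℝ)

/-! ## Edge potential and edge gradient -/

/-- The map `p ↦ (π_E^{k-1} p, p(x_src), p(x_tgt))` on `P^{k+1}(E)`. -/
def edgeDofs (k : ℕ) (E : ιE) :
    polyE ((k : ℤ) + 1) →ₗ[ℝ] polyE ((k : ℤ) - 1) × ℝ × ℝ :=
  ((M.projE E ((k : ℤ) - 1)).prod
    ((Polynomial.leval 0).prod (Polynomial.leval (M.len E)))) ∘ₗ (polyE ((k : ℤ) + 1)).subtype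

theorem mem_polyE {m : ℤ} {p : Polynomial ℝ} :
    p ∈ polyE m ↔ p.degree < ((m + 1).toNat : ℕ) := Polynomial.mem_degreeLT

theorem edgeDofs_injective (k : ℕ) (E : ιE) : Function.Injective (M.edgeDofs k E) := by
  rw [injective_iff_map_eq_zero]
  rintro ⟨p, hp⟩ h
  have hproj : M.projE E ((k : ℤ) - 1) p = 0 := congrArg Prod.fst h
  have h0 : p.eval 0 = 0 := congrArg (fun z => z.2.1) h
  have hl : p.eval (M.len E) = 0 := congrArg (fun z => z.2.2) h
  have hlen := M.len_pos E
  obtain ⟨a, rfl⟩ : Polynomial.X ∣ p := by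
    rw [Polynomial.X_dvd_iff, Polynomial.coeff_zero_eq_eval_zero, h0]
  have ha : a.IsRoot (M.len E) := by
    have := hl
    rw [Polynomial.eval_mul, Polynomial.eval_X] at this
    exact (mul_eq_zero.1 this).resolve_left hlen.ne'
  obtain ⟨r, rfl⟩ := Polynomial.dvd_iff_isRoot.2 ha
  have hr : r ∈ polyE ((k : ℤ) - 1) := by
    rw [mem_polyE] at hp ⊢
    by_cases hr0 : r = 0
    · subst hr0
      simp only [Polynomial.degree_zero]
      exact WithBot.bot_lt_coe _
    rw [Polynomial.degree_mul, Polynomial.degree_mul, Polynomial.degree_X,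
      Polynomial.degree_X_sub_C, Polynomial.degree_eq_natDegree hr0] at hp
    rw [Polynomial.degree_eq_natDegree hr0]
    have hp' : 1 + (1 + r.natDegree) < ((k : ℤ) + 1 + 1).toNat := by exact_mod_cast hp
    have : r.natDegree < ((k : ℤ) - 1 + 1).toNat := by omega
    exact_mod_cast this
  have key := M.projE_spec E ((k : ℤ) - 1)
    (Polynomial.X * ((Polynomial.X - Polynomial.C (M.len E)) * r)) ⟨r, hr⟩
  rw [hproj] at key
  simp only [Submodule.coe_zero, zero_mul, map_zero] at key
  have key2 : M.intE E
      (-(Polynomial.X * ((Polynomial.X - Polynomial.C (M.len E)) * r) * r)) = 0 := by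
    rw [map_neg, ← key, neg_zero]
  have hz := M.eq_zero_of_intE_eq_zero E _ (fun s hs => ?_) key2
  · have hr0 : r = 0 := by
      by_contra hr0
      rw [neg_eq_zero] at hz
      simp [hr0, Polynomial.X_sub_C_ne_zero] at hz
    subst hr0
    ext1
    simp
  · have e : Polynomial.eval s
        (-(Polynomial.X * ((Polynomial.X - Polynomial.C (M.len E)) * r) * r)) =
        s * (M.len E - s) * (r.eval s * r.eval s) := by
      simp; ring
    rw [e]
    exact mul_nonneg (mul_nonneg hs.1.le (by linarith [hs.2])) (mul_self_nonneg _)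

theorem finrank_polyE (m : ℤ) : Module.finrank ℝ (polyE m) = (m + 1).toNat := by
  unfold polyE
  have := (Polynomial.degreeLTEquiv ℝ (m + 1).toNat).finrank_eq
  simpa using this

theorem edgeDofs_bijective (k : ℕ) (E : ιE) : Function.Bijective (M.edgeDofs k E) := by
  refine ⟨M.edgeDofs_injective k E, ?_⟩
  refine (LinearMap.injective_iff_surjective_of_finrank_eq_finrank ?_).1
    (M.edgeDofs_injective k E)
  rw [Module.finrank_prod, Module.finrank_prod, finrank_polyE, finrank_polyE]
  simp only [Module.finrank_self]
  omega

/-- The edge potential `P_{V,E}^{k+1} : V_h → P^{k+1}(E)`: the unique polynomial that takes the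
values `q_ν` at the two end points of `E` and whose projection on `P^{k-1}(E)` is `q_E`. -/
def edgePotential (k : ℕ) (E : ιE) : M.SpaceV k →ₗ[ℝ] polyE ((k : ℤ) + 1) :=
  (LinearEquiv.ofBijective (M.edgeDofs k E) (M.edgeDofs_bijective k E)).symm.toLinearMap ∘ₗ
    { toFun := fun q => (q.2.1 E, q.2.2 (M.src E), q.2.2 (M.tgt E))
      map_add' := fun _ _ => rfl
      map_smul' := fun _ _ => rfl }

theorem edgePotential_spec (k : ℕ) (E : ιE) (q : M.SpaceV k) :
    M.projE E ((k : ℤ) - 1) (M.edgePotential k E q) = q.2.1 E ∧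
    (M.edgePotential k E q : Polynomial ℝ).eval 0 = q.2.2 (M.src E) ∧
    (M.edgePotential k E q : Polynomial ℝ).eval (M.len E) = q.2.2 (M.tgt E) := by
  have h : M.edgeDofs k E (M.edgePotential k E q) =
      (q.2.1 E, q.2.2 (M.src E), q.2.2 (M.tgt E)) :=
    LinearEquiv.apply_symm_apply
      (LinearEquiv.ofBijective (M.edgeDofs k E) (M.edgeDofs_bijective k E)) _
  exact ⟨congrArg Prod.fst h, congrArg (fun z => z.2.1) h, congrArg (fun z => z.2.2) h⟩

/-- The edge gradient `G_E^k`, the arc length derivative of the edge potential. -/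
def edgeGradient (k : ℕ) (E : ιE) : M.SpaceV k →ₗ[ℝ] polyE (k : ℤ) :=
  (Polynomial.derivative ∘ₗ (polyE ((k : ℤ) + 1)).subtype ∘ₗ M.edgePotential k E).codRestrict
    (polyE (k : ℤ)) (by
      intro q
      have h := (M.edgePotential k E q).2
      simp only [LinearMap.comp_apply, Submodule.subtype_apply]
      generalize (M.edgePotential k E q : Polynomial ℝ) = p at h
      rw [mem_polyE] at h ⊢
      rw [Polynomial.degree_lt_iff_coeff_zero] at h ⊢
      intro n hn
      rw [Polynomial.coeff_derivative, h (n + 1) (by omega), zero_mul])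

/-! ## Element gradient and scalar rotor -/

variable [Fintype ιE]

/-- The right-hand side of the definition of the element gradient:
`-∫_T q_T div v + ∑_{E ⊆ ∂T} ω_{TE} ∫_E P_{V,E}^{k+1} q (v · n_E)`. -/
def gradForm (k : ℕ) (T : ιT) : M.SpaceV k →ₗ[ℝ] VPoly2 →ₗ[ℝ] ℝ :=
  LinearMap.mk₂ ℝ (fun q v => -M.intT T (q.1 T * pdiv v) +
      ∑ E ∈ M.edgesOf T, M.omega T E *
        M.intE E (M.edgePotential k E q * M.normalTrace E v))
    (by
      intro q r v
      simp only [map_add, Prod.fst_add, Pi.add_apply, Submodule.coe_add, add_mul, mul_add,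
        Finset.sum_add_distrib]
      ring)
    (by
      intro c q v
      simp only [map_smul, Prod.smul_fst, Pi.smul_apply, Submodule.coe_smul, smul_mul_assoc,
        smul_eq_mul, mul_add, Finset.mul_sum, mul_left_comm _ c, mul_neg])
    (by
      intro q v w
      simp only [map_add, mul_add, Finset.sum_add_distrib]
      ring)
    (by
      intro c q v
      simp only [map_smul, mul_smul_comm, smul_eq_mul, mul_add, Finset.mul_sum,
        mul_left_comm _ c, mul_neg])

/-- The element gradient `G_T^k : V_h → P^k(T; ℝ²)`. -/
def elemGradient (k : ℕ) (T : ιT) : M.SpaceV k →ₗ[ℝ] vPolyT (k : ℤ) :=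
  (rieszRep (M.l2V T) (M.l2V_definite T) (vPolyT (k : ℤ))).toLinearMap ∘ₗ
    (vPolyT (k : ℤ)).subtype.dualMap ∘ₗ M.gradForm k T

theorem elemGradient_spec (k : ℕ) (T : ιT) (q : M.SpaceV k) (v : vPolyT (k : ℤ)) :
    M.l2V T (M.elemGradient k T q) v = -M.intT T (q.1 T * pdiv v) +
      ∑ E ∈ M.edgesOf T, M.omega T E *
        M.intE E (M.edgePotential k E q * M.normalTrace E v) :=
  rieszRep_spec (M.l2V T) (M.l2V_definite T) (vPolyT (k : ℤ))
    ((vPolyT (k : ℤ)).subtype.dualMap (M.gradForm k T q)) v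

/-- The right-hand side of the definition of the element rotor:
`∫_T v_{R,T} · rot q - ∑_{E ⊆ ∂T} ω_{TE} ∫_E v_E q`. -/
def rotForm (k : ℕ) (T : ιT) : M.SpaceSigma k →ₗ[ℝ] Poly2 →ₗ[ℝ] ℝ :=
  LinearMap.mk₂ ℝ (fun v q => M.l2V T (v.1 T).1 (vrot q) -
      ∑ E ∈ M.edgesOf T, M.omega T E * M.intE E ((v.2.1 E).1 * M.restrE E q))
    (by
      intro v w q
      simp only [map_add, Prod.fst_add, Prod.snd_add, Pi.add_apply, Submodule.coe_add, add_mul,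
        mul_add, Finset.sum_add_distrib, LinearMap.add_apply]
      ring)
    (by
      intro c v q
      simp only [map_smul, Prod.smul_fst, Prod.smul_snd, Pi.smul_apply, Submodule.coe_smul,
        smul_mul_assoc, smul_eq_mul, mul_sub, Finset.mul_sum, mul_left_comm _ c,
        LinearMap.smul_apply])
    (by
      intro v p q
      simp only [map_add, mul_add, Finset.sum_add_distrib]
      ring)
    (by
      intro c v q
      simp only [map_smul, mul_smul_comm, smul_eq_mul, mul_sub, Finset.mul_sum,
        mul_left_comm _ c])

/-- The element scalar rotor `R_T^k : Σ_h → P^k(T)`. -/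
def elemRotor (k : ℕ) (T : ιT) : M.SpaceSigma k →ₗ[ℝ] polyT (k : ℤ) :=
  (rieszRep (M.l2T T) (M.l2T_definite T) (polyT (k : ℤ))).toLinearMap ∘ₗ
    (polyT (k : ℤ)).subtype.dualMap ∘ₗ M.rotForm k T

theorem elemRotor_spec (k : ℕ) (T : ιT) (v : M.SpaceSigma k) (q : polyT (k : ℤ)) :
    M.intT T (M.elemRotor k T v * q) = M.l2V T (v.1 T).1 (vrot q) -
      ∑ E ∈ M.edgesOf T, M.omega T E * M.intE E ((v.2.1 E).1 * M.restrE E q) := by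
  rw [← l2T_apply]
  exact rieszRep_spec (M.l2T T) (M.l2T_definite T) (polyT (k : ℤ))
    ((polyT (k : ℤ)).subtype.dualMap (M.rotForm k T v)) q

/-! ## Global discrete gradient and rotor -/

/-- The discrete gradient `G_h^k : V_h → Σ_h`. -/
def discreteGradient (k : ℕ) : M.SpaceV k →ₗ[ℝ] M.SpaceSigma k where
  toFun q := (fun T => (M.projV T (roly ((k : ℤ) - 1)) (M.elemGradient k T q),
      M.projV T (croly (M.center T) k) (M.elemGradient k T q)),
    fun E => (M.edgeGradient k E q, 0), fun _ => 0)
  map_add' q r := by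
    simp only [map_add, Submodule.coe_add]
    ext <;> simp
  map_smul' c q := by
    simp only [map_smul, Submodule.coe_smul]
    ext <;> simp

/-- The discrete rotor `R_h^k : Σ_h → W_h`. -/
def discreteRotor (k : ℕ) : M.SpaceSigma k →ₗ[ℝ] M.SpaceW k where
  toFun v := (fun T => M.elemRotor k T v, fun E => (v.2.1 E).2, v.2.2)
  map_add' v w := by
    simp only [map_add]; rfl
  map_smul' c v := by
    simp only [map_smul]; rfl

end PolygonalMesh

end RotRot

end

/-!
The sequence is exact because its algebraic part reduces, element by element, to polynomial
exactness, and its combinatorial part is the exactness of the cochain complex of the mesh, seen as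
a decomposition of a contractible set.

Reduction. On an element, `div` is an isomorphism from `(x - x_T) P^{k-1}` to `P^{k-1}` (Euler's
relation, `divKoszul`) and `rot r = 0` only for constants (`eq_C_of_vrot_eq_zero`). Together with
the Riesz representations that define the discrete operators, this determines all the element
components, and what is left concerns the values at the vertices, the integrals over the edges and
the incidence numbers `ω_{TE}`. There are five facts to prove.

* Green's formula on an element (`intT_pdiv`). Its restriction to almost every line parallel to an
  axis is the fundamental theorem of calculus on an open set of the line
  (`setIntegral_deriv_eq_sum`). Applied to constants it gives `G_h I_V = 0`.
* The boundary of an element is a cycle (`sum_omega_mul_vertex_sub`), which gives `R_h G_h = 0`. It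
  is Green's formula for `rot p`, where `p` takes prescribed values at the vertices.
* The skeleton is connected (`apply_vertex_eq`), which gives the kernel of `G_h`. The closure of the
  domain is connected, and the frontier of each element is connected because the element is
  contractible (`isPreconnected_frontier_of_contractible`): if the frontier were not connected, the
  element would surround a point `z` of its complement, and a continuous logarithm of `x - z` on the
  element would extend to a continuous logarithm of `(x - z)⁻¹` near infinity.
* An edge function without circulation around the elements is the difference of a vertex function
  (`exists_potential`), which gives the kernel of `R_h`. Dually, each cycle must be a combination of
  boundaries of elements. The winding number of the cycle is constant on each element, its jump
  across an edge is the coefficient of that edge, and it vanishes outside of the closure of the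
  domain, where a continuous logarithm exists because that closure is contractible.
* The boundaries of the elements are linearly independent (`eq_zero_of_sum_incidence_eq_zero`), which
  gives the surjectivity of `R_h`. If `∑_T ω_{TE} c_T = 0` for each edge, then `∑_T c_T 1_T` is
  locally constant outside of the finitely many vertices, whose complement is connected, and it
  vanishes far away.

All of them rest on the local picture at an edge (`exists_ball_mem_elem_iff`): an element whose
closure meets an edge lies along the whole edge, on exactly one of its sides.
-/

noncomputable section

namespace RotRot

/-! ### Locally constant functions and continuous logarithms -/

/-- A function defined on a dense set `D` and equal to a constant on `D` near each point of a
preconnected set `s` is constant on `s ∩ D`. -/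
theorem apply_eq_of_eventually_const {X α : Type*} [TopologicalSpace X] {D s : Set X}
    (hD : Dense D) (hs : IsPreconnected s) (d : X → α)
    (h : ∀ x ∈ s, ∃ κ, ∀ᶠ y in 𝓝 x, y ∈ D → d y = κ) {x y : X}
    (hx : x ∈ s) (hxD : x ∈ D) (hy : y ∈ s) (hyD : y ∈ D) : d x = d y := by
  have : Nonempty α := ⟨d x⟩
  choose! κ hκ using h
  have hval : ∀ z ∈ s, z ∈ D → d z = κ z := fun z hz hzD => (hκ z hz).self_of_nhds hzD
  have hloc : IsLocallyConstant fun z : s => κ z := by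
    rw [IsLocallyConstant.iff_eventually_eq]
    rintro ⟨z, hz⟩
    have h1 := (hκ z hz).eventually_nhds
    rw [nhds_subtype]
    refine Filter.mem_comap.2 ⟨_, h1, ?_⟩
    rintro ⟨w, hw⟩ hw'
    have hw1 : ∀ᶠ y in 𝓝 w, y ∈ D → d y = κ z := hw'
    obtain ⟨v, hvD, hv⟩ := (mem_closure_iff_frequently.1 (hD w)).and_eventually
      (hw1.and (hκ w hw)) |>.exists
    exact (hv.2 hvD).symm.trans (hv.1 hvD)
  have : PreconnectedSpace s := isPreconnected_iff_preconnectedSpace.1 hs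
  rw [hval x hx hxD, hval y hy hyD]
  exact hloc.apply_eq_of_preconnectedSpace ⟨x, hx⟩ ⟨y, hy⟩

/-- On a contractible space, a continuous function without zeros has a continuous logarithm: a
contraction, composed with the function, lifts through the covering map `exp`. -/
theorem exists_continuous_log {X : Type*} [TopologicalSpace X] [ContractibleSpace X]
    {f : X → ℂ} (hf : Continuous f) (h0 : ∀ x, f x ≠ 0) :
    ∃ g : X → ℂ, Continuous g ∧ ∀ x, Complex.exp (g x) = f x := by
  obtain ⟨p, ⟨H⟩⟩ := id_nullhomotopic X
  let F : C(X, {z : ℂ // z ≠ 0}) := ⟨fun x => ⟨f x, h0 x⟩, by fun_prop⟩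
  let K : C(unitInterval × X, {z : ℂ // z ≠ 0}) := F.comp H.symm.toContinuousMap
  have hK0 : ∀ x, K (0, x) = ⟨Complex.exp (Complex.log (f p)), Complex.exp_ne_zero _⟩ := by
    intro x
    refine Subtype.ext ?_
    simp [K, F, Complex.exp_log (h0 p)]
  let G := Complex.isCoveringMap_exp.liftHomotopy K (.const X (Complex.log (f p))) hK0
  refine ⟨fun x => G (1, x), by fun_prop, fun x => ?_⟩
  have h := congrFun (Complex.isCoveringMap_exp.liftHomotopy_lifts K
    (.const X (Complex.log (f p))) hK0) (1, x)
  have h' := congrArg Subtype.val h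
  simpa [K, F] using h'

/-! ### Elements near the edges of the mesh -/

theorem IsPolygonalSet.isOpen {S : Set Plane} (h : IsPolygonalSet S) : IsOpen S := by
  obtain ⟨-, t, -, h⟩ := h
  rw [h]; exact isOpen_interior

theorem IsPolygonalSet.interior_closure {S : Set Plane} (h : IsPolygonalSet S) :
    interior (closure S) = S := by
  have ho := h.isOpen
  obtain ⟨-, t, -, h⟩ := h
  refine Subset.antisymm ?_ (interior_maximal subset_closure ho)
  have hc : IsClosed (⋃ p ∈ t, convexHull ℝ (range p)) :=
    Set.Finite.isClosed_biUnion t.finite_toSet fun p _ =>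
      (finite_range p).isClosed_convexHull ℝ
  conv_rhs => rw [h]
  refine interior_mono ?_
  rw [h]
  exact closure_minimal interior_subset hc

theorem isClosed_segment (x y : Plane) : IsClosed (segment ℝ x y) := by
  rw [segment_eq_image]
  exact (isCompact_Icc.image (by fun_prop)).isClosed

namespace PolygonalMesh

variable {Ω : Set Plane} {ιT ιE ιV : Type*} (M : PolygonalMesh Ω ιT ιE ιV)

/-- The mesh skeleton, the union of the closed edges. -/
def skel : Set Plane := ⋃ E, segment ℝ (M.vtx (M.src E)) (M.vtx (M.tgt E))

/-- The arc-length parametrisation of the edge `E`. -/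
def pt (E : ιE) (s : ℝ) : Plane := M.vtx (M.src E) + s • M.tangent E

/-- The scalar product `n_E · (y - x)`, whose sign tells on which side of the edge `E` through `x`
the point `y` lies. -/
def side (E : ιE) (x y : Plane) : ℝ :=
  M.normal E 0 * (y 0 - x 0) + M.normal E 1 * (y 1 - x 1)

/-- The half disc of centre `x` and radius `r` on the side of `E` into which `σ n_E` points. -/
def halfDisc (E : ιE) (x : Plane) (r σ : ℝ) : Set Plane :=
  Metric.ball x r ∩ {y | 0 < σ * M.side E x y}

/-- The element `T` lies along `E` on the side into which `σ n_E` points. -/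
def OnSide (T : ιT) (E : ιE) (σ : ℝ) : Prop :=
  ∀ x ∈ M.edge E, ∃ r > 0, M.halfDisc E x r σ ⊆ M.elem T

@[fun_prop]
theorem continuous_pt (E : ιE) : Continuous (M.pt E) := by unfold pt; fun_prop

theorem len_smul_tangent (E : ιE) :
    M.len E • M.tangent E = M.vtx (M.tgt E) - M.vtx (M.src E) := by
  unfold tangent
  rw [smul_smul, mul_inv_cancel₀ (M.len_pos E).ne', one_smul]

theorem pt_zero (E : ιE) : M.pt E 0 = M.vtx (M.src E) := by simp [pt]

theorem pt_len (E : ιE) : M.pt E (M.len E) = M.vtx (M.tgt E) := by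
  simp [pt, len_smul_tangent]

theorem mem_edge_iff {E : ιE} {x : Plane} :
    x ∈ M.edge E ↔ ∃ s ∈ Ioo 0 (M.len E), M.pt E s = x := by
  have hl := M.len_pos E
  unfold edge
  rw [openSegment_eq_image']
  constructor
  · rintro ⟨θ, hθ, rfl⟩
    refine ⟨θ * M.len E, ⟨mul_pos hθ.1 hl, by nlinarith [hθ.2]⟩, ?_⟩
    simp only [pt, mul_smul, len_smul_tangent]
  · rintro ⟨s, hs, rfl⟩
    refine ⟨s / M.len E, ⟨div_pos hs.1 hl, (div_lt_one hl).2 hs.2⟩, ?_⟩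
    simp only [pt, ← len_smul_tangent, smul_smul, div_mul_cancel₀ _ hl.ne']

theorem edge_nonempty (E : ιE) : (M.edge E).Nonempty :=
  ⟨_, M.mem_edge_iff.2 ⟨M.len E / 2, ⟨half_pos (M.len_pos E), half_lt_self (M.len_pos E)⟩, rfl⟩⟩

theorem segment_eq (E : ιE) : segment ℝ (M.vtx (M.src E)) (M.vtx (M.tgt E)) =
    insert (M.vtx (M.src E)) (insert (M.vtx (M.tgt E)) (M.edge E)) :=
  (insert_endpoints_openSegment ℝ _ _).symm

theorem edge_subset_skel (E : ιE) : M.edge E ⊆ M.skel :=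
  (openSegment_subset_segment ℝ _ _).trans (subset_iUnion_of_subset E subset_rfl)

theorem frontier_subset_skel (T : ιT) : frontier (M.elem T) ⊆ M.skel := by
  unfold skel
  rw [← M.skeleton]
  exact subset_iUnion (fun T => frontier (M.elem T)) T

theorem notMem_elem_of_mem_skel {x : Plane} (hx : x ∈ M.skel) (T : ιT) : x ∉ M.elem T := by
  unfold skel at hx
  rw [← M.skeleton] at hx
  obtain ⟨T', hT'⟩ := mem_iUnion.1 hx
  intro h
  have hc : x ∈ closure (M.elem T') := frontier_subset_closure hT'
  obtain ⟨y, hy, hy'⟩ := mem_closure_iff.1 hc _ (M.isOpen_elem T) h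
  by_cases hTT : T = T'
  · subst hTT
    rw [(M.isOpen_elem T).frontier_eq] at hT'
    exact hT'.2 h
  · exact disjoint_left.1 (M.elem_disjoint hTT) hy hy'

theorem normal_sq (E : ιE) : M.normal E 0 * M.normal E 0 + M.normal E 1 * M.normal E 1 = 1 := by
  have h1 : ‖M.tangent E‖ = 1 := by
    unfold tangent
    rw [norm_smul, norm_inv, Real.norm_of_nonneg (M.len_pos E).le]
    exact inv_mul_cancel₀ (M.len_pos E).ne'
  have h2 : ‖M.tangent E‖ ^ 2 = 1 := by rw [h1]; norm_num
  rw [EuclideanSpace.norm_sq_eq] at h2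
  simp only [Fin.sum_univ_two, Real.norm_eq_abs, sq_abs] at h2
  simp only [normal, PiLp.toLp_apply, Matrix.cons_val_zero, Matrix.cons_val_one]
  nlinarith

theorem side_add_normal (E : ιE) (x y : Plane) (s : ℝ) :
    M.side E x (y + s • M.normal E) = M.side E x y + s := by
  have h := M.normal_sq E
  simp only [side, PiLp.add_apply, PiLp.smul_apply, smul_eq_mul]
  linear_combination s * h

theorem side_self (E : ιE) (x : Plane) : M.side E x x = 0 := by simp [side]

theorem side_pt_pt (E : ιE) (s s' : ℝ) : M.side E (M.pt E s) (M.pt E s') = 0 := by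
  simp only [side, pt, normal, PiLp.add_apply, PiLp.smul_apply, smul_eq_mul, PiLp.toLp_apply,
    Matrix.cons_val_zero, Matrix.cons_val_one]
  ring

theorem side_eq_of_mem_edge {E : ιE} {x x' : Plane} (hx : x ∈ M.edge E) (hx' : x' ∈ M.edge E)
    (y : Plane) : M.side E x y = M.side E x' y := by
  obtain ⟨s, -, rfl⟩ := M.mem_edge_iff.1 hx
  obtain ⟨s', -, rfl⟩ := M.mem_edge_iff.1 hx'
  have h := M.side_pt_pt E s s'
  simp only [side] at h ⊢
  linarith

theorem norm_normal (E : ιE) : ‖M.normal E‖ = 1 := by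
  have h := M.normal_sq E
  rw [EuclideanSpace.norm_eq, Fin.sum_univ_two, Real.norm_eq_abs, Real.norm_eq_abs, sq_abs, sq_abs,
    Real.sqrt_eq_one]
  linarith

theorem add_normal_mem_halfDisc (E : ιE) (x : Plane) {r σ s : ℝ} (hs : 0 < s) (hsr : s < r)
    (hσ : σ * σ = 1) : x + (σ * s) • M.normal E ∈ M.halfDisc E x r σ := by
  refine ⟨?_, ?_⟩
  · have h1 : |σ| = 1 := by
      rcases mul_self_eq_one_iff.1 hσ with h | h <;> simp [h]
    rw [mem_ball_iff_norm, add_sub_cancel_left, norm_smul, M.norm_normal, mul_one,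
      Real.norm_eq_abs, abs_mul, h1, one_mul, abs_of_pos hs]
    exact hsr
  · simp only [mem_ofPred_eq, side_add_normal, side_self, zero_add]
    rw [← mul_assoc, hσ, one_mul]; exact hs

theorem convex_halfDisc (E : ιE) (x : Plane) (r σ : ℝ) : Convex ℝ (M.halfDisc E x r σ) := by
  refine (convex_ball x r).inter ?_
  have h : {y | 0 < σ * M.side E x y} =
      {y : Plane | σ * (M.normal E 0 * x 0 + M.normal E 1 * x 1) <
        σ * (M.normal E 0 * y 0 + M.normal E 1 * y 1)} := by
    ext y
    simp only [side, mem_ofPred_eq]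
    constructor <;> intro h <;> nlinarith
  rw [h]
  refine convex_halfSpace_gt ⟨fun y z => ?_, fun c y => ?_⟩ _
  · simp only [PiLp.add_apply]; ring
  · simp only [PiLp.smul_apply, smul_eq_mul]; ring

theorem interior_closure_elem (T : ιT) : interior (closure (M.elem T)) = M.elem T :=
  (M.elem_polygonal T).interior_closure

/-- Elements are open and their frontiers lie in the skeleton, so a connected set that avoids the
skeleton lies inside or outside of each of them. -/
theorem elem_subset_or_disjoint (T : ιT) {s : Set Plane} (hs : IsPreconnected s)
    (hd : Disjoint s (M.skel)) : s ⊆ M.elem T ∨ Disjoint s (M.elem T) := by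
  by_cases h : (s ∩ M.elem T).Nonempty
  · left
    by_contra hsub
    obtain ⟨y, hy, hyT⟩ := not_subset.1 hsub
    have hsub' : s ⊆ M.elem T ∪ (closure (M.elem T))ᶜ := by
      intro z hz
      by_contra hcon
      rw [mem_union, not_or, notMem_compl_iff] at hcon
      refine disjoint_left.1 hd hz (M.frontier_subset_skel T ?_)
      rw [(M.isOpen_elem T).frontier_eq]
      exact ⟨hcon.2, hcon.1⟩
    obtain ⟨z, -, hz, hz'⟩ := hs _ _ (M.isOpen_elem T) isClosed_closure.isOpen_compl hsub' h
      ⟨y, hy, fun hyc => (hsub' hy).elim hyT fun h' => h' hyc⟩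
    exact hz' (subset_closure hz)
  · right
    exact disjoint_iff_inter_eq_empty.2 (not_nonempty_iff_eq_empty.1 h)

theorem halfDisc_subset_of_mem_edge {E : ιE} {x x' : Plane} {r r' σ : ℝ} (hx : x ∈ M.edge E)
    (hx' : x' ∈ M.edge E) (h : Metric.ball x' r' ⊆ Metric.ball x r) :
    M.halfDisc E x' r' σ ⊆ M.halfDisc E x r σ := by
  rintro y ⟨hy, hy'⟩
  refine ⟨h hy, ?_⟩
  simpa only [mem_ofPred_eq, M.side_eq_of_mem_edge hx' hx] using hy'

theorem halfDisc_nonempty (E : ιE) (x : Plane) {r σ : ℝ} (hr : 0 < r) (hσ : σ * σ = 1) :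
    (M.halfDisc E x r σ).Nonempty :=
  ⟨_, M.add_normal_mem_halfDisc E x (half_pos hr) (half_lt_self hr) hσ⟩

/-- An edge whose two sides belong to one element would be interior to the closure of that
element. -/
theorem not_onSide_neg {T : ιT} {E : ιE} (h : M.OnSide T E 1) : ¬ M.OnSide T E (-1) := by
  intro h'
  obtain ⟨x, hx⟩ := M.edge_nonempty E
  obtain ⟨r, hr, h1⟩ := h x hx
  obtain ⟨r', hr', h2⟩ := h' x hx
  refine M.notMem_elem_of_mem_skel (M.edge_subset_skel E hx) T ?_
  rw [← M.interior_closure_elem T, mem_interior]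
  refine ⟨Metric.ball x (min r r'), ?_, Metric.isOpen_ball, Metric.mem_ball_self (lt_min hr hr')⟩
  have hne : ∀ y ∈ Metric.ball x (min r r'), M.side E x y ≠ 0 → y ∈ M.elem T := by
    intro y hy h0
    rcases lt_or_gt_of_ne h0 with h | h
    · exact h2 ⟨Metric.ball_subset_ball (min_le_right _ _) hy,
        by simp only [mem_ofPred_eq]; linarith⟩
    · exact h1 ⟨Metric.ball_subset_ball (min_le_left _ _) hy,
        by simp only [mem_ofPred_eq]; linarith⟩
  intro y hy
  by_cases h0 : M.side E x y = 0
  · have hc : Filter.Tendsto (fun s : ℝ => y + s • M.normal E) (𝓝[≠] 0) (𝓝 y) := by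
      have : ContinuousAt (fun s : ℝ => y + s • M.normal E) 0 := by fun_prop
      simpa [ContinuousAt] using this.tendsto.mono_left nhdsWithin_le_nhds
    refine mem_closure_of_tendsto hc ?_
    filter_upwards [hc (Metric.isOpen_ball.mem_nhds hy), eventually_mem_nhdsWithin] with s hs hs0
    refine hne _ hs ?_
    rw [side_add_normal, h0, zero_add]
    exact hs0
  · exact subset_closure (hne y hy h0)

theorem mem_closure_of_onSide {T : ιT} {E : ιE} {σ : ℝ} (hσ : σ * σ = 1) (h : M.OnSide T E σ)
    {x : Plane} (hx : x ∈ M.edge E) : x ∈ closure (M.elem T) := by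
  obtain ⟨r, hr, hsub⟩ := h x hx
  rw [Metric.mem_closure_iff]
  intro ε hε
  have hm : 0 < min r ε := lt_min hr hε
  obtain ⟨z, hz⟩ := M.halfDisc_nonempty E x hm hσ
  refine ⟨z, hsub ⟨Metric.ball_subset_ball (min_le_left _ _) hz.1, hz.2⟩, ?_⟩
  rw [dist_comm]
  exact lt_of_lt_of_le hz.1 (min_le_right _ _)

variable [Fintype ιE]

theorem isClosed_skel : IsClosed M.skel :=
  isClosed_iUnion_of_finite fun _ => isClosed_segment _ _

theorem exists_ball_inter_skel {E : ιE} {x : Plane} (hx : x ∈ M.edge E) :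
    ∃ r > 0, Metric.ball x r ∩ M.skel ⊆ M.edge E := by
  classical
  let C : Set Plane := (⋃ E' ∈ {E' | E' ≠ E}, segment ℝ (M.vtx (M.src E')) (M.vtx (M.tgt E'))) ∪
    {M.vtx (M.src E), M.vtx (M.tgt E)}
  have hC : IsClosed C :=
    ((toFinite _).isClosed_biUnion fun _ _ => isClosed_segment _ _).union
      (toFinite _).isClosed
  have hxC : x ∉ C := by
    have hv : ∀ v, x ≠ M.vtx v := fun v h => M.vtx_notMem_edge v E (h ▸ hx)
    rintro (h | h)
    · simp only [mem_iUnion] at h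
      obtain ⟨E', hE', h⟩ := h
      rw [M.segment_eq] at h
      rcases h with h | h | h
      · exact hv _ h
      · exact hv _ h
      · exact disjoint_left.1 (M.edge_disjoint hE') h hx
    · rcases h with h | h
      · exact hv _ h
      · exact hv _ h
  obtain ⟨r, hr, hb⟩ := Metric.isOpen_iff.1 hC.isOpen_compl x hxC
  refine ⟨r, hr, ?_⟩
  rintro y ⟨hy, hyS⟩
  obtain ⟨E', hE'⟩ := mem_iUnion.1 hyS
  have hyC := hb hy
  by_cases h : E' = E
  · subst h
    rw [M.segment_eq] at hE'
    rcases hE' with h | h | h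
    · exact absurd (Or.inr (Or.inl h)) hyC
    · exact absurd (Or.inr (Or.inr h)) hyC
    · exact h
  · exact absurd (Or.inl (mem_iUnion₂.2 ⟨E', h, hE'⟩)) hyC

theorem exists_halfDisc {E : ιE} {x : Plane} (hx : x ∈ M.edge E) :
    ∃ r > 0, Metric.ball x r ∩ M.skel ⊆ M.edge E ∧
      ∀ T σ, M.halfDisc E x r σ ⊆ M.elem T ∨ Disjoint (M.halfDisc E x r σ) (M.elem T) := by
  obtain ⟨r, hr, h⟩ := M.exists_ball_inter_skel hx
  refine ⟨r, hr, h, fun T σ =>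
    M.elem_subset_or_disjoint T (M.convex_halfDisc E x r σ).isPreconnected ?_⟩
  rw [disjoint_left]
  intro y hy hyS
  have hyE := h ⟨hy.1, hyS⟩
  have h0 := M.side_eq_of_mem_edge hx hyE y
  rw [side_self] at h0
  have := hy.2
  simp [h0] at this

/-- An element that does not lie along the whole edge on a given side meets no small half disc on
that side: the position of an element relative to an edge does not change along the edge. -/
theorem disjoint_of_not_onSide {T : ιT} {E : ιE} {σ : ℝ} (hσ : σ * σ = 1)
    (h : ¬ M.OnSide T E σ) {x : Plane} (hx : x ∈ M.edge E) :
    ∃ r > 0, Disjoint (M.halfDisc E x r σ) (M.elem T) := by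
  by_contra hcon
  refine h fun y hy => ?_
  obtain ⟨s, hs, rfl⟩ := M.mem_edge_iff.1 hx
  obtain ⟨s', hs', rfl⟩ := M.mem_edge_iff.1 hy
  have key := apply_eq_of_eventually_const (D := univ) dense_univ
    (isPreconnected_Ioo (a := 0) (b := M.len E))
    (fun s => ∃ r > 0, M.halfDisc E (M.pt E s) r σ ⊆ M.elem T) ?_ hs (mem_univ _) hs' (mem_univ _)
  · rw [← key]
    obtain ⟨r, hr, -, hd⟩ := M.exists_halfDisc hx
    rcases hd T σ with h1 | h1
    · exact ⟨r, hr, h1⟩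
    · exact absurd ⟨r, hr, h1⟩ hcon
  · intro s hs
    have hx := M.mem_edge_iff.2 ⟨s, hs, rfl⟩
    obtain ⟨r, hr, -, hd⟩ := M.exists_halfDisc hx
    have hev : ∀ᶠ u in 𝓝 s, u ∈ Ioo 0 (M.len E) ∧ M.pt E u ∈ Metric.ball (M.pt E s) r :=
      Filter.inter_mem (Ioo_mem_nhds hs.1 hs.2)
        ((M.continuous_pt E).continuousAt.preimage_mem_nhds (Metric.ball_mem_nhds _ hr))
    rcases hd T σ with h1 | h1
    · refine ⟨True, hev.mono fun u hu _ => eq_true ?_⟩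
      obtain ⟨r', hr', hb⟩ := Metric.isOpen_iff.1 Metric.isOpen_ball _ hu.2
      exact ⟨r', hr', (M.halfDisc_subset_of_mem_edge hx (M.mem_edge_iff.2 ⟨u, hu.1, rfl⟩)
        hb).trans h1⟩
    · refine ⟨False, hev.mono fun u hu _ => eq_false ?_⟩
      rintro ⟨r', hr', hsub⟩
      obtain ⟨r'', hr'', hb⟩ := Metric.isOpen_iff.1 Metric.isOpen_ball _ hu.2
      have hu' := M.mem_edge_iff.2 ⟨u, hu.1, rfl⟩
      obtain ⟨z, hz⟩ := M.halfDisc_nonempty E (M.pt E u) (lt_min hr' hr'') hσ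
      refine disjoint_left.1 h1 (M.halfDisc_subset_of_mem_edge hx hu'
        ((Metric.ball_subset_ball (min_le_right _ _)).trans hb) hz)
        (hsub (M.halfDisc_subset_of_mem_edge hu' hu'
          (Metric.ball_subset_ball (min_le_left _ _)) hz))

/-- An element whose closure meets an edge lies along the whole edge, on one of its sides: the
alternative is that the element is squeezed into the line that carries the edge. -/
theorem onSide_of_mem_closure {T : ιT} {E : ιE} {x : Plane} (hx : x ∈ M.edge E)
    (hxT : x ∈ closure (M.elem T)) : M.OnSide T E 1 ∨ M.OnSide T E (-1) := by
  by_contra! hcon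
  obtain ⟨r, hr, h1⟩ := M.disjoint_of_not_onSide (by norm_num) hcon.1 hx
  obtain ⟨r', hr', h2⟩ := M.disjoint_of_not_onSide (by norm_num) hcon.2 hx
  have ho : IsOpen (Metric.ball x (min r r') ∩ M.elem T) :=
    Metric.isOpen_ball.inter (M.isOpen_elem T)
  obtain ⟨y, hy⟩ := mem_closure_iff.1 hxT _ Metric.isOpen_ball
    (Metric.mem_ball_self (lt_min hr hr'))
  have hev : ∀ᶠ s in 𝓝[≠] (0 : ℝ), y + s • M.normal E ∈ Metric.ball x (min r r') ∩ M.elem T := by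
    have hc : ContinuousAt (fun s : ℝ => y + s • M.normal E) 0 := by fun_prop
    exact nhdsWithin_le_nhds (hc.preimage_mem_nhds (ho.mem_nhds (by simpa using hy)))
  have hne : ∀ᶠ s in 𝓝[≠] (0 : ℝ), M.side E x (y + s • M.normal E) ≠ 0 := by
    simp only [side_add_normal]
    by_cases h0 : M.side E x y = 0
    · simpa [h0] using (eventually_mem_nhdsWithin : ∀ᶠ s in 𝓝[≠] (0 : ℝ), s ∈ ({0}ᶜ : Set ℝ))
    · have hc : ContinuousAt (fun s : ℝ => M.side E x y + s) 0 := by fun_prop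
      exact (hc.eventually_ne (by simpa using h0)).filter_mono nhdsWithin_le_nhds
  obtain ⟨s, hs, hs0⟩ := (hev.and hne).exists
  rcases lt_or_gt_of_ne hs0 with h | h
  · exact disjoint_left.1 h2 ⟨Metric.ball_subset_ball (min_le_right _ _) hs.1,
      by simp only [mem_ofPred_eq]; linarith⟩ hs.2
  · exact disjoint_left.1 h1 ⟨Metric.ball_subset_ball (min_le_left _ _) hs.1,
      by simp only [mem_ofPred_eq]; linarith⟩ hs.2

theorem mem_edgesOf_iff {T : ιT} {E : ιE} :
    E ∈ M.edgesOf T ↔ M.OnSide T E 1 ∨ M.OnSide T E (-1) := by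
  simp only [edgesOf, Finset.mem_filter, Finset.mem_univ, true_and]
  constructor
  · intro h
    obtain ⟨x, hx⟩ := M.edge_nonempty E
    exact M.onSide_of_mem_closure hx (frontier_subset_closure (h hx))
  · intro h x hx
    rw [(M.isOpen_elem T).frontier_eq]
    refine ⟨?_, M.notMem_elem_of_mem_skel (M.edge_subset_skel E hx) T⟩
    rcases h with h | h
    · exact M.mem_closure_of_onSide (by norm_num) h hx
    · exact M.mem_closure_of_onSide (by norm_num) h hx

open Classical in
/-- The orientation depends only on the side of the edge on which the element lies. -/
theorem omega_eq (T : ιT) (E : ιE) : M.omega T E = if M.OnSide T E 1 then -1 else 1 := by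
  unfold omega
  have key : (∀ x ∈ M.edge E, ∀ᶠ s in 𝓝[>] (0 : ℝ), x + s • M.normal E ∉ M.elem T) ↔
      ¬ M.OnSide T E 1 := by
    constructor
    · intro h hs
      obtain ⟨x, hx⟩ := M.edge_nonempty E
      obtain ⟨r, hr, hsub⟩ := hs x hx
      obtain ⟨s, hs1, hs2⟩ := ((h x hx).and (Ioo_mem_nhdsGT hr)).exists
      refine hs1 (hsub ?_)
      simpa using M.add_normal_mem_halfDisc E x (σ := 1) hs2.1 hs2.2 (by norm_num)
    · intro h x hx
      obtain ⟨r, hr, hd⟩ := M.disjoint_of_not_onSide (by norm_num) h hx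
      filter_upwards [Ioo_mem_nhdsGT hr] with s hs
      refine disjoint_left.1 hd ?_
      simpa using M.add_normal_mem_halfDisc E x (σ := 1) hs.1 hs.2 (by norm_num)
  by_cases h : M.OnSide T E 1
  · rw [if_neg (fun h' => key.1 h' h), if_pos h]
  · rw [if_pos (key.2 h), if_neg h]

end PolygonalMesh

/-! ### Connectedness of the skeleton -/

theorem eqOn_of_exp_eq {X : Type*} [TopologicalSpace X] {s : Set X} (hs : IsPreconnected s)
    {f g : X → ℂ} (hf : ContinuousOn f s) (hg : ContinuousOn g s)
    (h : ∀ x ∈ s, Complex.exp (f x) = Complex.exp (g x)) {x₀ : X} (h₀ : x₀ ∈ s)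
    (h₁ : f x₀ = g x₀) : EqOn f g s :=
  Complex.isCoveringMap_exp.eqOn_of_comp_eqOn hs hf hg (fun x hx => Subtype.ext (h x hx)) h₀ h₁

theorem exp_two_pi_I_mul_intCast (n : ℤ) : Complex.exp (2 * Real.pi * Complex.I * n) = 1 :=
  Complex.exp_eq_one_iff.2 ⟨n, by ring⟩

theorem apply_eq_of_continuousOn_intCast {X : Type*} [TopologicalSpace X] {s : Set X}
    (hs : IsPreconnected s) {p : X → ℝ} (hp : ContinuousOn p s) (h : ∀ x ∈ s, ∃ n : ℤ, p x = n)
    {x y : X} (hx : x ∈ s) (hy : y ∈ s) : p x = p y := by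
  have h1 : ∀ z ∈ s, Complex.exp (2 * Real.pi * Complex.I * p z) = 1 := by
    intro z hz
    obtain ⟨n, hn⟩ := h z hz
    rw [hn]
    exact_mod_cast exp_two_pi_I_mul_intCast n
  have h2 := eqOn_of_exp_eq hs (f := fun z => 2 * Real.pi * Complex.I * p z)
    (g := fun _ => 2 * Real.pi * Complex.I * p x) (by fun_prop) (by fun_prop)
    (fun z hz => by rw [h1 z hz, h1 x hx]) hx rfl hy
  have h3 := mul_left_cancel₀ Complex.two_pi_I_ne_zero h2
  exact_mod_cast h3.symm

/-- On a circle around `z` there is no continuous logarithm of `w ↦ (w - z)⁻¹`. -/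
theorem not_exists_log_inv_sub {z : ℂ} {R : ℝ} (hz : ‖z‖ < R) {g : ℂ → ℂ} (hg : Continuous g)
    (h : ∀ w, ‖w‖ = R → Complex.exp (g w) = (w - z)⁻¹) : False := by
  have hR : 0 < R := (norm_nonneg z).trans_lt hz
  have hR' : (R : ℂ) ≠ 0 := by exact_mod_cast hR.ne'
  let w : ℝ → ℂ := fun θ => R * Complex.exp (θ * Complex.I)
  have hw0 : ∀ θ, w θ ≠ 0 := fun θ => mul_ne_zero hR' (Complex.exp_ne_zero _)
  have hwn : ∀ θ, ‖w θ‖ = R := fun θ => by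
    simp only [w, norm_mul, Complex.norm_exp_ofReal_mul_I, mul_one, Complex.norm_real,
      Real.norm_of_nonneg hR.le]
  have hwc : Continuous w := by fun_prop
  have hsl : ∀ θ, 1 - z / w θ ∈ Complex.slitPlane := by
    intro θ
    left
    have h1 : ‖z / w θ‖ < 1 := by
      rw [norm_div, hwn, div_lt_one hR]; exact hz
    have h2 := (Complex.re_le_norm (z / w θ)).trans_lt h1
    simp only [Complex.sub_re, Complex.one_re]
    linarith
  let k : ℝ → ℂ := fun θ => g (w θ) + θ * Complex.I + Real.log R + Complex.log (1 - z / w θ)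
  have hk : Continuous k := by
    have h1 : Continuous fun θ => Complex.log (1 - z / w θ) :=
      Continuous.clog (continuous_const.sub (continuous_const.div hwc hw0)) hsl
    have h2 : Continuous fun θ => g (w θ) := hg.comp hwc
    fun_prop
  have hk1 : ∀ θ, Complex.exp (k θ) = 1 := by
    intro θ
    have hwz : w θ - z ≠ 0 := by
      intro h0
      have := hwn θ
      rw [sub_eq_zero.1 h0] at this
      linarith
    simp only [k, Complex.exp_add]
    rw [h _ (hwn θ), Complex.exp_log (Complex.slitPlane_ne_zero (hsl θ)), ← Complex.ofReal_exp,
      Real.exp_log hR]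
    have h3 : Complex.exp (θ * Complex.I) * R = w θ := mul_comm _ _
    have h4 := hw0 θ
    rw [mul_assoc (w θ - z)⁻¹, h3]
    field_simp
  have h5 := eqOn_of_exp_eq isPreconnected_univ hk.continuousOn continuousOn_const
    (g := fun _ => k 0) (fun θ _ => by rw [hk1, hk1]) (mem_univ 0) rfl (mem_univ (2 * Real.pi))
  have h6 : w (2 * Real.pi) = w 0 := by
    simp only [w]
    push_cast
    rw [Complex.exp_two_pi_mul_I]
    simp
  simp only [k, h6] at h5
  push_cast at h5
  have h7 : (2 * Real.pi * Complex.I : ℂ) = 0 := by linear_combination h5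
  exact Complex.two_pi_I_ne_zero h7

/-- A contractible open set cannot surround a compact set in its complement. Here `p` is an
integer-valued function on the complement of `U`, positive at `z` and nonpositive far away;
a logarithm of `x ↦ x - z` on `U` would extend to a logarithm of `(x - z)⁻¹` near infinity. -/
theorem false_of_separated {U : Set ℂ} (hU : IsOpen U) [ContractibleSpace U] {p : ℂ → ℝ}
    (hp : Continuous p) (hpi : ∀ x ∉ U, ∃ n : ℤ, p x = n) {z : ℂ} (hz : z ∉ U) (hpz : 1 ≤ p z)
    {R : ℝ} (hzR : ‖z‖ < R) (hR : ∀ w, ‖w‖ = R → w ∉ U ∧ p w ≤ 0) : False := by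
  classical
  have hne : ∀ x ∈ U, x - z ≠ 0 := fun x hx h => hz (by rwa [← sub_eq_zero.1 h])
  obtain ⟨g, hg, hgexp⟩ := exists_continuous_log (X := U) (f := fun x => (x : ℂ) - z)
    (by fun_prop) (fun x => hne x x.2)
  let G : ℂ → ℂ := fun x => if h : x ∈ U then g ⟨x, h⟩ else 0
  have hG : ContinuousOn G U := by
    rw [continuousOn_iff_continuous_domRestrict]
    convert hg using 1
    funext x
    simp [G]
  have hGexp : ∀ x ∈ U, Complex.exp (G x) = x - z := by
    intro x hx
    simp only [G, hx, dif_pos]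
    exact hgexp ⟨x, hx⟩
  -- a cutoff equal to `1` near the points outside `U` where `p ≥ 1`, and to `0` near the others
  let c : ℂ → ℝ := fun x => min (max (3 * p x - 1) 0) 1
  have hc : Continuous c := by fun_prop
  have hc1 : ∀ x, 2 / 3 < p x → c x = 1 := fun x hx =>
    min_eq_right (le_max_of_le_left (by linarith))
  have hc0 : ∀ x, p x < 1 / 3 → c x = 0 := fun x hx => by
    simp only [c]
    rw [max_eq_right (by linarith)]
    exact min_eq_left zero_le_one
  -- `ψ` interpolates between `1` and `(x - z)⁻¹` without vanishing
  let ψ : ℂ → ℂ := fun x => if x ∈ U then Complex.exp ((c x - 1) * G x) else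
    if 1 / 2 < p x then 1 else (x - z)⁻¹
  have hψ1 : ∀ x, 2 / 3 < p x → ψ x = 1 := by
    intro x hx
    by_cases hxU : x ∈ U
    · simp [ψ, hxU, hc1 x hx]
    · simp only [ψ, hxU, if_false]
      rw [if_pos (by linarith)]
  have hψ0 : ∀ x, p x < 1 / 3 → ψ x = (x - z)⁻¹ := by
    intro x hx
    by_cases hxU : x ∈ U
    · simp only [ψ, hxU, if_true, hc0 x hx]
      rw [← hGexp x hxU, ← Complex.exp_neg]
      simp
    · simp only [ψ, hxU, if_false]
      rw [if_neg (by linarith)]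
  have hoff : ∀ x ∉ U, 2 / 3 < p x ∨ p x < 1 / 3 := by
    intro x hx
    obtain ⟨n, hn⟩ := hpi x hx
    rcases lt_or_ge n 1 with h | h
    · right
      have : (n : ℝ) ≤ 0 := by exact_mod_cast Int.lt_add_one_iff.1 h
      linarith
    · left
      have : (1 : ℝ) ≤ n := by exact_mod_cast h
      linarith
  have hzne : ∀ x, p x < 1 / 3 → x - z ≠ 0 := by
    intro x hx h
    rw [sub_eq_zero.1 h] at hx
    linarith
  have hψc : Continuous ψ := by
    rw [continuous_iff_continuousAt]
    intro x
    by_cases hx : x ∈ U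
    · have h1 : ContinuousAt (fun y => Complex.exp ((c y - 1) * G y)) x := by
        have := hG.continuousAt (hU.mem_nhds hx)
        have := hc.continuousAt (x := x)
        fun_prop
      refine h1.congr ?_
      filter_upwards [hU.mem_nhds hx] with y hy
      simp [ψ, hy]
    · rcases hoff x hx with h | h
      · refine (continuousAt_const (y := (1 : ℂ))).congr ?_
        filter_upwards [(isOpen_lt continuous_const hp).mem_nhds h] with y hy
        exact (hψ1 y hy).symm
      · have h1 : ContinuousAt (fun y => (y - z)⁻¹) x :=
          (continuousAt_id.sub continuousAt_const).inv₀ (hzne x h)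
        refine h1.congr ?_
        filter_upwards [(isOpen_lt hp continuous_const).mem_nhds h] with y hy
        exact (hψ0 y hy).symm
  have hψne : ∀ x, ψ x ≠ 0 := by
    intro x
    by_cases hx : x ∈ U
    · simp [ψ, hx, Complex.exp_ne_zero]
    · rcases hoff x hx with h | h
      · rw [hψ1 x h]; exact one_ne_zero
      · rw [hψ0 x h]; exact inv_ne_zero (hzne x h)
  obtain ⟨L, hL, hLexp⟩ := exists_continuous_log hψc hψne
  refine not_exists_log_inv_sub hzR hL fun w hw => ?_
  rw [hLexp, hψ0 w (by linarith [(hR w hw).2])]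

/-- If the frontier of an open connected set `U` splits into two closed pieces, then some continuous
function on the plane is `0` on one piece, `1` on the other, and takes integer values outside `U`.
It is a logarithm of the function equal to `exp (2πiχ)` on `U` and to `1` outside, where `χ`
separates the two pieces. -/
theorem exists_separating_of_frontier {U : Set ℂ} (hUc : IsConnected U)
    {u v : Set ℂ} (hu : IsClosed u) (hv : IsClosed v) (huv : Disjoint u v)
    (hsub : frontier U ⊆ u ∪ v) :
    ∃ p : ℂ → ℝ, Continuous p ∧ (∀ x ∉ U, ∃ n : ℤ, p x = n) ∧
      (∀ x ∈ frontier U ∩ u, p x = 0) ∧ ∀ x ∈ frontier U ∩ v, p x = 1 := by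
  classical
  obtain ⟨χ, hχ0, hχ1, -⟩ := exists_continuous_zero_one_of_isClosed hu hv huv
  have hφ : Continuous fun x => if x ∈ U then Complex.exp (2 * Real.pi * Complex.I * χ x) else 1 := by
    refine Continuous.if (fun x hx => ?_) (by fun_prop) continuous_const
    rcases hsub hx with h | h
    · rw [hχ0 h]; simp
    · rw [hχ1 h]; simp
  obtain ⟨L, hL, hLexp⟩ := exists_continuous_log hφ (fun x => by
    split_ifs
    · exact Complex.exp_ne_zero _
    · exact one_ne_zero)
  obtain ⟨x₀, hx₀⟩ := hUc.nonempty
  have h1 : ∀ x ∈ U, L x = 2 * Real.pi * Complex.I * χ x +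
      (L x₀ - 2 * Real.pi * Complex.I * χ x₀) := by
    refine eqOn_of_exp_eq hUc.isPreconnected hL.continuousOn (by fun_prop) (fun x hx => ?_) hx₀
      (by ring)
    rw [Complex.exp_add, Complex.exp_sub, hLexp, hLexp, if_pos hx, if_pos hx₀,
      div_self (Complex.exp_ne_zero _), mul_one]
  obtain ⟨n₀, hn₀⟩ := Complex.exp_eq_exp_iff_exists_int.1 ((hLexp x₀).trans (if_pos hx₀))
  have h2 : ∀ x ∈ closure U, L x = 2 * Real.pi * Complex.I * (χ x + n₀) := by
    intro x hx
    refine closure_minimal (t := {x | L x = 2 * Real.pi * Complex.I * (χ x + n₀)}) ?_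
      (isClosed_eq hL (by fun_prop)) hx
    intro y hy
    simp only [mem_ofPred_eq, h1 y hy, hn₀]
    ring
  have hpi : (2 * Real.pi : ℝ) ≠ 0 := by positivity
  have him : ∀ (x : ℂ) (r : ℝ), L x = 2 * Real.pi * Complex.I * r →
      (L x).im / (2 * Real.pi) = r := by
    intro x r h
    rw [h]
    have : (2 * Real.pi * Complex.I * r : ℂ) = ((2 * Real.pi * r : ℝ) : ℂ) * Complex.I := by
      push_cast; ring
    rw [this, Complex.im_ofReal_mul, Complex.I_im]
    field_simp
  refine ⟨fun x => (L x).im / (2 * Real.pi) - n₀, by fun_prop, fun x hx => ?_, fun x hx => ?_,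
    fun x hx => ?_⟩
  · have h3 := hLexp x
    rw [if_neg hx] at h3
    obtain ⟨n, hn⟩ := Complex.exp_eq_one_iff.1 h3
    refine ⟨n - n₀, ?_⟩
    simp only
    rw [him x n (by rw [hn]; push_cast; ring)]
    push_cast; ring
  · have h3 := h2 x (frontier_subset_closure hx.1)
    rw [hχ0 hx.2] at h3
    simp only
    rw [him x n₀ (by rw [h3]; simp), sub_self]
  · have h3 := h2 x (frontier_subset_closure hx.1)
    rw [hχ1 hx.2] at h3
    simp only
    rw [him x (1 + n₀) (by rw [h3]; simp), add_sub_cancel_right]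

/-- The frontier of a bounded contractible open set of the plane is connected. Otherwise the
complement of the set would split into two closed pieces, one of them surrounded by the set. -/
theorem isPreconnected_frontier_of_contractible {U : Set ℂ} (hU : IsOpen U) (hUc : IsConnected U)
    (hUb : Bornology.IsBounded U) [ContractibleSpace U] : IsPreconnected (frontier U) := by
  rw [isPreconnected_iff_subset_of_fully_disjoint_closed isClosed_frontier]
  intro u v hu hv hsub huv
  by_contra! hcon
  obtain ⟨⟨b, hb, hbu⟩, ⟨a, ha, hav⟩⟩ := And.imp not_subset.1 not_subset.1 hcon
  have hau := (hsub ha).resolve_right hav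
  have hbv := (hsub hb).resolve_left hbu
  obtain ⟨p, hp, hpi, hp0, hp1⟩ := exists_separating_of_frontier hUc hu hv huv hsub
  obtain ⟨R, hR⟩ := hUb.closure.subset_ball 0
  have hfr : ∀ x ∈ frontier U, x ∉ U ∧ ‖x‖ < R := by
    intro x hx
    refine ⟨?_, by simpa using hR (frontier_subset_closure hx)⟩
    rw [hU.frontier_eq] at hx
    exact hx.2
  have hRU : ∀ w : ℂ, ‖w‖ = R → w ∉ U := by
    intro w hw hwU
    have := hR (subset_closure hwU)
    rw [mem_ball_zero_iff] at this
    linarith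
  have hsph : IsPreconnected (Metric.sphere (0 : ℂ) R) :=
    isPreconnected_sphere (by rw [Complex.rank_real_complex]; norm_num) 0 R
  have hRpos : 0 ≤ R := (norm_nonneg a).trans (hfr a ha).2.le
  have hmem : (R : ℂ) ∈ Metric.sphere (0 : ℂ) R := by
    simp [abs_of_nonneg hRpos]
  have hconst : ∀ w : ℂ, ‖w‖ = R → p w = p R := fun w hw =>
    apply_eq_of_continuousOn_intCast hsph hp.continuousOn
      (fun x hx => hpi x (hRU x (by simpa using hx))) (by simpa using hw) hmem
  obtain ⟨n, hn⟩ := hpi R (hRU R (by simpa using hmem))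
  -- the piece of the complement that does not reach infinity is the one on which `p` differs
  -- from its value on a large circle
  rcases lt_or_ge n 1 with h | h
  · have hn0 : (n : ℝ) ≤ 0 := by exact_mod_cast Int.lt_add_one_iff.1 h
    exact false_of_separated hU hp hpi (hfr b hb).1 (hp1 b ⟨hb, hbv⟩).ge (hfr b hb).2
      fun w hw => ⟨hRU w hw, by rw [hconst w hw, hn]; exact hn0⟩
  · have hn1 : (1 : ℝ) ≤ n := by exact_mod_cast h
    refine false_of_separated hU (p := fun x => 1 - p x) (by fun_prop) (fun x hx => ?_)
      (hfr a ha).1 (by rw [hp0 a ⟨ha, hau⟩]; norm_num) (hfr a ha).2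
      fun w hw => ⟨hRU w hw, by rw [hconst w hw, hn]; linarith⟩
    obtain ⟨m, hm⟩ := hpi x hx
    exact ⟨1 - m, by rw [hm]; push_cast; ring⟩

/-- The identification of the Euclidean plane with the complex plane. -/
def toC : Plane ≃ₗᵢ[ℝ] ℂ := Complex.orthonormalBasisOneI.repr.symm

theorem toC_apply (x : Plane) : toC x = x 0 + x 1 * Complex.I :=
  Complex.orthonormalBasisOneI_repr_symm_apply x

namespace PolygonalMesh

variable {Ω : Set Plane} {ιT ιE ιV : Type*} (M : PolygonalMesh Ω ιT ιE ιV)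

theorem isPreconnected_frontier_elem (T : ιT) [ContractibleSpace (M.elem T)] :
    IsPreconnected (frontier (M.elem T)) := by
  let e : Plane ≃ₜ ℂ := toC.toHomeomorph
  have : ContractibleSpace (e '' M.elem T) := (e.image (M.elem T)).symm.contractibleSpace
  have h := isPreconnected_frontier_of_contractible (U := e '' M.elem T)
    (e.isOpenMap _ (M.isOpen_elem T)) ((M.elem_polygonal T).1.image _ e.continuous.continuousOn)
    (toC.lipschitz.isBounded_image (M.isBounded_elem T))
  rw [← e.image_frontier] at h
  exact (e.isInducing.isPreconnected_image).1 h

theorem nonempty_frontier_elem (T : ιT) : (frontier (M.elem T)).Nonempty := by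
  rw [nonempty_frontier_iff]
  refine ⟨(M.elem_polygonal T).1.nonempty, fun huniv => ?_⟩
  have := M.isBounded_elem T
  rw [huniv] at this
  exact NormedSpace.unbounded_univ ℝ Plane this

variable [Fintype ιT] [Fintype ιE]

/-- Two elements with frontiers in disjoint parts of the skeleton have disjoint closures, so a
splitting of the skeleton would split the closure of the domain. -/
theorem isPreconnected_skel (hΩ : IsPreconnected (closure Ω))
    (hT : ∀ T, ContractibleSpace (M.elem T)) : IsPreconnected M.skel := by
  rw [isPreconnected_iff_subset_of_fully_disjoint_closed M.isClosed_skel]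
  intro u v hu hv hsub huv
  have hfr : ∀ T, frontier (M.elem T) ⊆ u ∨ frontier (M.elem T) ⊆ v := fun T => by
    have := hT T
    exact (isPreconnected_iff_subset_of_fully_disjoint_closed isClosed_frontier).1
      (M.isPreconnected_frontier_elem T) u v hu hv ((M.frontier_subset_skel T).trans hsub) huv
  let C : Set Plane → Set Plane := fun w =>
    ⋃ T ∈ {T | frontier (M.elem T) ⊆ w}, closure (M.elem T)
  have hC : ∀ w, IsClosed (C w) := fun w =>
    (toFinite _).isClosed_biUnion fun _ _ => isClosed_closure
  have hdisj : Disjoint (C u) (C v) := by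
    rw [disjoint_left]
    intro x hxu hxv
    obtain ⟨T, hT1, hx1⟩ := mem_iUnion₂.1 hxu
    obtain ⟨T', hT2, hx2⟩ := mem_iUnion₂.1 hxv
    have hTT : T ≠ T' := by
      rintro rfl
      obtain ⟨z, hz⟩ := M.nonempty_frontier_elem T
      exact disjoint_left.1 huv (hT1 hz) (hT2 hz)
    have key : ∀ T T', T ≠ T' → x ∈ closure (M.elem T) → x ∈ closure (M.elem T') →
        x ∈ frontier (M.elem T) := by
      intro T T' hTT h h'
      rw [(M.isOpen_elem T).frontier_eq]
      refine ⟨h, fun hx => ?_⟩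
      obtain ⟨y, hy, hy'⟩ := mem_closure_iff.1 h' _ (M.isOpen_elem T) hx
      exact disjoint_left.1 (M.elem_disjoint hTT) hy hy'
    exact disjoint_left.1 huv (hT1 (key T T' hTT hx1 hx2)) (hT2 (key T' T hTT.symm hx2 hx1))
  have hcover : closure Ω ⊆ C u ∪ C v := by
    rw [M.elem_cover]
    refine iUnion_subset fun T => ?_
    rcases hfr T with h | h
    · exact subset_union_of_subset_left (fun x hx => mem_iUnion₂.2 ⟨T, h, hx⟩) _
    · exact subset_union_of_subset_right (fun x hx => mem_iUnion₂.2 ⟨T, h, hx⟩) _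
  have hmain : ∀ w w', Disjoint (C w) (C w') → closure Ω ⊆ C w →
      ∀ T, ¬ frontier (M.elem T) ⊆ w' := by
    intro w w' hd hsub T h
    obtain ⟨x, hx⟩ := (M.elem_polygonal T).1.nonempty
    have hxΩ : x ∈ closure Ω := by
      rw [M.elem_cover]
      exact mem_iUnion.2 ⟨T, subset_closure hx⟩
    exact disjoint_left.1 hd (hsub hxΩ) (mem_iUnion₂.2 ⟨T, h, subset_closure hx⟩)
  have hskel : M.skel = ⋃ T, frontier (M.elem T) := M.skeleton.symm
  rw [hskel]
  rcases (isPreconnected_iff_subset_of_fully_disjoint_closed isClosed_closure).1 hΩ _ _ (hC u)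
    (hC v) hcover hdisj with h | h
  · exact Or.inl (iUnion_subset fun T => (hfr T).resolve_right (hmain u v hdisj h T))
  · exact Or.inr (iUnion_subset fun T => (hfr T).resolve_left (hmain v u hdisj.symm h T))

/-- A function of the vertices that takes the same value at both end points of each edge is
constant: the skeleton is connected. -/
theorem apply_vertex_eq (hΩ : IsPreconnected (closure Ω))
    (hT : ∀ T, ContractibleSpace (M.elem T)) {α : Type*} (f : ιV → α)
    (hf : ∀ E, f (M.src E) = f (M.tgt E)) (v w : ιV) : f v = f w := by
  let S : ιE → Set Plane := fun E => segment ℝ (M.vtx (M.src E)) (M.vtx (M.tgt E))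
  have hval : ∀ E ν, M.vtx ν ∈ S E → f ν = f (M.src E) := by
    intro E ν h
    simp only [S, M.segment_eq] at h
    rcases h with h | h | h
    · rw [M.vtx_injective h]
    · rw [M.vtx_injective h, hf]
    · exact absurd h (M.vtx_notMem_edge ν E)
  have hmeet : ∀ E E' x, x ∈ S E → x ∈ S E' → f (M.src E) = f (M.src E') := by
    intro E E' x h h'
    have h0 := h
    simp only [S, M.segment_eq] at h
    rcases h with h | h | h
    · exact hval E' _ (h ▸ h')
    · exact (hf E).trans (hval E' _ (h ▸ h'))
    · have h1 := h'
      simp only [S, M.segment_eq] at h'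
      rcases h' with h' | h' | h'
      · exact (hval E _ (h' ▸ h0)).symm
      · exact ((hf E').trans (hval E _ (h' ▸ h0))).symm
      · by_cases hE : E = E'
        · rw [hE]
        · exact absurd h' (disjoint_left.1 (M.edge_disjoint hE) h)
  have hend : ∀ ν, ∃ E, M.vtx ν ∈ S E := by
    intro ν
    obtain ⟨E, rfl | rfl⟩ := M.vtx_endpoint ν
    · exact ⟨E, left_mem_segment ℝ _ _⟩
    · exact ⟨E, right_mem_segment ℝ _ _⟩
  let A : Set Plane := ⋃ E ∈ {E | f (M.src E) = f v}, S E
  let B : Set Plane := ⋃ E ∈ {E | f (M.src E) ≠ f v}, S E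
  have hA : IsClosed A := (toFinite _).isClosed_biUnion fun _ _ => isClosed_segment _ _
  have hB : IsClosed B := (toFinite _).isClosed_biUnion fun _ _ => isClosed_segment _ _
  have hAB : Disjoint A B := by
    rw [disjoint_left]
    intro x hx hx'
    obtain ⟨E, hE, hxE⟩ := mem_iUnion₂.1 hx
    obtain ⟨E', hE', hxE'⟩ := mem_iUnion₂.1 hx'
    exact hE' ((hmeet E' E x hxE' hxE).trans hE)
  have hcov : M.skel ⊆ A ∪ B := by
    refine iUnion_subset fun E => ?_
    by_cases h : f (M.src E) = f v
    · exact subset_union_of_subset_left (fun x hx => mem_iUnion₂.2 ⟨E, h, hx⟩) _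
    · exact subset_union_of_subset_right (fun x hx => mem_iUnion₂.2 ⟨E, h, hx⟩) _
  obtain ⟨Ev, hEv⟩ := hend v
  have hvA : M.vtx v ∈ A := mem_iUnion₂.2 ⟨Ev, (hval Ev v hEv).symm, hEv⟩
  rcases (isPreconnected_iff_subset_of_fully_disjoint_closed M.isClosed_skel).1
    (M.isPreconnected_skel hΩ hT) A B hA hB hcov hAB with h | h
  · obtain ⟨Ew, hEw⟩ := hend w
    obtain ⟨E, hE, hwE⟩ := mem_iUnion₂.1 (h (mem_iUnion.2 ⟨Ew, hEw⟩))
    rw [hval E w hwE]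
    exact hE.symm
  · exact absurd (h (mem_iUnion.2 ⟨Ev, hEv⟩)) (disjoint_left.1 hAB hvA)

end PolygonalMesh

/-! ### The angle subtended by a segment -/

theorem left_sub_ne_zero_of_notMem_segment {a b z : ℂ} (hz : z ∉ segment ℝ a b) : a - z ≠ 0 :=
  fun h => hz (sub_eq_zero.1 h ▸ left_mem_segment ℝ a b)

theorem right_sub_ne_zero_of_notMem_segment {a b z : ℂ} (hz : z ∉ segment ℝ a b) : b - z ≠ 0 :=
  fun h => hz (sub_eq_zero.1 h ▸ right_mem_segment ℝ a b)

theorem div_mem_slitPlane_of_notMem_segment {a b z : ℂ} (hz : z ∉ segment ℝ a b) :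
    (b - z) / (a - z) ∈ Complex.slitPlane := by
  have ha := left_sub_ne_zero_of_notMem_segment hz
  by_contra hcon
  rw [Complex.mem_slitPlane_iff, not_or, not_lt, not_not] at hcon
  obtain ⟨hre, him⟩ := hcon
  set r := ((b - z) / (a - z)).re with hr
  have hq : (b - z) / (a - z) = (r : ℂ) := Complex.ext (by simp [hr]) (by simp [him])
  rw [div_eq_iff ha] at hq
  have h1 : 0 < 1 - r := by linarith
  have h1' : (1 - r : ℂ) ≠ 0 := by exact_mod_cast h1.ne'
  refine hz ⟨-r / (1 - r), 1 / (1 - r), div_nonneg (by linarith) h1.le, by positivity, ?_, ?_⟩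
  · field_simp
    ring
  · simp only [Complex.real_smul]
    push_cast
    field_simp
    linear_combination hq

/-- The complex angle under which the segment from `a` to `b` is seen from `z`. -/
def viewAngle (a b z : ℂ) : ℂ := Complex.log ((b - z) / (a - z))

theorem hasDerivAt_viewAngle {a b z : ℂ} (hz : z ∉ segment ℝ a b) :
    HasDerivAt (viewAngle a b) (1 / (a - z) - 1 / (b - z)) z := by
  have ha := left_sub_ne_zero_of_notMem_segment hz
  have hb := right_sub_ne_zero_of_notMem_segment hz
  have h1 : HasDerivAt (fun z => (b - z) / (a - z))
      (((-1) * (a - z) - (b - z) * (-1)) / (a - z) ^ 2) z :=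
    ((hasDerivAt_id z).const_sub b).div ((hasDerivAt_id z).const_sub a) ha
  have h2 : HasDerivAt (viewAngle a b) _ z := h1.clog (div_mem_slitPlane_of_notMem_segment hz)
  convert h2 using 1
  field_simp
  ring

/-- A continuous logarithm of `ζ ↦ ζ - z` along the segment computes the view angle. -/
theorem viewAngle_eq_sub {a b z : ℂ} (hz : z ∉ segment ℝ a b) {G : ℂ → ℂ}
    (hG : ContinuousOn G (segment ℝ a b))
    (hexp : ∀ ζ ∈ segment ℝ a b, Complex.exp (G ζ) = ζ - z) : viewAngle a b z = G b - G a := by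
  have ha := left_sub_ne_zero_of_notMem_segment hz
  have hsl : ∀ ζ ∈ segment ℝ a b, (ζ - z) / (a - z) ∈ Complex.slitPlane := fun ζ hζ =>
    div_mem_slitPlane_of_notMem_segment fun h => hz
      ((convex_segment a b).segment_subset (left_mem_segment ℝ a b) hζ h)
  have h := eqOn_of_exp_eq (convex_segment (𝕜 := ℝ) a b).isPreconnected hG
    (g := fun ζ => Complex.log ((ζ - z) / (a - z)) + G a)
    ((ContinuousOn.clog (by fun_prop) hsl).add continuousOn_const) (fun ζ hζ => ?_)
    (left_mem_segment ℝ a b) (by simp [div_self ha]) (right_mem_segment ℝ a b)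
  · rw [h]; simp [viewAngle]
  · rw [Complex.exp_add, Complex.exp_log (Complex.slitPlane_ne_zero (hsl ζ hζ)), hexp ζ hζ,
      hexp a (left_mem_segment ℝ a b), div_mul_cancel₀ _ ha]

/-- The view angle of a segment jumps by `2πi` across the segment. -/
theorem tendsto_viewAngle_sub {τ p : ℂ} (hτ : τ ≠ 0) {u v : ℝ} (hu : 0 < u) (hv : 0 < v) :
    Filter.Tendsto (fun s : ℝ =>
      viewAngle (p - u * τ) (p + v * τ) (p + s * (Complex.I * τ)) -
      viewAngle (p - u * τ) (p + v * τ) (p - s * (Complex.I * τ))) (𝓝[>] 0)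
      (𝓝 (2 * Real.pi * Complex.I)) := by
  let q : ℝ → ℂ := fun s => (v - s * Complex.I) / (-u - s * Complex.I)
  have hden : ∀ s : ℝ, (-u - s * Complex.I : ℂ) ≠ 0 := by
    intro s h
    have := congrArg Complex.re h
    simp at this
    exact hu.ne' this
  have hqc : Continuous q := by
    refine Continuous.div (by fun_prop) (by fun_prop) hden
  have hq : ∀ s : ℝ, viewAngle (p - u * τ) (p + v * τ) (p + s * (Complex.I * τ)) =
      Complex.log (q s) := by
    intro s
    simp only [viewAngle, q]
    rw [← mul_div_mul_right _ (-u - s * Complex.I : ℂ) hτ]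
    congr 2 <;> ring
  have hq' : ∀ s : ℝ, viewAngle (p - u * τ) (p + v * τ) (p - s * (Complex.I * τ)) =
      Complex.log (q (-s)) := by
    intro s
    rw [← hq]
    push_cast
    congr 1
    ring
  have him : ∀ s : ℝ, (q s).im = s * (u + v) / (u ^ 2 + s ^ 2) := by
    intro s
    have h1 : u ^ 2 + s ^ 2 ≠ 0 := by positivity
    simp only [q, Complex.div_im, Complex.normSq_apply]
    simp
    field_simp
    ring
  have hq0 : q 0 = ((-(v / u) : ℝ) : ℂ) := by
    have : (u : ℂ) ≠ 0 := by exact_mod_cast hu.ne'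
    simp only [q]
    push_cast
    simp
    field_simp
  have hre0 : (q 0).re < 0 := by
    rw [hq0, Complex.ofReal_re]
    exact neg_neg_of_pos (div_pos hv hu)
  have him0 : (q 0).im = 0 := by rw [hq0, Complex.ofReal_im]
  have h1 : Filter.Tendsto q (𝓝[>] 0) (𝓝[{z : ℂ | 0 ≤ z.im}] (q 0)) := by
    refine tendsto_nhdsWithin_iff.2 ⟨hqc.continuousAt.tendsto.mono_left nhdsWithin_le_nhds, ?_⟩
    filter_upwards [self_mem_nhdsWithin] with s hs
    have hs : 0 < s := hs
    simp only [him]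
    positivity
  have h2 : Filter.Tendsto (fun s => q (-s)) (𝓝[>] 0) (𝓝[{z : ℂ | z.im < 0}] (q 0)) := by
    refine tendsto_nhdsWithin_iff.2 ⟨?_, ?_⟩
    · have : ContinuousAt (fun s => q (-s)) 0 := by fun_prop
      simpa [ContinuousAt] using this.tendsto.mono_left nhdsWithin_le_nhds
    · filter_upwards [self_mem_nhdsWithin] with s hs
      have hs : 0 < s := hs
      simp only [him]
      rw [neg_mul, neg_div, neg_neg_iff_pos]
      positivity
  have h3 := ((Complex.tendsto_log_nhdsWithin_im_nonneg_of_re_neg_of_im_zero hre0 him0).comp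
    h1).sub ((Complex.tendsto_log_nhdsWithin_im_neg_of_re_neg_of_im_zero hre0 him0).comp h2)
  simp only [hq, hq']
  have h4 : 2 * Real.pi * Complex.I = Real.log ‖q 0‖ + Real.pi * Complex.I -
      (Real.log ‖q 0‖ - Real.pi * Complex.I) := by ring
  rw [h4]
  exact h3

namespace PolygonalMesh

variable {Ω : Set Plane} {ιT ιE ιV : Type*} (M : PolygonalMesh Ω ιT ιE ιV)

/-! ### Incidence numbers of edges and elements -/

open Classical in
/-- The incidence number of `T` and `E`: the orientation `ω_{TE}` for an edge of `T`, and `0` for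
other edges. -/
def incidence [Fintype ιE] (T : ιT) (E : ιE) : ℝ := if E ∈ M.edgesOf T then M.omega T E else 0

theorem vtx_mem_skel (ν : ιV) : M.vtx ν ∈ M.skel := by
  obtain ⟨E, rfl | rfl⟩ := M.vtx_endpoint ν
  · exact mem_iUnion.2 ⟨E, left_mem_segment ℝ _ _⟩
  · exact mem_iUnion.2 ⟨E, right_mem_segment ℝ _ _⟩

theorem exists_mem_edge_or_vtx {x : Plane} (hx : x ∈ M.skel) :
    (∃ E, x ∈ M.edge E) ∨ ∃ ν, M.vtx ν = x := by
  obtain ⟨E, hE⟩ := mem_iUnion.1 hx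
  rw [M.segment_eq] at hE
  rcases hE with h | h | h
  · exact Or.inr ⟨_, h.symm⟩
  · exact Or.inr ⟨_, h.symm⟩
  · exact Or.inl ⟨E, h⟩

/-- Near a point of an edge, the line that carries the edge coincides with it. -/
theorem eventually_mem_edge {E : ιE} {x : Plane} (hx : x ∈ M.edge E) :
    ∀ᶠ y in 𝓝 x, M.side E x y = 0 → y ∈ M.edge E := by
  obtain ⟨s, hs, rfl⟩ := M.mem_edge_iff.1 hx
  let f : Plane → ℝ := fun y => M.tangent E 0 * (y 0 - M.vtx (M.src E) 0) +
    M.tangent E 1 * (y 1 - M.vtx (M.src E) 1)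
  have hf : Continuous f := by fun_prop
  have hn := M.normal_sq E
  simp only [normal, PiLp.toLp_apply, Matrix.cons_val_zero, Matrix.cons_val_one] at hn
  have hfs : f (M.pt E s) = s := by
    simp only [f, pt, PiLp.add_apply, PiLp.smul_apply, smul_eq_mul]
    linear_combination s * hn
  filter_upwards [hf.continuousAt.preimage_mem_nhds (Ioo_mem_nhds (hfs.symm ▸ hs.1)
    (hfs.symm ▸ hs.2))] with y hy h0
  refine M.mem_edge_iff.2 ⟨f y, hy, ?_⟩
  simp only [side, normal, pt, PiLp.toLp_apply, Matrix.cons_val_zero, Matrix.cons_val_one,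
    PiLp.add_apply, PiLp.smul_apply, smul_eq_mul] at h0
  ext i
  fin_cases i
  · simp only [f, pt, PiLp.add_apply, PiLp.smul_apply, smul_eq_mul, Fin.zero_eta]
    linear_combination M.tangent E 1 * h0 + (y 0 - M.vtx (M.src E) 0) * hn
  · simp only [f, pt, PiLp.add_apply, PiLp.smul_apply, smul_eq_mul, Fin.mk_one]
    linear_combination -M.tangent E 0 * h0 + (y 1 - M.vtx (M.src E) 1) * hn

theorem exists_notMem_skel_notMem_elem [Finite ιT] :
    ∃ y, y ∉ M.skel ∧ ∀ T, y ∉ M.elem T := by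
  have hb : Bornology.IsBounded (⋃ T, closure (M.elem T)) :=
    Bornology.isBounded_iUnion.2 fun T => (M.isBounded_elem T).closure
  have hne : (⋃ T, closure (M.elem T)) ≠ univ := fun h =>
    NormedSpace.unbounded_univ ℝ Plane (h ▸ hb)
  obtain ⟨y, hy⟩ := (ne_univ_iff_exists_notMem _).1 hne
  simp only [mem_iUnion, not_exists] at hy
  refine ⟨y, fun h => ?_, fun T h => hy T (subset_closure h)⟩
  unfold skel at h
  rw [← M.skeleton] at h
  obtain ⟨T, hT⟩ := mem_iUnion.1 h
  exact hy T (frontier_subset_closure hT)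

theorem dense_compl_skel [Finite ιT] : Dense M.skelᶜ := by
  have h : M.skelᶜ = ⋂ T, (frontier (M.elem T))ᶜ := by
    unfold skel
    rw [← M.skeleton, compl_iUnion]
  rw [h]
  refine dense_iInter_of_isOpen (fun T => isClosed_frontier.isOpen_compl) fun T => ?_
  rw [← interior_eq_empty_iff_dense_compl, ← frontier_compl]
  exact interior_frontier (M.isOpen_elem T).isClosed_compl

open Classical in
theorem sum_ite_mem_elem {α : Type*} [AddCommMonoid α] [Fintype ιT] (c : ιT → α) {T : ιT}
    {x : Plane} (hx : x ∈ M.elem T) : ∑ T', (if x ∈ M.elem T' then c T' else 0) = c T := by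
  rw [Finset.sum_eq_single T, if_pos hx]
  · intro T' _ hne
    exact if_neg fun h => disjoint_left.1 (M.elem_disjoint hne) h hx
  · simp

variable [Fintype ιE]

open Classical in
theorem incidence_eq (T : ιT) (E : ιE) : M.incidence T E =
    (if M.OnSide T E (-1) then 1 else 0) - if M.OnSide T E 1 then 1 else 0 := by
  unfold incidence
  simp only [mem_edgesOf_iff, omega_eq]
  have := M.not_onSide_neg (T := T) (E := E)
  by_cases h1 : M.OnSide T E 1 <;> by_cases h2 : M.OnSide T E (-1) <;> simp_all

theorem sum_incidence_mul (T : ιT) (f : ιE → ℝ) :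
    ∑ E, M.incidence T E * f E = ∑ E ∈ M.edgesOf T, M.omega T E * f E := by
  classical
  simp only [incidence, ite_mul, zero_mul, Finset.sum_ite_mem, Finset.univ_inter]

/-- Each half disc of small radius around a point of an edge avoids the skeleton, and is contained
in the elements lying along the edge on its side and disjoint from the other elements. -/
theorem exists_ball_mem_elem_iff {E : ιE} {x : Plane} (hx : x ∈ M.edge E) :
    ∃ r > 0, ∀ σ : ℝ, σ * σ = 1 → ∀ y ∈ M.halfDisc E x r σ,
      y ∉ M.skel ∧ ∀ T, y ∈ M.elem T ↔ M.OnSide T E σ := by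
  obtain ⟨r, hr, hS, hd⟩ := M.exists_halfDisc hx
  refine ⟨r, hr, fun σ hσ y hy => ⟨fun hyS => ?_, fun T => ⟨fun hyT => ?_, fun h => ?_⟩⟩⟩
  · have h0 := M.side_eq_of_mem_edge hx (hS ⟨hy.1, hyS⟩) y
    rw [side_self] at h0
    have := hy.2
    simp [h0] at this
  · by_contra hcon
    obtain ⟨r', hr', hd'⟩ := M.disjoint_of_not_onSide hσ hcon hx
    obtain ⟨z, hz⟩ := M.halfDisc_nonempty E x (lt_min hr hr') hσ
    have h1 := (hd T σ).resolve_right fun h => disjoint_left.1 h hy hyT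
    exact disjoint_left.1 hd' (M.halfDisc_subset_of_mem_edge hx hx
      (Metric.ball_subset_ball (min_le_right _ _)) hz) (h1 (M.halfDisc_subset_of_mem_edge hx hx
      (Metric.ball_subset_ball (min_le_left _ _)) hz))
  · refine (hd T σ).resolve_right (fun h' => ?_) hy
    obtain ⟨r', hr', hs'⟩ := h x hx
    obtain ⟨z, hz⟩ := M.halfDisc_nonempty E x (lt_min hr hr') hσ
    exact disjoint_left.1 h' (M.halfDisc_subset_of_mem_edge hx hx
      (Metric.ball_subset_ball (min_le_left _ _)) hz) (hs' (M.halfDisc_subset_of_mem_edge hx hx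
      (Metric.ball_subset_ball (min_le_right _ _)) hz))

/-- The difference of the values of `∑_T c_T 1_T` on both sides of an edge. -/
theorem sum_incidence_smul_eq [Fintype ιT] {α : Type*} [AddCommGroup α] [Module ℝ α] (c : ιT → α)
    (E : ιE) : ∑ T, M.incidence T E • c T = (open Classical in
      ∑ T, (if M.OnSide T E (-1) then c T else 0) - ∑ T, if M.OnSide T E 1 then c T else 0) := by
  simp only [incidence_eq, sub_smul, ite_smul, one_smul, zero_smul, Finset.sum_sub_distrib]

/-- The incidence matrix of edges and elements has linearly independent columns: if
`∑_T ω_{TE} c_T = 0` for every edge, then `∑_T c_T 1_T` does not jump across any edge, hence is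
constant outside of the finitely many vertices, and it vanishes far away. -/
theorem eq_zero_of_sum_incidence_eq_zero [Fintype ιT] [Finite ιV] (c : ιT → ℝ)
    (h : ∀ E, ∑ T, M.incidence T E * c T = 0) : c = 0 := by
  classical
  let m : Plane → ℝ := fun y => ∑ T, if y ∈ M.elem T then c T else 0
  have hs : IsPreconnected (range M.vtx)ᶜ := by
    refine (Set.Countable.isConnected_compl_of_one_lt_rank ?_
      (finite_range M.vtx).countable).isPreconnected
    rw [← Module.finrank_eq_rank, finrank_euclideanSpace_fin]
    norm_num
  have hloc : ∀ x ∈ (range M.vtx)ᶜ, ∃ κ, ∀ᶠ y in 𝓝 x, y ∈ M.skelᶜ → m y = κ := by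
    intro x hx
    by_cases hxS : x ∈ M.skel
    · obtain ⟨E, hE⟩ := (M.exists_mem_edge_or_vtx hxS).resolve_right hx
      obtain ⟨r, hr, hr'⟩ := M.exists_ball_mem_elem_iff hE
      refine ⟨∑ T, if M.OnSide T E 1 then c T else 0, ?_⟩
      have hE' := M.sum_incidence_smul_eq c E
      simp only [smul_eq_mul, h E] at hE'
      filter_upwards [Metric.ball_mem_nhds x hr, M.eventually_mem_edge hE] with y hy hy0 hyS
      have hside : M.side E x y ≠ 0 := fun h0 => hyS (M.edge_subset_skel E (hy0 h0))
      rcases lt_or_gt_of_ne hside with h1 | h1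
      · have := (hr' (-1) (by norm_num) y ⟨hy, by simp only [mem_ofPred_eq]; linarith⟩).2
        simp only [m, this]
        linarith
      · have := (hr' 1 (by norm_num) y ⟨hy, by simp only [mem_ofPred_eq]; linarith⟩).2
        simp only [m, this]
    · refine ⟨m x, ?_⟩
      have hT : ∀ T, ∀ᶠ y in 𝓝 x, (y ∈ M.elem T ↔ x ∈ M.elem T) := by
        intro T
        by_cases hx1 : x ∈ M.elem T
        · filter_upwards [(M.isOpen_elem T).mem_nhds hx1] with y hy
          simp [hx1, hy]
        · have hx2 : x ∉ closure (M.elem T) := fun hc => hxS (M.frontier_subset_skel T (by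
            rw [(M.isOpen_elem T).frontier_eq]; exact ⟨hc, hx1⟩))
          filter_upwards [isClosed_closure.isOpen_compl.mem_nhds hx2] with y hy
          exact ⟨fun hyT => absurd (subset_closure hyT) hy, fun hxT => absurd hxT hx1⟩
      filter_upwards [Filter.eventually_all.2 hT] with y hy _
      simp only [m, hy]
  obtain ⟨y, hyS, hyT⟩ := M.exists_notMem_skel_notMem_elem
  have hoff : ∀ x ∉ M.skel, x ∈ (range M.vtx)ᶜ := by
    rintro x hx ⟨ν, rfl⟩
    exact hx (M.vtx_mem_skel ν)
  funext T
  obtain ⟨x, hx⟩ := (M.elem_polygonal T).1.nonempty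
  have hxS : x ∉ M.skel := fun h => M.notMem_elem_of_mem_skel h T hx
  have key := apply_eq_of_eventually_const M.dense_compl_skel hs m hloc (hoff x hxS) hxS
    (hoff y hyS) hyS
  simp only [m, M.sum_ite_mem_elem c hx, hyT, if_false, Finset.sum_const_zero] at key
  simpa using key

end PolygonalMesh

namespace PolygonalMesh

variable {Ω : Set Plane} {ιT ιE ιV : Type*} (M : PolygonalMesh Ω ιT ιE ιV)

/-! ### Winding numbers and the discrete Poincaré lemma -/

/-- The position of a vertex in the complex plane. -/
def cvtx (ν : ιV) : ℂ := toC (M.vtx ν)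

theorem toC_mem_segment_iff {E : ιE} {x : Plane} :
    toC x ∈ segment ℝ (M.cvtx (M.src E)) (M.cvtx (M.tgt E)) ↔
      x ∈ segment ℝ (M.vtx (M.src E)) (M.vtx (M.tgt E)) := by
  have h := image_segment ℝ toC.toLinearEquiv.toLinearMap.toAffineMap
    (M.vtx (M.src E)) (M.vtx (M.tgt E))
  have h' : segment ℝ (M.cvtx (M.src E)) (M.cvtx (M.tgt E)) =
      toC '' segment ℝ (M.vtx (M.src E)) (M.vtx (M.tgt E)) := h.symm
  rw [h', toC.injective.mem_set_image]

theorem toC_normal (E : ιE) : toC (M.normal E) = Complex.I * toC (M.tangent E) := by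
  simp only [toC_apply, normal, Matrix.cons_val_zero, Matrix.cons_val_one]
  push_cast
  linear_combination -(M.tangent E 1 : ℂ) * Complex.I_mul_I

theorem toC_smul (s : ℝ) (x : Plane) : toC (s • x) = s * toC x := by
  rw [map_smul, Complex.real_smul]

theorem notMem_segment_of_mem_edge {E E' : ιE} (h : E' ≠ E) {x : Plane} (hx : x ∈ M.edge E) :
    x ∉ segment ℝ (M.vtx (M.src E')) (M.vtx (M.tgt E')) := by
  rw [M.segment_eq]
  rintro (h' | h' | h')
  · exact M.vtx_notMem_edge _ E (h' ▸ hx)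
  · exact M.vtx_notMem_edge _ E (h' ▸ hx)
  · exact disjoint_left.1 (M.edge_disjoint h) h' hx

variable [Fintype ιE]

/-- The winding function of the chain `∑_E c_E E`: up to the factor `2πi`, its value at `x` is the
winding number around `x` when the chain is a cycle. -/
def winding (c : ιE → ℝ) (x : Plane) : ℂ :=
  ∑ E, c E * viewAngle (M.cvtx (M.src E)) (M.cvtx (M.tgt E)) (toC x)

/-- The chain `∑_E c_E E` has no boundary, in the dual form that it annihilates the differences
of functions of the vertices. -/
def IsCycle (c : ιE → ℝ) : Prop := ∀ φ : ιV → ℝ, ∑ E, c E * (φ (M.tgt E) - φ (M.src E)) = 0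

theorem IsCycle.sum_eq_zero {c : ιE → ℝ} (hc : M.IsCycle c) (φ : ιV → ℂ) :
    ∑ E, (c E : ℂ) * (φ (M.tgt E) - φ (M.src E)) = 0 := by
  apply Complex.ext
  · simpa using hc fun ν => (φ ν).re
  · simpa using hc fun ν => (φ ν).im

/-- The derivative of the winding function of a cycle outside of the skeleton is the boundary of
the cycle applied to `ν ↦ 1 / (x_ν - z)`, hence zero. -/
theorem winding_eq_of_mem_elem {c : ιE → ℝ} (hc : M.IsCycle c) (T : ιT) {x y : Plane}
    (hx : x ∈ M.elem T) (hy : y ∈ M.elem T) : M.winding c x = M.winding c y := by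
  let U : Set ℂ := toC '' M.elem T
  let f : ℂ → ℂ := fun z => ∑ E, c E * viewAngle (M.cvtx (M.src E)) (M.cvtx (M.tgt E)) z
  have hU : IsOpen U := toC.toHomeomorph.isOpenMap _ (M.isOpen_elem T)
  have hUc : IsPreconnected U :=
    (M.elem_polygonal T).1.isPreconnected.image _ toC.continuous.continuousOn
  have hd : ∀ z ∈ U, HasDerivAt f 0 z := by
    rintro _ ⟨w, hw, rfl⟩
    have h1 : HasDerivAt f (∑ E, (c E : ℂ) * (1 / (M.cvtx (M.src E) - toC w) -
        1 / (M.cvtx (M.tgt E) - toC w))) (toC w) := by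
      refine HasDerivAt.fun_sum fun E _ => (hasDerivAt_viewAngle fun h => ?_).const_mul _
      exact M.notMem_elem_of_mem_skel (mem_iUnion.2 ⟨E, M.toC_mem_segment_iff.1 h⟩) T hw
    convert h1 using 1
    rw [← neg_eq_zero.2 (IsCycle.sum_eq_zero M hc fun ν => 1 / (M.cvtx ν - toC w)),
      ← Finset.sum_neg_distrib]
    exact Finset.sum_congr rfl fun E _ => by ring
  exact hU.is_const_of_deriv_eq_zero hUc
    (fun z hz => (hd z hz).differentiableAt.differentiableWithinAt)
    (fun z hz => (hd z hz).deriv) (mem_image_of_mem _ hx) (mem_image_of_mem _ hy)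

/-- A cycle does not wind around a point outside the closure of a domain with contractible
closure. -/
theorem winding_eq_zero_of_notMem_closure [ContractibleSpace (closure Ω)] {c : ιE → ℝ}
    (hc : M.IsCycle c) {x : Plane} (hx : x ∉ closure Ω) : M.winding c x = 0 := by
  classical
  obtain ⟨g, hg, hgexp⟩ := exists_continuous_log (X := closure Ω)
    (f := fun y => toC y - toC x) (by fun_prop) (fun y h => hx (by
      rw [← toC.injective (sub_eq_zero.1 h)]; exact y.2))
  let G : ℂ → ℂ := fun z => if h : toC.symm z ∈ closure Ω then g ⟨toC.symm z, h⟩ else 0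
  have hGval : ∀ y (hy : y ∈ closure Ω), G (toC y) = g ⟨y, hy⟩ := by
    intro y hy
    simp [G, hy]
  have hG : ContinuousOn G (toC.symm ⁻¹' closure Ω) := by
    have hres : (toC.symm ⁻¹' closure Ω).domRestrict G =
        fun z : ↥(toC.symm ⁻¹' closure Ω) => g ⟨toC.symm z.1, z.2⟩ := by
      funext ⟨z, hz⟩
      have hz' : toC.symm z ∈ closure Ω := hz
      simp [G, hz']
    rw [continuousOn_iff_continuous_domRestrict, hres]
    fun_prop
  have hsub : ∀ E, segment ℝ (M.cvtx (M.src E)) (M.cvtx (M.tgt E)) ⊆ toC.symm ⁻¹' closure Ω := by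
    intro E z hz
    obtain ⟨y, rfl⟩ := toC.surjective z
    rw [M.toC_mem_segment_iff] at hz
    rw [mem_preimage, toC.symm_apply_apply, M.elem_cover]
    have h1 : y ∈ M.skel := mem_iUnion.2 ⟨E, hz⟩
    unfold skel at h1
    rw [← M.skeleton] at h1
    obtain ⟨T, hT⟩ := mem_iUnion.1 h1
    exact mem_iUnion.2 ⟨T, frontier_subset_closure hT⟩
  rw [← IsCycle.sum_eq_zero M hc fun ν => G (M.cvtx ν)]
  refine Finset.sum_congr rfl fun E _ => ?_
  rw [viewAngle_eq_sub (fun h => ?_) (hG.mono (hsub E)) (fun z hz => ?_)]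
  · refine hx ?_
    have := hsub E h
    rwa [mem_preimage, toC.symm_apply_apply] at this
  · have hz' := hsub E hz
    rw [mem_preimage] at hz'
    have h1 := hgexp ⟨_, hz'⟩
    simp only [toC.apply_symm_apply] at h1
    rw [← h1, ← hGval _ hz', toC.apply_symm_apply]

/-- The winding function jumps by `2πi c_E` across `E`: only the term of `E` is discontinuous. -/
theorem tendsto_winding_sub (c : ιE → ℝ) {E : ιE} {x : Plane} (hx : x ∈ M.edge E) :
    Filter.Tendsto (fun s : ℝ => M.winding c (x + s • M.normal E) -
      M.winding c (x - s • M.normal E)) (𝓝[>] 0) (𝓝 (c E * (2 * Real.pi * Complex.I))) := by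
  classical
  have hp : ∀ s : ℝ, toC (x + s • M.normal E) =
      toC x + s * (Complex.I * toC (M.tangent E)) := fun s => by
    rw [map_add, toC_smul, toC_normal]
  have hm : ∀ s : ℝ, toC (x - s • M.normal E) =
      toC x - s * (Complex.I * toC (M.tangent E)) := fun s => by
    rw [map_sub, toC_smul, toC_normal]
  simp only [winding, ← Finset.sum_sub_distrib, ← mul_sub]
  have hsum : (c E * (2 * Real.pi * Complex.I) : ℂ) =
      ∑ E', if E' = E then (c E * (2 * Real.pi * Complex.I) : ℂ) else 0 := by simp
  rw [hsum]
  refine tendsto_finsetSum _ fun E' _ => ?_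
  by_cases hE : E' = E
  · subst hE
    rw [if_pos rfl]
    refine Filter.Tendsto.const_mul _ ?_
    obtain ⟨u, hu, rfl⟩ := M.mem_edge_iff.1 hx
    have hτ : toC (M.tangent E') ≠ 0 := by
      rw [Ne, map_eq_zero_iff _ toC.injective]
      intro h0
      have := M.normal_sq E'
      simp [normal, h0] at this
    have h1 : M.cvtx (M.src E') = toC (M.pt E' u) - u * toC (M.tangent E') := by
      rw [← toC_smul, ← map_sub]; simp [cvtx, pt]
    have h2 : M.cvtx (M.tgt E') =
        toC (M.pt E' u) + (M.len E' - u : ℝ) * toC (M.tangent E') := by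
      rw [← toC_smul, ← map_add, cvtx, ← M.pt_len]
      congr 1
      simp only [pt, sub_smul]
      abel
    simp only [hp, hm, h1, h2]
    exact tendsto_viewAngle_sub hτ hu.1 (sub_pos.2 hu.2)
  · rw [if_neg hE]
    have hns : toC x ∉ segment ℝ (M.cvtx (M.src E')) (M.cvtx (M.tgt E')) := fun h =>
      M.notMem_segment_of_mem_edge hE hx (M.toC_mem_segment_iff.1 h)
    have hc := (hasDerivAt_viewAngle hns).continuousAt
    have h1 : Filter.Tendsto (fun s : ℝ => toC (x + s • M.normal E)) (𝓝[>] 0) (𝓝 (toC x)) := by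
      have : Continuous fun s : ℝ => toC (x + s • M.normal E) := by fun_prop
      simpa using (this.tendsto 0).mono_left nhdsWithin_le_nhds
    have h2 : Filter.Tendsto (fun s : ℝ => toC (x - s • M.normal E)) (𝓝[>] 0) (𝓝 (toC x)) := by
      have : Continuous fun s : ℝ => toC (x - s • M.normal E) := by fun_prop
      simpa using (this.tendsto 0).mono_left nhdsWithin_le_nhds
    simpa using ((hc.tendsto.comp h1).sub (hc.tendsto.comp h2)).const_mul (c E' : ℂ)

/-- Every cycle is the boundary of a combination of elements, the coefficient of an element being
the winding number of the cycle around its points. -/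
theorem IsCycle.eq_boundary [Fintype ιT] [ContractibleSpace (closure Ω)] {c : ιE → ℝ}
    (hc : M.IsCycle c) (E : ιE) :
    (c E * (2 * Real.pi * Complex.I) : ℂ) =
      -∑ T, M.incidence T E • M.winding c (M.center T) := by
  classical
  obtain ⟨x, hx⟩ := M.edge_nonempty E
  obtain ⟨r, hr, hball⟩ := M.exists_ball_mem_elem_iff hx
  have hval : ∀ σ : ℝ, σ * σ = 1 → ∀ y ∈ M.halfDisc E x r σ, M.winding c y =
      ∑ T, if M.OnSide T E σ then M.winding c (M.center T) else 0 := by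
    intro σ hσ y hy
    obtain ⟨hyS, hyT⟩ := hball σ hσ y hy
    simp only [← hyT]
    by_cases h : ∃ T, y ∈ M.elem T
    · obtain ⟨T, hT⟩ := h
      rw [M.sum_ite_mem_elem _ hT]
      exact M.winding_eq_of_mem_elem hc T hT (M.center_mem T)
    · push Not at h
      simp only [h, if_false, Finset.sum_const_zero]
      refine M.winding_eq_zero_of_notMem_closure hc fun hcl => ?_
      rw [M.elem_cover] at hcl
      obtain ⟨T, hT⟩ := mem_iUnion.1 hcl
      refine hyS (M.frontier_subset_skel T ?_)
      rw [(M.isOpen_elem T).frontier_eq]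
      exact ⟨hT, h T⟩
  rw [M.sum_incidence_smul_eq, neg_sub]
  refine tendsto_nhds_unique (M.tendsto_winding_sub c hx) (tendsto_const_nhds.congr' ?_)
  filter_upwards [Ioo_mem_nhdsGT hr] with s hs
  have h1 := M.add_normal_mem_halfDisc E x (σ := 1) hs.1 hs.2 (by norm_num)
  have h2 := M.add_normal_mem_halfDisc E x (σ := -1) hs.1 hs.2 (by norm_num)
  rw [one_mul] at h1
  rw [neg_one_mul, neg_smul, ← sub_eq_add_neg] at h2
  rw [hval 1 (by norm_num) _ h1, hval (-1) (by norm_num) _ h2]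

/-- Discrete Poincaré lemma: a function of the edges with vanishing circulation around every
element is the difference of a function of the vertices. By duality, this is the fact that every
cycle is a boundary. -/
theorem exists_potential [Fintype ιT] [ContractibleSpace (closure Ω)] (a : ιE → ℝ)
    (ha : ∀ T, ∑ E, M.incidence T E * a E = 0) :
    ∃ φ : ιV → ℝ, ∀ E, φ (M.tgt E) - φ (M.src E) = a E := by
  classical
  let d : (ιV → ℝ) →ₗ[ℝ] (ιE → ℝ) :=
    { toFun := fun φ E => φ (M.tgt E) - φ (M.src E)
      map_add' := fun φ ψ => by funext E; simp only [Pi.add_apply]; ring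
      map_smul' := fun r φ => by
        funext E; simp only [Pi.smul_apply, smul_eq_mul, RingHom.id_apply]; ring }
  suffices h : a ∈ LinearMap.range d by
    obtain ⟨φ, hφ⟩ := h
    exact ⟨φ, fun E => congrFun hφ E⟩
  by_contra hcon
  obtain ⟨F, hFa, hF⟩ := Submodule.exists_le_ker_of_notMem hcon
  let c : ιE → ℝ := fun E => F (Pi.single E 1)
  have hFc : ∀ b, F b = ∑ E, c E * b E := by
    intro b
    rw [LinearMap.pi_apply_eq_sum_univ F b]
    refine Finset.sum_congr rfl fun E _ => ?_
    rw [smul_eq_mul, mul_comm]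
    congr 2
    funext E'
    simp [Pi.single_apply, eq_comm]
  have hc : M.IsCycle c := by
    intro φ
    have := hF ⟨φ, rfl⟩
    rw [LinearMap.mem_ker, hFc] at this
    exact this
  refine hFa ?_
  have h1 : ((∑ E, c E * a E : ℝ) : ℂ) * (2 * Real.pi * Complex.I) = 0 := by
    have h2 : ((∑ E, c E * a E : ℝ) : ℂ) * (2 * Real.pi * Complex.I) =
        -∑ T, ((∑ E, M.incidence T E * a E : ℝ) : ℂ) * M.winding c (M.center T) := by
      push_cast
      simp only [Finset.sum_mul]
      rw [Finset.sum_comm, ← Finset.sum_neg_distrib]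
      refine Finset.sum_congr rfl fun E _ => ?_
      have h3 := hc.eq_boundary M E
      simp only [Complex.real_smul] at h3
      rw [mul_right_comm, h3, neg_mul, Finset.sum_mul]
      congr 1
      exact Finset.sum_congr rfl fun T _ => by ring
    rw [h2]
    simp [ha]
  rw [hFc]
  exact_mod_cast (mul_eq_zero.1 h1).resolve_right Complex.two_pi_I_ne_zero

end PolygonalMesh

/-! ### Green's formula -/

/-- The fundamental theorem of calculus on an open bounded subset `U` of the line whose
boundary is contained in the finite set of points `p i`: the indicator function of `U` jumps by
`σ i` there, from right to left. -/
theorem setIntegral_deriv_eq_sum {ι : Type*} (I : Finset ι) {p σ : ι → ℝ} (hp : InjOn p I)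
    {U : Set ℝ} (hU : IsOpen U) (hUb : Bornology.IsBounded U)
    (hfr : ∀ x ∈ frontier U, ∃ i ∈ I, p i = x)
    (hjump : ∀ i ∈ I, ∃ κ : ℝ, (∀ᶠ s in 𝓝[<] p i, U.indicator (fun _ => (1 : ℝ)) s = κ + σ i) ∧
      ∀ᶠ s in 𝓝[>] p i, U.indicator (fun _ => (1 : ℝ)) s = κ)
    {f f' : ℝ → ℝ} (hf : ∀ s, HasDerivAt f (f' s) s) (hf' : Continuous f') :
    ∫ s in U, f' s = ∑ i ∈ I, σ i * f (p i) := by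
  classical
  let χ : ℝ → ℝ := U.indicator fun _ => (1 : ℝ)
  let S : ℝ → ℝ := fun s => ∑ i ∈ I, if s < p i then σ i else 0
  let D : Set ℝ := (p '' I)ᶜ
  have hfin : (p '' I).Finite := I.finite_toSet.image p
  have hD : Dense D := by
    have := (dense_univ (X := ℝ)).sdiff_finite hfin
    rwa [← compl_eq_univ_sdiff] at this
  -- the step function with the prescribed jumps differs from the indicator by a constant
  have hstep : ∀ (x : ℝ) (i : ι), p i ≠ x →
      ∀ᶠ y in 𝓝 x, (if y < p i then σ i else 0) = if x < p i then σ i else 0 := by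
    intro x i hne
    rcases lt_or_gt_of_ne hne with h | h
    · filter_upwards [lt_mem_nhds h] with y hy
      rw [if_neg (not_lt.2 hy.le), if_neg (not_lt.2 h.le)]
    · filter_upwards [gt_mem_nhds h] with y hy
      rw [if_pos hy, if_pos h]
  have hloc : ∀ x ∈ (univ : Set ℝ), ∃ κ, ∀ᶠ y in 𝓝 x, y ∈ D → χ y - S y = κ := by
    intro x _
    by_cases hx : ∃ i ∈ I, p i = x
    · obtain ⟨i, hi, rfl⟩ := hx
      obtain ⟨κ, hl, hr⟩ := hjump i hi
      rw [eventually_nhdsWithin_iff] at hl hr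
      have hoth : ∀ᶠ y in 𝓝 (p i), ∀ j ∈ I.erase i,
          (if y < p j then σ j else 0) = if p i < p j then σ j else 0 := by
        rw [Filter.eventually_all_finset]
        intro j hj
        refine hstep _ j fun h => ?_
        exact (Finset.mem_erase.1 hj).1 (hp (Finset.mem_erase.1 hj).2 hi h)
      refine ⟨κ - ∑ j ∈ I.erase i, if p i < p j then σ j else 0, ?_⟩
      filter_upwards [hl, hr, hoth] with y hyl hyr hyo hyD
      have hne : y ≠ p i := fun h => hyD ⟨i, hi, h.symm⟩
      simp only [χ, S]
      rw [← Finset.add_sum_erase I _ hi, Finset.sum_congr rfl hyo]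
      rcases lt_or_gt_of_ne hne with h | h
      · rw [hyl h, if_pos h]; ring
      · rw [hyr h, if_neg (not_lt.2 h.le)]; ring
    · refine ⟨χ x - S x, ?_⟩
      have hxf : x ∉ frontier U := fun h => hx (hfr x h)
      have hχ : ∀ᶠ y in 𝓝 x, χ y = χ x := by
        by_cases hxU : x ∈ U
        · filter_upwards [hU.mem_nhds hxU] with y hy
          simp [χ, hy, hxU]
        · have hxc : x ∉ closure U := fun hc => hxf (by
            rw [hU.frontier_eq]; exact ⟨hc, hxU⟩)
          filter_upwards [isClosed_closure.isOpen_compl.mem_nhds hxc] with y hy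
          have hyU : y ∉ U := fun h => hy (subset_closure h)
          simp [χ, hyU, hxU]
      have hoth : ∀ᶠ y in 𝓝 x, ∀ j ∈ I,
          (if y < p j then σ j else 0) = if x < p j then σ j else 0 := by
        rw [Filter.eventually_all_finset]
        exact fun j hj => hstep _ j fun h => hx ⟨j, hj, h⟩
      filter_upwards [hχ, hoth] with y hy1 hy2 _
      simp only [S]
      rw [hy1, Finset.sum_congr rfl hy2]
  obtain ⟨R, hR⟩ := (hUb.union hfin.isBounded).subset_ball 0
  have hR' : ∀ x ∈ U ∪ p '' I, -R < x ∧ x < R := by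
    intro x hx
    have := hR hx
    rw [mem_ball_zero_iff, Real.norm_eq_abs, abs_lt] at this
    exact this
  have hpR : ∀ i ∈ I, -R < p i ∧ p i < R := fun i hi => hR' _ (Or.inr ⟨i, hi, rfl⟩)
  have hRD : ∀ x, x ≤ -R ∨ R ≤ x → x ∈ D ∧ χ x = 0 := by
    intro x hx
    have : x ∉ U ∪ p '' I := fun h => by
      have := hR' x h
      rcases hx with hx | hx <;> linarith
    rw [mem_union, not_or] at this
    exact ⟨this.2, indicator_of_notMem this.1 _⟩
  have hRmem := hRD R (Or.inr le_rfl)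
  have hSR : S R = 0 :=
    Finset.sum_eq_zero fun i hi => if_neg (not_lt.2 (hpR i hi).2.le)
  have heq : ∀ x ∈ D, χ x = S x := by
    intro x hx
    have := apply_eq_of_eventually_const hD isPreconnected_univ (fun y => χ y - S y) hloc
      (mem_univ x) hx (mem_univ R) hRmem.1
    simp only [hRmem.2, hSR] at this
    linarith
  have hSsum : ∑ i ∈ I, σ i = 0 := by
    by_cases hI : I.Nonempty
    · obtain ⟨i₀, hi₀⟩ := hI
      have h1 := hRD (-R) (Or.inl le_rfl)
      have h2 := heq _ h1.1
      rw [h1.2] at h2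
      rw [h2]
      exact Finset.sum_congr rfl fun i hi => (if_pos (hpR i hi).1).symm
    · rw [Finset.not_nonempty_iff_eq_empty.1 hI, Finset.sum_empty]
  have hUR : U ⊆ Ioo (-R) R := fun x hx => hR' x (Or.inl hx)
  have hint : ∀ a b : ℝ, IntegrableOn f' (Ioo a b) := fun a b =>
    (hf'.continuousOn.integrableOn_compact (isCompact_Icc (a := a) (b := b))).mono_set
      Ioo_subset_Icc_self
  have hae : ∀ᵐ x ∂(volume : Measure ℝ), x ∈ D := by
    rw [ae_iff]
    have : {a | a ∉ D} = p '' I := by ext; simp [D]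
    rw [this]
    exact hfin.measure_zero _
  have hpart : ∀ i ∈ I, ∫ x in Ioo (-R) R, (Iio (p i)).indicator f' x = f (p i) - f (-R) := by
    intro i hi
    rw [setIntegral_indicator measurableSet_Iio, Ioo_inter_Iio, min_eq_right (hpR i hi).2.le,
      ← integral_Ioc_eq_integral_Ioo, ← intervalIntegral.integral_of_le (hpR i hi).1.le]
    exact intervalIntegral.integral_eq_sub_of_hasDerivAt (fun x _ => hf x)
      (hf'.intervalIntegrable _ _)
  calc ∫ s in U, f' s = ∫ s in Ioo (-R) R, U.indicator f' s := by
        rw [setIntegral_indicator hU.measurableSet, inter_eq_self_of_subset_right hUR]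
    _ = ∫ s in Ioo (-R) R, ∑ i ∈ I, σ i * (Iio (p i)).indicator f' s := by
        refine integral_congr_ae (ae_restrict_of_ae ?_)
        filter_upwards [hae] with x hx
        have h1 : U.indicator f' x = χ x * f' x := by
          by_cases hxU : x ∈ U <;> simp [χ, hxU]
        rw [h1, heq x hx, Finset.sum_mul]
        refine Finset.sum_congr rfl fun i _ => ?_
        by_cases h : x < p i <;> simp [h]
    _ = ∑ i ∈ I, σ i * (f (p i) - f (-R)) := by
        rw [integral_finsetSum _ fun i _ => ((hint _ _).indicator measurableSet_Iio).const_mul _]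
        refine Finset.sum_congr rfl fun i hi => ?_
        rw [integral_const_mul, hpart i hi]
    _ = ∑ i ∈ I, σ i * f (p i) := by
        simp only [mul_sub, Finset.sum_sub_distrib, ← Finset.sum_mul, hSsum]
        ring

theorem hasDerivAt_eval {x : ℝ → Fin 2 → ℝ} {x' : Fin 2 → ℝ} {s : ℝ}
    (hx : ∀ k, HasDerivAt (fun s => x s k) (x' k) s) (p : Poly2) :
    HasDerivAt (fun s => MvPolynomial.eval (x s) p)
      (∑ k, x' k * MvPolynomial.eval (x s) (MvPolynomial.pderiv k p)) s := by
  induction p using MvPolynomial.induction_on with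
  | C a => simpa using hasDerivAt_const s a
  | add p q hp hq =>
    simp only [map_add, mul_add, Finset.sum_add_distrib]
    exact hp.add hq
  | mul_X p n hp =>
    simp only [map_mul, MvPolynomial.eval_X]
    refine (hp.mul (hx n)).congr_deriv ?_
    simp only [Derivation.leibniz, smul_eq_mul, map_add, map_mul, MvPolynomial.eval_X, mul_add,
      Finset.sum_add_distrib, Finset.sum_mul, MvPolynomial.pderiv_X]
    rw [add_comm]
    congr 1
    · rw [Finset.sum_eq_single n]
      · simp [mul_comm]
      · intro k _ hk
        rw [Pi.single_eq_of_ne hk.symm]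
        simp
      · simp
    · exact Finset.sum_congr rfl fun k _ => by ring

/-- The point of the plane with coordinate `s` in the direction `i` and `t` in the other
direction. -/
def slice (i : Fin 2) (s t : ℝ) : Plane := WithLp.toLp 2 fun k => if k = i then s else t

theorem slice_apply (i k : Fin 2) (s t : ℝ) : slice i s t k = if k = i then s else t := rfl

@[fun_prop]
theorem continuous_slice (i : Fin 2) {X : Type*} [TopologicalSpace X] {f g : X → ℝ}
    (hf : Continuous f) (hg : Continuous g) : Continuous fun x => slice i (f x) (g x) := by
  refine (PiLp.continuous_toLp 2 _).comp (continuous_pi fun k => ?_)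
  by_cases h : k = i <;> simp [h, hf, hg]

theorem slice_surjective (i : Fin 2) (x : Plane) : slice i (x i) (x (1 - i)) = x := by
  ext k
  rw [slice_apply]
  fin_cases i <;> fin_cases k <;> simp

theorem measurePreserving_slice (i : Fin 2) :
    MeasurePreserving (fun z : ℝ × ℝ => slice i z.1 z.2) volume volume := by
  have h0 : MeasurePreserving (fun z : ℝ × ℝ => slice 0 z.1 z.2) volume volume := by
    have h : (fun z : ℝ × ℝ => slice 0 z.1 z.2) =
        WithLp.toLp 2 ∘ MeasurableEquiv.finTwoArrow.symm := by
      funext z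
      ext k
      fin_cases k <;> simp [slice_apply, MeasurableEquiv.finTwoArrow]
    rw [h]
    exact (PiLp.volume_preserving_toLp (Fin 2)).comp (volume_preserving_finTwoArrow ℝ).symm
  fin_cases i
  · exact h0
  · have h : (fun z : ℝ × ℝ => slice 1 z.1 z.2) =
        (fun z : ℝ × ℝ => slice 0 z.1 z.2) ∘ Prod.swap := by
      funext z
      ext k
      fin_cases k <;> simp [slice_apply]
    exact h ▸ h0.comp Measure.measurePreserving_swap

theorem measurableEmbedding_slice (i : Fin 2) :
    MeasurableEmbedding (fun z : ℝ × ℝ => slice i z.1 z.2) := by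
  refine (Continuous.measurableEmbedding (by fun_prop) fun z w h => ?_)
  have h1 := congrArg (fun x : Plane => x i) h
  have h2 := congrArg (fun x : Plane => x (1 - i)) h
  have hne : 1 - i ≠ i := by fin_cases i <;> simp
  simp only [slice_apply, if_true, hne, if_false] at h1 h2
  exact Prod.ext h1 h2

namespace PolygonalMesh

variable {Ω : Set Plane} {ιT ιE ιV : Type*} (M : PolygonalMesh Ω ιT ιE ιV)

theorem eval_restrE (E : ιE) (p : Poly2) (s : ℝ) :
    (M.restrE E p).eval s = MvPolynomial.eval (fun k => M.pt E s k) p := by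
  induction p using MvPolynomial.induction_on with
  | C a => simp [restrE]
  | add p q hp hq => simp only [map_add, Polynomial.eval_add, hp, hq]
  | mul_X p n hp =>
    simp only [map_mul, Polynomial.eval_mul, hp, MvPolynomial.eval_X]
    congr 1
    simp [restrE, pt]
    ring

theorem abs_normal (E : ιE) (i : Fin 2) : |M.normal E i| = |M.tangent E (1 - i)| := by
  fin_cases i <;> simp [normal]

/-- The arc length at which the line carrying the edge `E` takes the value `t` for the coordinate
other than `i`. -/
def crossing (E : ιE) (i : Fin 2) (t : ℝ) : ℝ :=
  (t - M.vtx (M.src E) (1 - i)) / M.tangent E (1 - i)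

theorem tangent_ne_zero {E : ιE} {i : Fin 2} (h : M.normal E i ≠ 0) :
    M.tangent E (1 - i) ≠ 0 := by
  rwa [← abs_ne_zero, ← abs_normal, abs_ne_zero]

theorem pt_crossing_apply {E : ιE} {i : Fin 2} (h : M.normal E i ≠ 0) (t : ℝ) :
    M.pt E (M.crossing E i t) (1 - i) = t := by
  have := M.tangent_ne_zero h
  simp only [pt, crossing, PiLp.add_apply, PiLp.smul_apply, smul_eq_mul]
  field_simp
  ring

theorem slice_crossing {E : ιE} {i : Fin 2} (h : M.normal E i ≠ 0) (t : ℝ) :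
    slice i (M.pt E (M.crossing E i t) i) t = M.pt E (M.crossing E i t) := by
  conv_rhs => rw [← slice_surjective i (M.pt E (M.crossing E i t)), M.pt_crossing_apply h]

/-- The part of Green's formula contributed by one edge. -/
theorem integral_crossing (E : ιE) (i : Fin 2) (P : Polynomial ℝ) (hn : M.normal E i ≠ 0) :
    Integrable (fun t => (Ioo 0 (M.len E)).indicator (fun u => P.eval u) (M.crossing E i t)) ∧
    ∫ t, (Ioo 0 (M.len E)).indicator (fun u => P.eval u) (M.crossing E i t) =
      |M.normal E i| * M.intE E P := by
  have hint : Integrable ((Ioo 0 (M.len E)).indicator fun u => P.eval u) :=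
    ((P.continuous.continuousOn.integrableOn_compact
      (isCompact_Icc (a := 0) (b := M.len E))).mono_set
        Ioo_subset_Icc_self).integrable_indicator measurableSet_Ioo
  refine ⟨(hint.comp_div (M.tangent_ne_zero hn)).comp_sub_right
    (M.vtx (M.src E) (1 - i)), ?_⟩
  unfold crossing
  rw [integral_sub_right_eq_self (fun t => (Ioo 0 (M.len E)).indicator (fun u => P.eval u)
    (t / M.tangent E (1 - i))), Measure.integral_comp_div, smul_eq_mul, ← abs_normal,
    integral_indicator measurableSet_Ioo, ← integral_Ioc_eq_integral_Ioo,
    ← intervalIntegral.integral_of_le (M.len_pos E).le]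
  rfl

variable [Fintype ιE]

open Classical in
/-- Green's formula on a line parallel to the `i`-th axis that contains no vertex. -/
theorem integral_slice_pderiv (T : ιT) (i : Fin 2) (p : Poly2) {t : ℝ}
    (ht : ∀ ν, M.vtx ν (1 - i) ≠ t) :
    ∫ s in {s | slice i s t ∈ M.elem T},
        MvPolynomial.eval (fun k => slice i s t k) (MvPolynomial.pderiv i p) =
      ∑ E, if M.normal E i ≠ 0 ∧ M.crossing E i t ∈ Ioo 0 (M.len E) then
        M.incidence T E * (SignType.sign (M.normal E i) : ℝ) *
          (M.restrE E p).eval (M.crossing E i t) else 0 := by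
  let I : Finset ιE := Finset.univ.filter fun E =>
    M.normal E i ≠ 0 ∧ M.crossing E i t ∈ Ioo 0 (M.len E)
  let pp : ιE → ℝ := fun E => M.pt E (M.crossing E i t) i
  have hI : ∀ E ∈ I, M.normal E i ≠ 0 ∧ M.pt E (M.crossing E i t) ∈ M.edge E := by
    intro E hE
    have := (Finset.mem_filter.1 hE).2
    exact ⟨this.1, M.mem_edge_iff.2 ⟨_, this.2, rfl⟩⟩
  have hcont : Continuous fun s => slice i s t := by fun_prop
  have hne : 1 - i ≠ i := by fin_cases i <;> simp
  refine (setIntegral_deriv_eq_sum I (p := pp)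
    (σ := fun E => M.incidence T E * (SignType.sign (M.normal E i) : ℝ))
    (f := fun s => MvPolynomial.eval (fun k => slice i s t k) p)
    ?_ ?_ ?_ ?_ ?_ ?_ ?_).trans ?_
  · intro E hE E' hE' h
    by_contra hEE
    have h1 := (hI E hE).2
    have h2 := (hI E' hE').2
    have h3 : M.pt E (M.crossing E i t) = M.pt E' (M.crossing E' i t) := by
      rw [← M.slice_crossing (hI E hE).1, ← M.slice_crossing (hI E' hE').1]
      exact congrArg (fun s => slice i s t) h
    exact disjoint_left.1 (M.edge_disjoint hEE) h1 (h3 ▸ h2)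
  · exact (M.isOpen_elem T).preimage hcont
  · have hb := (M.isBounded_elem T)
    obtain ⟨R, hR⟩ := hb.subset_closedBall 0
    refine (Metric.isBounded_closedBall (x := (0 : ℝ)) (r := R)).subset fun s hs => ?_
    have h1 := hR hs
    rw [mem_closedBall_zero_iff] at h1 ⊢
    refine le_trans ?_ h1
    have h2 := PiLp.norm_apply_le (p := 2) (slice i s t) i
    simpa only [slice_apply, if_true] using h2
  · intro s hs
    have hsf : slice i s t ∈ frontier (M.elem T) :=
      hcont.frontier_preimage_subset (M.elem T) hs
    have hcoord : slice i s t (1 - i) = t := by simp only [slice_apply, if_neg hne]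
    rcases M.exists_mem_edge_or_vtx (M.frontier_subset_skel T hsf) with ⟨E, hE⟩ | ⟨ν, hν⟩
    · obtain ⟨u, hu, hpt⟩ := M.mem_edge_iff.1 hE
      have h1 : M.vtx (M.src E) (1 - i) + u * M.tangent E (1 - i) = t := by
        rw [← hpt] at hcoord
        simpa [pt] using hcoord
      have h2 : M.tangent E (1 - i) ≠ 0 := by
        intro h0
        rw [h0, mul_zero, add_zero] at h1
        exact ht _ h1
      have h3 : M.normal E i ≠ 0 := by
        rwa [← abs_ne_zero, M.abs_normal, abs_ne_zero]
      have h4 : M.crossing E i t = u := by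
        rw [crossing, ← h1]
        field_simp
        ring
      refine ⟨E, Finset.mem_filter.2 ⟨Finset.mem_univ _, h3, h4.symm ▸ hu⟩, ?_⟩
      simp only [pp]
      rw [h4, hpt, slice_apply, if_pos rfl]
    · exact absurd (hν ▸ hcoord) (ht ν)
  · intro E hE
    obtain ⟨hn, hx⟩ := hI E hE
    obtain ⟨r, hr, hball⟩ := M.exists_ball_mem_elem_iff hx
    have hsl := M.slice_crossing hn t
    have hev : ∀ᶠ s in 𝓝 (pp E), slice i s t ∈ Metric.ball (M.pt E (M.crossing E i t)) r := by
      refine hcont.continuousAt.preimage_mem_nhds (Metric.isOpen_ball.mem_nhds ?_)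
      simp only [pp]
      rw [hsl]
      exact Metric.mem_ball_self hr
    have hside : ∀ s, M.side E (M.pt E (M.crossing E i t)) (slice i s t) =
        M.normal E i * (s - pp E) := by
      intro s
      have h1 := M.pt_crossing_apply hn t
      simp only [side, pp, slice_apply]
      fin_cases i
      · simp at h1 ⊢
        simp [h1]
      · simp at h1 ⊢
        simp [h1]
    have hside' : ∀ σ : ℝ, σ * σ = 1 → ∀ᶠ s in 𝓝 (pp E), 0 < σ * (M.normal E i * (s - pp E)) →
        {s | slice i s t ∈ M.elem T}.indicator (fun _ => (1 : ℝ)) s =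
          if M.OnSide T E σ then 1 else 0 := by
      intro σ hσ
      filter_upwards [hev] with s hs hpos
      have h1 := (hball σ hσ _ ⟨hs, by simpa only [mem_ofPred_eq, hside] using hpos⟩).2 T
      simp only [indicator, mem_ofPred_eq, h1]
    have h1 := hside' 1 (by norm_num)
    have h2 := hside' (-1) (by norm_num)
    rw [M.incidence_eq]
    rcases lt_or_gt_of_ne hn with h | h
    · refine ⟨if M.OnSide T E (-1) then 1 else 0, ?_, ?_⟩
      · rw [eventually_nhdsWithin_iff]
        filter_upwards [h1] with s hs hlt
        have hlt : s < pp E := hlt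
        rw [hs (by nlinarith), sign_neg h, SignType.coe_neg_one]
        ring
      · rw [eventually_nhdsWithin_iff]
        filter_upwards [h2] with s hs hlt
        have hlt : pp E < s := hlt
        exact hs (by nlinarith)
    · refine ⟨if M.OnSide T E 1 then 1 else 0, ?_, ?_⟩
      · rw [eventually_nhdsWithin_iff]
        filter_upwards [h2] with s hs hlt
        have hlt : s < pp E := hlt
        rw [hs (by nlinarith), sign_pos h, SignType.coe_one]
        ring
      · rw [eventually_nhdsWithin_iff]
        filter_upwards [h1] with s hs hlt
        have hlt : pp E < s := hlt
        exact hs (by nlinarith)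
  · intro s
    have h1 := hasDerivAt_eval (x := fun s k => slice i s t k)
      (x' := fun k => if k = i then 1 else 0) (s := s) (fun k => ?_) p
    · simpa using h1
    · simp only [slice_apply]
      by_cases hk : k = i
      · simpa [hk] using hasDerivAt_id' s
      · simpa [hk] using hasDerivAt_const s t
  · exact (continuous_eval _).comp hcont
  · rw [← Finset.sum_filter]
    refine Finset.sum_congr rfl fun E hE => ?_
    simp only [pp]
    rw [M.slice_crossing (hI E hE).1, eval_restrE]

/-- Green's formula for polynomials on an element, by integration along the lines parallel to the
`i`-th axis: almost all of them avoid the vertices. -/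
theorem intT_pderiv [Finite ιV] (T : ιT) (i : Fin 2) (p : Poly2) :
    M.intT T (MvPolynomial.pderiv i p) =
      ∑ E, M.incidence T E * (M.normal E i * M.intE E (M.restrE E p)) := by
  classical
  let F : Plane → ℝ := fun x => MvPolynomial.eval (fun k => x k) (MvPolynomial.pderiv i p)
  let Q : Set (ℝ × ℝ) := (fun z : ℝ × ℝ => slice i z.1 z.2) ⁻¹' M.elem T
  have hcont : Continuous fun z : ℝ × ℝ => slice i z.1 z.2 := by fun_prop
  have hQ : MeasurableSet Q := ((M.isOpen_elem T).preimage hcont).measurableSet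
  have hFint : IntegrableOn F (M.elem T) := M.integrableOn_elem T (continuous_eval _)
  have hint : IntegrableOn (F ∘ fun z : ℝ × ℝ => slice i z.1 z.2) Q :=
    ((measurePreserving_slice i).integrableOn_comp_preimage (measurableEmbedding_slice i)).2 hFint
  have h1 : M.intT T (MvPolynomial.pderiv i p) =
      ∫ z in Q, F (slice i z.1 z.2) := by
    rw [intT_apply]
    exact ((measurePreserving_slice i).setIntegral_preimage_emb (measurableEmbedding_slice i)
      F (M.elem T)).symm
  have h2 : ∫ z in Q, F (slice i z.1 z.2) =
      ∫ t, ∫ s in {s | slice i s t ∈ M.elem T}, F (slice i s t) := by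
    rw [← integral_indicator hQ]
    have h3 := integral_prod_symm (μ := (volume : Measure ℝ)) (ν := (volume : Measure ℝ))
      (Q.indicator fun z : ℝ × ℝ => F (slice i z.1 z.2)) (hint.integrable_indicator hQ)
    refine Eq.trans h3 (integral_congr_ae (Filter.Eventually.of_forall fun t => ?_))
    have hm : MeasurableSet {s | slice i s t ∈ M.elem T} :=
      ((M.isOpen_elem T).preimage (by fun_prop : Continuous fun s => slice i s t)).measurableSet
    simp only
    rw [← integral_indicator hm]
    rfl
  have hae : ∀ᵐ t ∂(volume : Measure ℝ), ∀ ν, M.vtx ν (1 - i) ≠ t := by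
    rw [ae_iff]
    have hset : {t | ¬ ∀ ν, M.vtx ν (1 - i) ≠ t} = range fun ν => M.vtx ν (1 - i) := by
      ext t; simp
    rw [hset]
    exact (finite_range _).measure_zero _
  rw [h1, h2]
  have h3 : ∫ t, ∫ s in {s | slice i s t ∈ M.elem T}, F (slice i s t) =
      ∫ t, ∑ E, if M.normal E i ≠ 0 then
        M.incidence T E * (SignType.sign (M.normal E i) : ℝ) *
          (Ioo 0 (M.len E)).indicator (fun u => (M.restrE E p).eval u) (M.crossing E i t)
        else 0 := by
    refine integral_congr_ae ?_
    filter_upwards [hae] with t ht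
    rw [M.integral_slice_pderiv T i p ht]
    refine Finset.sum_congr rfl fun E _ => ?_
    by_cases hn : M.normal E i ≠ 0 <;>
      by_cases hc : M.crossing E i t ∈ Ioo 0 (M.len E) <;> simp [hn, hc]
  rw [h3, integral_finsetSum]
  · refine Finset.sum_congr rfl fun E _ => ?_
    by_cases hn : M.normal E i ≠ 0
    · simp only [if_pos hn]
      rw [integral_const_mul, (M.integral_crossing E i (M.restrE E p) hn).2, mul_assoc,
        ← mul_assoc (SignType.sign (M.normal E i) : ℝ), sign_mul_abs]
    · rw [not_not] at hn
      simp [hn]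
  · intro E _
    by_cases hn : M.normal E i ≠ 0
    · simp only [if_pos hn]
      exact (M.integral_crossing E i (M.restrE E p) hn).1.const_mul _
    · simp only [if_neg hn]
      exact integrable_zero _ _ _

end PolygonalMesh

/-! ### Polynomial spaces -/

theorem mem_polyT_iff {m : ℤ} {p : Poly2} :
    p ∈ polyT m ↔ ∀ d, p.coeff d ≠ 0 → (d.degree : ℤ) ≤ m := by
  unfold polyT
  rw [MvPolynomial.mem_restrictSupport_iff]
  constructor
  · intro h d hd
    exact h (MvPolynomial.mem_support_iff.2 hd)
  · intro h d hd
    exact h d (MvPolynomial.mem_support_iff.1 hd)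

theorem polyT_mono {m n : ℤ} (h : m ≤ n) : polyT m ≤ polyT n := fun _ hp =>
  mem_polyT_iff.2 fun d hd => (mem_polyT_iff.1 hp d hd).trans h

theorem pderiv_mem_polyT {m : ℤ} {p : Poly2} (hp : p ∈ polyT m) (i : Fin 2) :
    MvPolynomial.pderiv i p ∈ polyT (m - 1) := by
  rw [mem_polyT_iff] at hp ⊢
  intro d hd
  rw [MvPolynomial.coeff_pderiv] at hd
  have h := hp _ (left_ne_zero_of_mul hd)
  rw [map_add, Finsupp.degree_single] at h
  push_cast at h
  linarith

theorem C_mem_polyT {m : ℤ} (hm : 0 ≤ m) (a : ℝ) : (MvPolynomial.C a : Poly2) ∈ polyT m := by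
  rw [mem_polyT_iff]
  intro d hd
  rw [MvPolynomial.coeff_C] at hd
  have h0 : 0 = d := by
    by_contra h
    rw [if_neg h] at hd
    exact hd rfl
  rw [← h0]
  simpa using hm

theorem X_sub_C_mul_mem_polyT {m : ℤ} {p : Poly2} (hp : p ∈ polyT m) (i : Fin 2) (a : ℝ) :
    (MvPolynomial.X i - MvPolynomial.C a) * p ∈ polyT (m + 1) := by
  rw [sub_mul]
  refine Submodule.sub_mem _ ?_ ?_
  · rw [mem_polyT_iff] at hp ⊢
    intro d hd
    rw [mul_comm, MvPolynomial.coeff_mul_X'] at hd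
    by_cases hi : i ∈ d.support
    · rw [if_pos hi] at hd
      have h := hp _ hd
      have hle : Finsupp.single i 1 ≤ d := by
        rw [Finsupp.single_le_iff]
        exact Nat.one_le_iff_ne_zero.2 (Finsupp.mem_support_iff.1 hi)
      have h2 : d.degree = (d - Finsupp.single i 1).degree + 1 := by
        conv_lhs => rw [← tsub_add_cancel_of_le hle]
        rw [map_add, Finsupp.degree_single]
      rw [h2]
      push_cast
      linarith
    · rw [if_neg hi] at hd
      exact absurd rfl hd
  · rw [← MvPolynomial.smul_eq_C_mul]
    exact Submodule.smul_mem _ _ (polyT_mono (by linarith) hp)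

theorem mem_vPolyT_iff {m : ℤ} {v : VPoly2} : v ∈ vPolyT m ↔ ∀ i, v i ∈ polyT m := by
  simp [vPolyT, Submodule.mem_pi]

theorem pdiv_mem_polyT {m : ℤ} {v : VPoly2} (hv : v ∈ vPolyT m) : pdiv v ∈ polyT (m - 1) :=
  Submodule.add_mem _ (pderiv_mem_polyT (mem_vPolyT_iff.1 hv 0) 0)
    (pderiv_mem_polyT (mem_vPolyT_iff.1 hv 1) 1)

theorem roly_le_vPolyT (m : ℤ) : roly m ≤ vPolyT m := by
  rintro _ ⟨p, hp, rfl⟩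
  rw [mem_vPolyT_iff]
  have h : ∀ i, MvPolynomial.pderiv i p ∈ polyT m := fun i => by
    simpa using pderiv_mem_polyT hp i
  intro i
  fin_cases i
  · exact h 1
  · exact Submodule.neg_mem _ (h 0)

theorem croly_le_vPolyT (c : Plane) (m : ℤ) : croly c m ≤ vPolyT m := by
  rintro _ ⟨p, hp, rfl⟩
  rw [mem_vPolyT_iff]
  intro i
  have := X_sub_C_mul_mem_polyT hp i (c i)
  rwa [sub_add_cancel] at this

theorem pdiv_vrot (p : Poly2) : pdiv (vrot p) = 0 := by
  simp only [pdiv, vrot, LinearMap.coe_mk, AddHom.coe_mk, Matrix.cons_val_zero,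
    Matrix.cons_val_one, map_neg]
  have h : MvPolynomial.pderiv 0 (MvPolynomial.pderiv 1 p) =
      MvPolynomial.pderiv 1 (MvPolynomial.pderiv 0 p) := by
    ext d
    simp only [MvPolynomial.coeff_pderiv]
    rw [add_right_comm]
    simp
    ring
  rw [h, add_neg_cancel]

theorem pdiv_koszul (c : Plane) (p : Poly2) : pdiv (koszul c p) =
    2 * p + ∑ i, (MvPolynomial.X i - MvPolynomial.C (c i)) * MvPolynomial.pderiv i p := by
  simp only [pdiv, koszul, LinearMap.coe_mk, AddHom.coe_mk, MvPolynomial.pderiv_mul, map_sub,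
    MvPolynomial.pderiv_X_self, MvPolynomial.pderiv_C, Fin.sum_univ_two]
  ring

/-- Euler's relation: `d/ds (s² p(c + s (x - c))) = s (div ((x - c) p))(c + s (x - c))`. -/
theorem eq_zero_of_pdiv_koszul_eq_zero (c : Plane) {p : Poly2} (h : pdiv (koszul c p) = 0) :
    p = 0 := by
  refine MvPolynomial.funext fun x => ?_
  let y : ℝ → Fin 2 → ℝ := fun s k => c k + s * (x k - c k)
  have hd : ∀ s, HasDerivAt (fun s => s ^ 2 * MvPolynomial.eval (y s) p) 0 s := by
    intro s
    have h1 := (hasDerivAt_pow 2 s).mul (hasDerivAt_eval (x := y) (x' := fun k => x k - c k)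
      (fun k => (((hasDerivAt_id' s).mul_const (x k - c k)).const_add (c k)).congr_deriv
        (one_mul _)) p)
    refine h1.congr_deriv ?_
    have h2 := congrArg (MvPolynomial.eval (y s)) h
    rw [pdiv_koszul] at h2
    simp only [map_add, map_mul, map_sub, MvPolynomial.eval_X, MvPolynomial.eval_C,
      map_zero, y, add_sub_cancel_left, Fin.sum_univ_two, map_ofNat] at h2 ⊢
    push_cast
    linear_combination s * h2
  have h3 := is_const_of_deriv_eq_zero (fun s => (hd s).differentiableAt)
    (fun s => (hd s).deriv) 1 0
  have h4 : y 1 = x := by funext k; simp [y]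
  simpa [h4] using h3

theorem eq_C_of_vrot_eq_zero {p : Poly2} (h : vrot p = 0) :
    p = MvPolynomial.C (MvPolynomial.eval 0 p) := by
  have h0 : MvPolynomial.pderiv 1 p = 0 := congrFun h 0
  have h1 : MvPolynomial.pderiv 0 p = 0 := neg_eq_zero.1 (congrFun h 1)
  refine MvPolynomial.funext fun x => ?_
  have hd : ∀ s : ℝ, HasDerivAt (fun s => MvPolynomial.eval (fun k => s * x k) p) 0 s := by
    intro s
    refine (hasDerivAt_eval (x := fun s k => s * x k) (x' := x)
      (fun k => by simpa using (hasDerivAt_id' s).mul_const (x k)) p).congr_deriv ?_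
    simp [h0, h1]
  have h3 := is_const_of_deriv_eq_zero (fun s => (hd s).differentiableAt)
    (fun s => (hd s).deriv) 1 0
  simp only [one_mul, zero_mul] at h3
  rw [MvPolynomial.eval_C]
  exact h3

theorem vrot_C (a : ℝ) : vrot (MvPolynomial.C a) = 0 := by
  funext i
  fin_cases i <;> simp [vrot]

/-- The divergence is an isomorphism from `(x - c) P^m` to `P^m`. -/
def divKoszul (c : Plane) (m : ℤ) : polyT m ≃ₗ[ℝ] polyT m :=
  LinearEquiv.ofInjectiveEndo
    ((pdiv ∘ₗ koszul c ∘ₗ (polyT m).subtype).codRestrict (polyT m) (by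
      rintro ⟨p, hp⟩
      have h : koszul c p ∈ croly c (m + 1) := ⟨p, by simpa using hp, rfl⟩
      simpa using pdiv_mem_polyT (croly_le_vPolyT c (m + 1) h)))
    (by
      rw [injective_iff_map_eq_zero]
      rintro ⟨p, hp⟩ h
      exact Subtype.ext (eq_zero_of_pdiv_koszul_eq_zero c (congrArg Subtype.val h)))

theorem divKoszul_apply (c : Plane) (m : ℤ) (p : polyT m) :
    (divKoszul c m p : Poly2) = pdiv (koszul c p) := rfl

/-- A polynomial with prescribed values at finitely many points of the plane. -/
theorem exists_eval_eq {ι : Type*} [Finite ι] {x : ι → Plane} (hx : Function.Injective x)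
    (f : ι → ℝ) : ∃ p : Poly2, ∀ i, MvPolynomial.eval (fun k => x i k) p = f i := by
  classical
  have := Fintype.ofFinite ι
  let g : ι → ι → Poly2 := fun j i => ∑ k, (MvPolynomial.X k - MvPolynomial.C (x j k)) ^ 2
  have hg : ∀ i j, MvPolynomial.eval (fun k => x i k) (g j j) =
      (x i 0 - x j 0) ^ 2 + (x i 1 - x j 1) ^ 2 := by
    intro i j
    simp [g, Fin.sum_univ_two]
  have hg0 : ∀ i j, i ≠ j → MvPolynomial.eval (fun k => x i k) (g j j) ≠ 0 := by
    intro i j hij h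
    rw [hg] at h
    refine hij (hx ?_)
    have h0 : x i 0 - x j 0 = 0 := by nlinarith [sq_nonneg (x i 0 - x j 0), sq_nonneg (x i 1 - x j 1)]
    have h1 : x i 1 - x j 1 = 0 := by nlinarith [sq_nonneg (x i 0 - x j 0), sq_nonneg (x i 1 - x j 1)]
    ext k
    fin_cases k
    · exact sub_eq_zero.1 h0
    · exact sub_eq_zero.1 h1
  let L : ι → Poly2 := fun i => ∏ j ∈ Finset.univ.erase i, g j j
  have hL : ∀ i, MvPolynomial.eval (fun k => x i k) (L i) ≠ 0 := by
    intro i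
    simp only [L, map_prod]
    exact Finset.prod_ne_zero_iff.2 fun j hj => hg0 i j (Finset.ne_of_mem_erase hj).symm
  have hL0 : ∀ i j, i ≠ j → MvPolynomial.eval (fun k => x i k) (L j) = 0 := by
    intro i j hij
    simp only [L, map_prod]
    refine Finset.prod_eq_zero (Finset.mem_erase.2 ⟨hij, Finset.mem_univ i⟩) ?_
    rw [hg]
    ring
  refine ⟨∑ i, MvPolynomial.C (f i / MvPolynomial.eval (fun k => x i k) (L i)) * L i, fun i => ?_⟩
  rw [map_sum, Finset.sum_eq_single i]
  · rw [map_mul, MvPolynomial.eval_C, div_mul_cancel₀ _ (hL i)]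
  · intro j _ hj
    rw [map_mul, hL0 i j hj.symm, mul_zero]
  · simp

/-- Polynomials in the arc length have polynomial primitives. -/
theorem exists_derivative_eq {m : ℤ} (hm : 0 ≤ m + 1) {p : Polynomial ℝ} (hp : p ∈ polyE m) :
    ∃ P ∈ polyE (m + 1), Polynomial.derivative P = p := by
  have hdeg := Polynomial.degree_lt_iff_coeff_zero p (m + 1).toNat |>.1
    (PolygonalMesh.mem_polyE.1 hp)
  refine ⟨∑ n ∈ p.support, Polynomial.monomial (n + 1) (p.coeff n / (n + 1)), ?_, ?_⟩
  · refine Submodule.sum_mem _ fun n hn => ?_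
    rw [PolygonalMesh.mem_polyE]
    refine (Polynomial.degree_monomial_le _ _).trans_lt ?_
    have hn' : n < (m + 1).toNat := by
      by_contra h
      exact Polynomial.mem_support_iff.1 hn (hdeg n (not_lt.1 h))
    have : n + 1 < (m + 1 + 1).toNat := by omega
    exact_mod_cast this
  · rw [map_sum]
    conv_rhs => rw [Polynomial.as_sum_support p]
    refine Finset.sum_congr rfl fun n _ => ?_
    rw [Polynomial.derivative_monomial]
    have : (n : ℝ) + 1 ≠ 0 := by positivity
    push_cast
    rw [div_mul_cancel₀ _ this]

namespace PolygonalMesh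

variable {Ω : Set Plane} {ιT ιE ιV : Type*} (M : PolygonalMesh Ω ιT ιE ιV)

/-! ### Traces on edges and integration by parts -/

theorem derivative_restrE (E : ιE) (p : Poly2) : Polynomial.derivative (M.restrE E p) =
    M.tangent E 0 • M.restrE E (MvPolynomial.pderiv 0 p) +
      M.tangent E 1 • M.restrE E (MvPolynomial.pderiv 1 p) := by
  refine Polynomial.funext fun s => ?_
  have h1 : HasDerivAt (fun s => (M.restrE E p).eval s) _ s := (M.restrE E p).hasDerivAt s
  simp only [eval_restrE] at h1
  have h2 := hasDerivAt_eval (x := fun s k => M.pt E s k) (x' := fun k => M.tangent E k)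
    (s := s) (fun k => by
      simp only [pt, PiLp.add_apply, PiLp.smul_apply, smul_eq_mul]
      exact (((hasDerivAt_id' s).mul_const _).const_add _).congr_deriv (one_mul _)) p
  rw [h1.unique h2]
  simp [eval_restrE, Fin.sum_univ_two]

theorem normalTrace_vrot (E : ιE) (p : Poly2) :
    M.normalTrace E (vrot p) = -Polynomial.derivative (M.restrE E p) := by
  rw [derivative_restrE]
  simp only [normalTrace, vrot, normal, LinearMap.coe_mk, AddHom.coe_mk, Matrix.cons_val_zero,
    Matrix.cons_val_one, PiLp.toLp_apply, map_neg, neg_smul, smul_neg]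
  abel

theorem intE_derivative (E : ιE) (P : Polynomial ℝ) :
    M.intE E (Polynomial.derivative P) = P.eval (M.len E) - P.eval 0 :=
  intervalIntegral.integral_eq_sub_of_hasDerivAt (fun s _ => P.hasDerivAt s)
    ((Polynomial.continuous _).intervalIntegrable _ _)

theorem intE_mul_derivative (E : ιE) (P Q : Polynomial ℝ) :
    M.intE E (P * Polynomial.derivative Q) = P.eval (M.len E) * Q.eval (M.len E) -
      P.eval 0 * Q.eval 0 - M.intE E (Polynomial.derivative P * Q) := by
  have h := M.intE_derivative E (P * Q)
  rw [Polynomial.derivative_mul, map_add, Polynomial.eval_mul, Polynomial.eval_mul] at h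
  linarith

theorem intE_C_mul (E : ιE) (a : ℝ) (P : Polynomial ℝ) :
    M.intE E (Polynomial.C a * P) = a * M.intE E P := by
  rw [← Polynomial.smul_eq_C_mul, map_smul, smul_eq_mul]

theorem polyT_ext {T : ιT} {m : ℤ} {p q : polyT m}
    (h : ∀ r : polyT m, M.intT T (p * r) = M.intT T (q * r)) : p = q := by
  have h1 := M.l2T_definite T (p - q : polyT m) (by
    rw [l2T_apply]
    have := h (p - q)
    simp only [Submodule.coe_sub, sub_mul, map_sub] at this ⊢
    linarith)
  exact sub_eq_zero.1 (Subtype.ext h1)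

theorem polyE_ext {E : ιE} {m : ℤ} {p q : polyE m}
    (h : ∀ r : polyE m, M.intE E (p * r) = M.intE E (q * r)) : p = q := by
  have h1 := M.l2E_definite E (p - q : polyE m) (by
    rw [l2E_apply]
    have := h (p - q)
    simp only [Submodule.coe_sub, sub_mul, map_sub] at this ⊢
    linarith)
  exact sub_eq_zero.1 (Subtype.ext h1)

theorem l2V_ext {T : ιT} {X : Submodule ℝ VPoly2} {v w : X}
    (h : ∀ u : X, M.l2V T v u = M.l2V T w u) : v = w := by
  have h1 := M.l2V_definite T (v - w : X) (by
    have := h (v - w)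
    simp only [Submodule.coe_sub, map_sub, LinearMap.sub_apply] at this ⊢
    linarith)
  exact sub_eq_zero.1 (Subtype.ext h1)

theorem nonempty_vertex (M : PolygonalMesh Ω ιT ιE ιV) (hΩ : (closure Ω).Nonempty) :
    Nonempty ιV := by
  rw [M.elem_cover] at hΩ
  obtain ⟨x, hx⟩ := hΩ
  obtain ⟨T, -⟩ := mem_iUnion.1 hx
  obtain ⟨y, hy⟩ := M.nonempty_frontier_elem T
  obtain ⟨E, -⟩ := mem_iUnion.1 (M.frontier_subset_skel T hy)
  exact ⟨M.src E⟩

theorem edgePotential_eq {k : ℕ} {E : ιE} {q : M.SpaceV k} {P : Polynomial ℝ}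
    (hP : P ∈ polyE ((k : ℤ) + 1)) (h1 : M.projE E ((k : ℤ) - 1) P = q.2.1 E)
    (h2 : P.eval 0 = q.2.2 (M.src E)) (h3 : P.eval (M.len E) = q.2.2 (M.tgt E)) :
    (M.edgePotential k E q : Polynomial ℝ) = P := by
  obtain ⟨h1', h2', h3'⟩ := M.edgePotential_spec k E q
  have h : M.edgePotential k E q = ⟨P, hP⟩ := by
    refine M.edgeDofs_injective k E (Prod.ext ?_ (Prod.ext ?_ ?_))
    · exact h1'.trans h1.symm
    · exact h2'.trans h2.symm
    · exact h3'.trans h3.symm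
  rw [h]

theorem C_mem_polyE {m : ℤ} (hm : 0 ≤ m) (a : ℝ) : Polynomial.C a ∈ polyE m := by
  rw [mem_polyE]
  refine Polynomial.degree_C_le.trans_lt ?_
  have : 0 < (m + 1).toNat := by omega
  exact_mod_cast this

/-! ### Interpolation of constants -/

theorem projECont_const (E : ιE) (m : ℤ) (c : ℝ) :
    M.projECont E m (algebraMap ℝ C(Plane, ℝ) c) = M.projE E m (Polynomial.C c) := by
  refine M.polyE_ext (E := E) fun r => ?_
  rw [projECont_spec, projE_spec]
  simp [intE]

theorem intT_projTCont_const (T : ιT) (m : ℤ) (c : ℝ) {r : Poly2} (hr : r ∈ polyT m) :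
    M.intT T (M.projTCont T m (algebraMap ℝ C(Plane, ℝ) c) * r) = c * M.intT T r := by
  have h := M.projTCont_spec T m (algebraMap ℝ C(Plane, ℝ) c) ⟨r, hr⟩
  rw [h, intT_apply, ← integral_const_mul]
  rfl

theorem interpConst_apply (k : ℕ) (c : ℝ) : M.interpConst k c =
    (fun T => M.projTCont T _ (algebraMap ℝ C(Plane, ℝ) c),
      fun E => M.projECont E _ (algebraMap ℝ C(Plane, ℝ) c), fun _ => c) := rfl

theorem edgePotential_interpConst (k : ℕ) (E : ιE) (c : ℝ) :
    (M.edgePotential k E (M.interpConst k c) : Polynomial ℝ) = Polynomial.C c := by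
  refine M.edgePotential_eq (C_mem_polyE (by omega) c) ?_ ?_ ?_
  · exact (M.projECont_const E _ c).symm
  · exact Polynomial.eval_C
  · exact Polynomial.eval_C

variable [Fintype ιE]

/-! ### The divergence theorem -/

/-- The divergence theorem for polynomial vector fields on an element. -/
theorem intT_pdiv [Finite ιV] (T : ιT) (w : VPoly2) :
    M.intT T (pdiv w) = ∑ E ∈ M.edgesOf T, M.omega T E * M.intE E (M.normalTrace E w) := by
  rw [← M.sum_incidence_mul T fun E => M.intE E (M.normalTrace E w)]
  change M.intT T (MvPolynomial.pderiv 0 (w 0) + MvPolynomial.pderiv 1 (w 1)) = _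
  rw [map_add, intT_pderiv, intT_pderiv, ← Finset.sum_add_distrib]
  refine Finset.sum_congr rfl fun E _ => ?_
  simp only [normalTrace, LinearMap.coe_mk, AddHom.coe_mk, map_add, map_smul, smul_eq_mul]
  ring

/-- The boundary of an element is a cycle. -/
theorem sum_omega_mul_vertex_sub [Finite ιV] (T : ιT) (f : ιV → ℝ) :
    ∑ E ∈ M.edgesOf T, M.omega T E * (f (M.tgt E) - f (M.src E)) = 0 := by
  obtain ⟨p, hp⟩ := exists_eval_eq M.vtx_injective f
  have h := M.intT_pdiv T (vrot p)
  rw [pdiv_vrot, map_zero] at h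
  rw [← neg_eq_zero, h, ← Finset.sum_neg_distrib]
  refine Finset.sum_congr rfl fun E _ => ?_
  rw [normalTrace_vrot, map_neg, intE_derivative, eval_restrE, eval_restrE, pt_zero, pt_len,
    hp, hp]
  ring

/-- Integration by parts along the boundary of an element, for functions continuous at the
vertices. -/
theorem sum_omega_mul_intE_mul_normalTrace_vrot [Finite ιV] (T : ιT) (P : ιE → Polynomial ℝ)
    (φ : ιV → ℝ) (h0 : ∀ E, (P E).eval 0 = φ (M.src E))
    (h1 : ∀ E, (P E).eval (M.len E) = φ (M.tgt E)) (r : Poly2) :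
    ∑ E ∈ M.edgesOf T, M.omega T E * M.intE E (P E * M.normalTrace E (vrot r)) =
      ∑ E ∈ M.edgesOf T, M.omega T E *
        M.intE E (Polynomial.derivative (P E) * M.restrE E r) := by
  have h := M.sum_omega_mul_vertex_sub T fun ν => φ ν * MvPolynomial.eval (fun k => M.vtx ν k) r
  rw [← sub_eq_zero, ← neg_eq_zero, ← Finset.sum_sub_distrib, ← Finset.sum_neg_distrib, ← h]
  refine Finset.sum_congr rfl fun E _ => ?_
  rw [normalTrace_vrot, mul_neg, map_neg, intE_mul_derivative, eval_restrE, eval_restrE, pt_zero,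
    pt_len, h0, h1]
  ring

/-! ### Exactness -/

theorem discreteGradient_interpConst [Finite ιV] (k : ℕ) (c : ℝ) :
    M.discreteGradient k (M.interpConst k c) = 0 := by
  have hG : ∀ T, M.elemGradient k T (M.interpConst k c) = 0 := by
    intro T
    refine M.l2V_ext (T := T) fun w => ?_
    rw [elemGradient_spec]
    simp only [edgePotential_interpConst, intE_C_mul]
    rw [interpConst_apply, intT_projTCont_const _ _ _ _ (pdiv_mem_polyT w.2), intT_pdiv, Finset.mul_sum]
    simp only [mul_left_comm _ c, neg_add_cancel, Submodule.coe_zero, map_zero,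
      LinearMap.zero_apply]
  have hE : ∀ E, M.edgeGradient k E (M.interpConst k c) = 0 := by
    intro E
    refine Subtype.ext ?_
    change Polynomial.derivative (M.edgePotential k E (M.interpConst k c) : Polynomial ℝ) = 0
    rw [edgePotential_interpConst, Polynomial.derivative_C]
  refine Prod.ext (funext fun T => Prod.ext ?_ ?_) (Prod.ext (funext fun E => ?_) rfl)
  · change M.projV T _ (M.elemGradient k T (M.interpConst k c)) = 0
    rw [hG, Submodule.coe_zero, map_zero]
  · change M.projV T _ (M.elemGradient k T (M.interpConst k c)) = 0
    rw [hG, Submodule.coe_zero, map_zero]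
  · change (M.edgeGradient k E (M.interpConst k c), 0) = _
    rw [hE]
    rfl

theorem discreteRotor_discreteGradient [Finite ιV] (k : ℕ) (q : M.SpaceV k) :
    M.discreteRotor k (M.discreteGradient k q) = 0 := by
  refine Prod.ext (funext fun T => ?_) rfl
  change M.elemRotor k T (M.discreteGradient k q) = 0
  refine M.polyT_ext (T := T) fun r => ?_
  have hr : vrot r ∈ roly ((k : ℤ) - 1) := ⟨r, by simp, rfl⟩
  have hr' : vrot r ∈ vPolyT (k : ℤ) := by
    rw [mem_vPolyT_iff]
    exact fun i => polyT_mono (by omega) (mem_vPolyT_iff.1 (roly_le_vPolyT _ hr) i)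
  have h1 := M.projV_spec T _ (M.elemGradient k T q) ⟨vrot r, hr⟩
  have h2 := M.elemGradient_spec k T q ⟨vrot r, hr'⟩
  simp only [pdiv_vrot, mul_zero, map_zero, neg_zero, zero_add] at h2
  rw [M.sum_omega_mul_intE_mul_normalTrace_vrot T
    (fun E => (M.edgePotential k E q : Polynomial ℝ)) q.2.2
    (fun E => (M.edgePotential_spec k E q).2.1) (fun E => (M.edgePotential_spec k E q).2.2)] at h2
  rw [elemRotor_spec, Submodule.coe_zero, zero_mul, map_zero, sub_eq_zero]
  exact h1.trans h2

variable [Fintype ιT]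

/-- The edge gradients determine the edge and vertex components up to one constant, since the
skeleton is connected, and the components of the element gradients in the Koszul complements
determine the element components. -/
theorem exists_interpConst_eq [Finite ιV] (hΩ : IsConnected (closure Ω))
    (hT : ∀ T, ContractibleSpace (M.elem T)) {k : ℕ} {q : M.SpaceV k}
    (hq : M.discreteGradient k q = 0) : ∃ c, M.interpConst k c = q := by
  have hE : ∀ E, (M.edgePotential k E q : Polynomial ℝ) = Polynomial.C (q.2.2 (M.src E)) := by
    intro E
    have h1 : M.edgeGradient k E q = 0 :=
      congrArg Prod.fst (congrFun (congrArg (fun v => v.2.1) hq) E)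
    have h2 : Polynomial.derivative (M.edgePotential k E q : Polynomial ℝ) = 0 :=
      congrArg Subtype.val h1
    have h3 := Polynomial.eq_C_of_derivative_eq_zero h2
    have h4 := (M.edgePotential_spec k E q).2.1
    rw [h3, Polynomial.eval_C] at h4
    rw [h3, h4]
  have hends : ∀ E, q.2.2 (M.src E) = q.2.2 (M.tgt E) := by
    intro E
    have h := (M.edgePotential_spec k E q).2.2
    rwa [hE, Polynomial.eval_C] at h
  have := M.nonempty_vertex hΩ.nonempty
  let ν₀ : ιV := Classical.arbitrary ιV
  have hν : ∀ ν, q.2.2 ν = q.2.2 ν₀ := fun ν =>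
    M.apply_vertex_eq hΩ.isPreconnected hT q.2.2 hends ν ν₀
  refine ⟨q.2.2 ν₀, ?_⟩
  rw [interpConst_apply]
  refine Prod.ext (funext fun T => ?_) (Prod.ext (funext fun E => ?_) (funext fun ν => (hν ν).symm))
  · change M.projTCont T _ _ = q.1 T
    refine M.polyT_ext (T := T) fun r => ?_
    rw [intT_projTCont_const _ _ _ _ r.2]
    obtain ⟨p, rfl⟩ := (divKoszul (M.center T) ((k : ℤ) - 1)).surjective r
    rw [divKoszul_apply]
    have hw : koszul (M.center T) p ∈ croly (M.center T) k := ⟨p, p.2, rfl⟩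
    have h1 : M.projV T (croly (M.center T) k) (M.elemGradient k T q) = 0 :=
      congrArg Prod.snd (congrFun (congrArg Prod.fst hq) T)
    have h2 := M.projV_spec T _ (M.elemGradient k T q) ⟨_, hw⟩
    have h3 := M.elemGradient_spec k T q ⟨_, croly_le_vPolyT _ _ hw⟩
    rw [h1] at h2
    simp only [Submodule.coe_zero, map_zero, LinearMap.zero_apply] at h2
    rw [← h2] at h3
    simp only [hE, hν, intE_C_mul, mul_left_comm _ (q.2.2 ν₀), ← Finset.mul_sum, ← intT_pdiv] at h3
    linarith
  · change M.projECont E _ _ = q.2.1 E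
    rw [projECont_const, ← (M.edgePotential_spec k E q).1, hE, hν (M.src E)]

/-- The rotor of `v`, tested with `r = 1`, gives vanishing circulations, hence a potential on the
skeleton; tested with the other `r`, it determines the component of `v` in `rot P^k`. -/
theorem exists_discreteGradient_eq [Finite ιV] [ContractibleSpace (closure Ω)] {k : ℕ}
    {v : M.SpaceSigma k} (hv : M.discreteRotor k v = 0) : ∃ q, M.discreteGradient k q = v := by
  have hR : ∀ T, ∀ r : polyT (k : ℤ), M.l2V T (v.1 T).1 (vrot r) =
      ∑ E ∈ M.edgesOf T, M.omega T E * M.intE E ((v.2.1 E).1 * M.restrE E r) := by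
    intro T r
    have h1 : M.elemRotor k T v = 0 := congrFun (congrArg Prod.fst hv) T
    have h2 := M.elemRotor_spec k T v r
    rw [h1, Submodule.coe_zero, zero_mul, map_zero] at h2
    linarith
  -- the circulation of the edge components vanishes, so they have a potential
  obtain ⟨φ, hφ⟩ := M.exists_potential (fun E => M.intE E (v.2.1 E).1) (fun T => by
    rw [M.sum_incidence_mul T fun E => M.intE E (v.2.1 E).1]
    have h := hR T ⟨MvPolynomial.C 1, C_mem_polyT (by omega) 1⟩
    rw [vrot_C, map_zero] at h
    rw [h]
    simp)
  have hP : ∀ E, ∃ P ∈ polyE ((k : ℤ) + 1), Polynomial.derivative P = (v.2.1 E).1 ∧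
      P.eval 0 = φ (M.src E) := by
    intro E
    obtain ⟨P, hP, hP'⟩ := exists_derivative_eq (by omega) (v.2.1 E).1.2
    refine ⟨P + Polynomial.C (φ (M.src E) - P.eval 0),
      Submodule.add_mem _ hP (C_mem_polyE (by omega) _), ?_, ?_⟩
    · rw [Polynomial.derivative_add, Polynomial.derivative_C, add_zero, hP']
    · rw [Polynomial.eval_add, Polynomial.eval_C, add_sub_cancel]
  choose P hPmem hPd hP0 using hP
  have hPl : ∀ E, (P E).eval (M.len E) = φ (M.tgt E) := by
    intro E
    have h := M.intE_derivative E (P E)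
    rw [hPd, hP0, ← hφ E] at h
    linarith
  -- the element components are determined by the components of `v` in the Koszul complements
  let l : ∀ T, VPoly2 →ₗ[ℝ] ℝ := fun T =>
    (∑ E ∈ M.edgesOf T, M.omega T E • (M.l2E E (P E)) ∘ₗ M.normalTrace E) - M.l2V T (v.1 T).2
  have hl : ∀ T w, l T w = ∑ E ∈ M.edgesOf T, M.omega T E *
      M.intE E (P E * M.normalTrace E w) - M.l2V T (v.1 T).2 w := by
    intro T w
    simp [l, l2E_apply]
  let qT : ∀ T, polyT ((k : ℤ) - 1) := fun T =>
    rieszRep (M.l2T T) (M.l2T_definite T) (polyT ((k : ℤ) - 1))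
      ((l T ∘ₗ koszul (M.center T) ∘ₗ (polyT ((k : ℤ) - 1)).subtype) ∘ₗ
        (divKoszul (M.center T) ((k : ℤ) - 1)).symm.toLinearMap)
  have hqT : ∀ T (p : polyT ((k : ℤ) - 1)),
      M.intT T (qT T * pdiv (koszul (M.center T) p)) = l T (koszul (M.center T) p) := by
    intro T p
    have h := rieszRep_spec (M.l2T T) (M.l2T_definite T) (polyT ((k : ℤ) - 1))
      ((l T ∘ₗ koszul (M.center T) ∘ₗ (polyT ((k : ℤ) - 1)).subtype) ∘ₗ
        (divKoszul (M.center T) ((k : ℤ) - 1)).symm.toLinearMap)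
      (divKoszul (M.center T) ((k : ℤ) - 1) p)
    rw [l2T_apply, divKoszul_apply] at h
    refine h.trans ?_
    simp
  let q : M.SpaceV k := (qT, fun E => M.projE E _ (P E), φ)
  have hq : ∀ E, (M.edgePotential k E q : Polynomial ℝ) = P E := fun E =>
    M.edgePotential_eq (hPmem E) rfl (hP0 E) (hPl E)
  have hC : ∀ E, (v.2.1 E).2 = 0 := fun E => congrFun (congrArg (fun w => w.2.1) hv) E
  have hν : ∀ ν, v.2.2 ν = 0 := fun ν => congrFun (congrArg (fun w => w.2.2) hv) ν
  refine ⟨q, Prod.ext (funext fun T => Prod.ext ?_ ?_)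
    (Prod.ext (funext fun E => Prod.ext (Subtype.ext ?_) (hC E).symm)
      (funext fun ν => (hν ν).symm))⟩
  · change M.projV T _ (M.elemGradient k T q) = (v.1 T).1
    refine M.l2V_ext (T := T) fun w => ?_
    rw [projV_spec]
    obtain ⟨w, hw⟩ := w
    have hw' : w ∈ vPolyT (k : ℤ) := by
      rw [mem_vPolyT_iff]
      exact fun i => polyT_mono (by omega) (mem_vPolyT_iff.1 (roly_le_vPolyT _ hw) i)
    have h := M.elemGradient_spec k T q ⟨w, hw'⟩
    obtain ⟨r, hr, rfl⟩ := hw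
    rw [sub_add_cancel] at hr
    refine h.trans ?_
    simp only [hq]
    rw [pdiv_vrot, mul_zero, map_zero, neg_zero, zero_add,
      M.sum_omega_mul_intE_mul_normalTrace_vrot T P φ hP0 hPl]
    simp only [hPd]
    exact (hR T ⟨r, hr⟩).symm
  · change M.projV T _ (M.elemGradient k T q) = (v.1 T).2
    refine M.l2V_ext (T := T) fun w => ?_
    rw [projV_spec]
    obtain ⟨w, hw⟩ := w
    have h := M.elemGradient_spec k T q ⟨w, croly_le_vPolyT _ _ hw⟩
    obtain ⟨p, hp, rfl⟩ := hw
    refine h.trans ?_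
    have h1 := hqT T ⟨p, hp⟩
    rw [hl] at h1
    simp only [hq]
    change -M.intT T (qT T * _) + _ = _
    rw [h1]
    ring
  · change Polynomial.derivative (M.edgePotential k E q : Polynomial ℝ) = _
    rw [hq, hPd]

/-- Circulations around the elements can be prescribed arbitrarily: this is dual to the linear
independence of the boundaries of the elements. -/
theorem exists_sum_incidence_mul_eq [Finite ιV] (b : ιT → ℝ) :
    ∃ a : ιE → ℝ, ∀ T, ∑ E, M.incidence T E * a E = b T := by
  classical
  let d : (ιE → ℝ) →ₗ[ℝ] (ιT → ℝ) := Matrix.mulVecLin (Matrix.of M.incidence)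
  have hd : ∀ a T, d a T = ∑ E, M.incidence T E * a E := fun a T => rfl
  suffices h : b ∈ LinearMap.range d by
    obtain ⟨a, ha⟩ := h
    exact ⟨a, fun T => congrFun ha T⟩
  by_contra hcon
  obtain ⟨F, hFb, hF⟩ := Submodule.exists_le_ker_of_notMem hcon
  have hFc : ∀ b, F b = ∑ T, F (Pi.single T 1) * b T := by
    intro b
    rw [LinearMap.pi_apply_eq_sum_univ F b]
    refine Finset.sum_congr rfl fun T _ => ?_
    rw [smul_eq_mul, mul_comm]
    congr 2
    funext T'
    simp [Pi.single_apply, eq_comm]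
  have h0 := M.eq_zero_of_sum_incidence_eq_zero (fun T => F (Pi.single T 1)) (fun E => by
    have h := hF ⟨Pi.single E 1, rfl⟩
    rw [LinearMap.mem_ker, hFc] at h
    rw [← h]
    refine Finset.sum_congr rfl fun T _ => ?_
    rw [hd, mul_comm]
    simp [Pi.single_apply])
  refine hFb ?_
  rw [hFc]
  exact Finset.sum_eq_zero fun T _ => by rw [congrFun h0 T, Pi.zero_apply, zero_mul]

theorem discreteRotor_surjective [Finite ιV] (k : ℕ) :
    Function.Surjective (M.discreteRotor k) := by
  intro w
  obtain ⟨a, ha⟩ := M.exists_sum_incidence_mul_eq fun T => -M.intT T (w.1 T)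
  -- constant edge components with the integrals required by the test functions `r = 1`
  let vE : ∀ _ : ιE, polyE (k : ℤ) := fun E =>
    ⟨Polynomial.C (a E / M.len E), C_mem_polyE (by omega) _⟩
  have hvE : ∀ E, M.intE E (vE E) = a E := by
    intro E
    have hl := (M.len_pos E).ne'
    simp only [vE, intE, LinearMap.coe_mk, AddHom.coe_mk, Polynomial.eval_C,
      intervalIntegral.integral_const, sub_zero, smul_eq_mul]
    field_simp
  let L : ∀ T, Poly2 →ₗ[ℝ] ℝ := fun T => M.l2T T (w.1 T) +
    ∑ E ∈ M.edgesOf T, M.omega T E • (M.l2E E (vE E)) ∘ₗ (M.restrE E).toLinearMap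
  have hL : ∀ T r, L T r = M.intT T (w.1 T * r) +
      ∑ E ∈ M.edgesOf T, M.omega T E * M.intE E (vE E * M.restrE E r) := by
    intro T r
    simp [L, l2E_apply, l2T_apply]
  have hL1 : ∀ T c, L T (MvPolynomial.C c) = 0 := by
    intro T c
    have h1 : (MvPolynomial.C c : Poly2) = c • 1 := by
      rw [MvPolynomial.smul_eq_C_mul, mul_one]
    rw [h1, map_smul, hL]
    simp only [map_one, mul_one, hvE]
    rw [← M.sum_incidence_mul T a, ha, add_neg_cancel, smul_zero]
  -- the remaining condition only sees `rot r`
  have hv : ∀ T, ∃ u : roly ((k : ℤ) - 1), ∀ r : polyT (k : ℤ), M.l2V T u (vrot r) = L T r := by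
    intro T
    have hmem : ∀ r : polyT (k : ℤ), vrot r ∈ roly ((k : ℤ) - 1) := fun r =>
      ⟨r, by simp, rfl⟩
    let f : polyT (k : ℤ) →ₗ[ℝ] roly ((k : ℤ) - 1) :=
      (vrot ∘ₗ (polyT (k : ℤ)).subtype).codRestrict _ hmem
    have hf : LinearMap.range f = ⊤ := by
      rw [LinearMap.range_eq_top]
      rintro ⟨_, r, hr, rfl⟩
      rw [sub_add_cancel] at hr
      exact ⟨⟨r, hr⟩, rfl⟩
    obtain ⟨g, hg⟩ := f.exists_rightInverse_of_surjective hf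
    refine ⟨rieszRep (M.l2V T) (M.l2V_definite T) _
      ((L T ∘ₗ (polyT (k : ℤ)).subtype) ∘ₗ g), fun r => ?_⟩
    have h := rieszRep_spec (M.l2V T) (M.l2V_definite T) _
      ((L T ∘ₗ (polyT (k : ℤ)).subtype) ∘ₗ g) (f r)
    refine h.trans ?_
    have h1 : f (g (f r) - r) = 0 := by
      rw [map_sub, sub_eq_zero]
      exact LinearMap.congr_fun hg (f r)
    have h2 : vrot ((g (f r) : Poly2) - (r : Poly2)) = 0 := congrArg Subtype.val h1
    have h3 := hL1 T (MvPolynomial.eval 0 ((g (f r) : Poly2) - (r : Poly2)))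
    rw [← eq_C_of_vrot_eq_zero h2, map_sub, sub_eq_zero] at h3
    exact h3
  choose u hu using hv
  refine ⟨(fun T => (u T, 0), fun E => (vE E, w.2.1 E), w.2.2),
    Prod.ext (funext fun T => ?_) rfl⟩
  refine M.polyT_ext (T := T) fun r => ?_
  refine (M.elemRotor_spec k T _ r).trans ?_
  simp only
  rw [hu, hL]
  ring

end PolygonalMesh

end RotRot

end

theorem mainTheorem3 {ιT ιE ιV : Type*} [Fintype ιT] [Fintype ιE] [Fintype ιV]
    (Ω : Set RotRot.Plane) (hΩ : RotRot.IsPolygonalSet Ω)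
    (hΩc : ContractibleSpace (closure Ω))
    (M : RotRot.PolygonalMesh Ω ιT ιE ιV)
    (hT : ∀ T, ContractibleSpace (M.elem T)) (k : ℕ) :
    Function.Exact (M.interpConst k) (M.discreteGradient k) ∧
      Function.Exact (M.discreteGradient k) (M.discreteRotor k) ∧
      Function.Surjective (M.discreteRotor k) := by
  refine ⟨fun q => ⟨fun hq => ?_, ?_⟩, fun v => ⟨fun hv => ?_, ?_⟩, M.discreteRotor_surjective k⟩
  · exact M.exists_interpConst_eq hΩ.1.closure hT hq
  · rintro ⟨c, rfl⟩
    exact M.discreteGradient_interpConst k c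
  · exact M.exists_discreteGradient_eq hv
  · rintro ⟨q, rfl⟩
    exact M.discreteRotor_discreteGradient k q
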